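/- **Setting.** Let $\Omega=\mathbb R^{\mathbb N}$ with the $\sigma$-algebra $\mathcal B_\Omega$ of all universally measurable sets, i.e. of the sets that are measurable up to null sets for every Borel probability measure. For a measurable space $(X,\mathcal B)$ let $\mathcal B_{\mathcal G}$ denote its universal completion, i.e. the $\sigma$-algebra of the sets that are measurable up to null sets for every probability measure on $(X,\mathcal B)$. A *quasi-universal space* is a set $X$ with a set $X^\Omega$ of maps $\Omega\to X$ ("random variables") that contains all constant maps and is closed under precomposition with measurable maps $(\Omega,\mathcal B_\Omega)\to(\Omega,\mathcal B_\Omega)$. A map $h:X\to Y$ is *quasi-measurable* if $h\circ\alpha\in Y^\Omega$ for all $\alpha\in X^\Omega$. The space $X$ carries the $\sigma$-algebra $\mathcal B_X=\{A\subseteq X : \alpha^{-1}(A)\in\mathcal B_\Omega\ \text{for all}\ \alpha\in X^\Omega\}$. The product $X\times Y$ has as random variables the pairs of random variables, and $\mathbf 1$ is the one-point space. A quasi-universal space $X$ is *universal* if $X^\Omega$ consists of all measurable maps $(\Omega,\mathcal B_\Omega)\to(X,\mathcal B_X)$ and $(X,(\mathcal B_X)_{\mathcal G})$ is isomorphic to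 a set $Z\in\mathcal B_\Omega$ with the $\sigma$-algebra induced from $\mathcal B_\Omega$ (so the empty space is universal). Let $\mathbf{UQUS}$ be the category of universal quasi-universal spaces and quasi-measurable maps. Let $\mathcal Q(\Omega)$ be the set of probability measures $\nu$ on $(\Omega,\mathcal B_\Omega)$ such that $\omega\mapsto\nu(D_\omega)$ is measurable for all $D\in\mathcal B_{\Omega\times\Omega}$, where $D_\omega=\{y:(\omega,y)\in D\}$. Let $\mathcal Q(\Omega)^\Omega$ be the set of maps $\kappa:\Omega\to\mathcal Q(\Omega)$ such that $\omega\mapsto\kappa(\varphi(\omega))(D_\omega)$ is measurable for all measurable $\varphi:\Omega\to\Omega$ and all $D\in\mathcal B_{\Omega\times\Omega}$. For a quasi-universal space $X$ let $\mathcal P(X)=\{\alpha_*\nu : \alpha\in X^\Omega,\ \nu\in\mathcal Q(\Omega)\}$, a set of probability measures on $(X,\mathcal B_X)$, with $\mathcal P(X)^\Omega=\{\omega\mapsto\alpha_*\kappa(\omega) : \alpha\in X^\Omega,\ \kappa\in\mathcal Q(\Omega)^\Omega\}$. It is functorial by push-forward, with $\delta_X(x)=\delta_x$ (Dirac measure)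 and $\mathbb M_X(\pi)(A)=\int\mu(A)\,\pi(d\mu)$. **Theorem.** 1. $(\mathbf{UQUS},\times,\mathbf 1)$ is a symmetric cartesian monoidal category that is not closed. It has countable products and countable coproducts. 2. If $X$ is in $\mathbf{UQUS}$, then so is $\mathcal P(X)$. The triple $(\mathcal P,\delta,\mathbb M)$ is a monad on $\mathbf{UQUS}$, and the maps $\tau_{X,Y}:X\times\mathcal P(Y)\to\mathcal P(X\times Y)$, $(x,\mu)\mapsto\delta_x\otimes\mu$ (the push-forward of $\mu$ along $y\mapsto(x,y)$) are morphisms that form a strength. With this strength the monad is commutative (the two induced maps $\mathcal P(X)\times\mathcal P(Y)\to\mathcal P(X\times Y)$ agree) and affine ($\mathcal P(\mathbf 1)\cong\mathbf 1$). It is a symmetric monoidal monad: $\mathcal P$ is lax symmetric monoidal with structure maps $\delta_{\mathbf 1}$ and the double strength, and $\delta$, $\mathbb M$ are monoidal natural transformations. 3. The Kleisli category of $\mathcal P$ on $\mathbf{UQUS}$, with tensor product $X\otimes Y=X\times Y$ induced by the strength, and with the symmetry, the copy maps $\Delta_X:X\to X\otimes X$ and the discard maps $\varepsilon_X:X\to\mathbf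 1$ induced by those of $\mathbf{UQUS}$, is a Markov category. Moreover: * It is a.s.-compatibly representable. That is, every object $X$ has a distribution object: an object $D$ with a morphism $s:D\to X$ such that every morphism $f:A\to X$ equals $s\circ f^\sharp$ for a unique deterministic morphism $f^\sharp:A\to D$. Moreover, for every distribution object $(D,s)$ of an object $X$, every $p:\Theta\to A$ and all $f,g:A\to X$, the morphisms $f$ and $g$ are $p$-almost surely equal if and only if $f^\sharp$ and $g^\sharp$ are. Here $f,g$ are $p$-a.s. equal if $(\mathrm{id}_A\otimes f)\circ\Delta_A\circ p=(\mathrm{id}_A\otimes g)\circ\Delta_A\circ p$. * It has conditionals: for every $f:A\to X\otimes Y$ there is $c:X\otimes A\to Y$ such that $f=(\mathrm{id}_X\otimes c)\circ(\Delta_X\otimes\mathrm{id}_A)\circ(f_X\otimes\mathrm{id}_A)\circ\Delta_A$, where $f_X:A\to X$ is the marginal of $f$ (coherence isomorphisms omitted). * It has countable Kolmogorov products, in particular countable Kolmogorov powers: for every sequence $(X_n)_{n\in\mathbb N}$ of objects, the diagram of the finite tensor products $X_0\otimes\dots\otimes X_{n-1}$ and the maps that discard the last factor has a limit whose projections are deterministic,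 and this limit is preserved by $-\otimes Y$ for every object $Y$. -/

import Mathlib

open MeasureTheory CategoryTheory MonoidalCategory CartesianMonoidalCategory Limits

universe u v w

noncomputable section

/-! ### Universally measurable sets and the sample space -/

/-- The universal completion of a `σ`-algebra: the sets that are measurable up to null sets for
every probability measure. -/
abbrev univCompletion {X : Type u} (m : MeasurableSpace X) : MeasurableSpace X where
  MeasurableSet' A := ∀ μ : Measure X, IsProbabilityMeasure μ → NullMeasurableSet A μ
  measurableSet_empty _ _ := MeasurableSet.empty.nullMeasurableSet
  measurableSet_compl _ hA μ hμ := (hA μ hμ).compl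
  measurableSet_iUnion _ hA μ hμ := NullMeasurableSet.iUnion fun i => hA i μ hμ

theorem le_univCompletion {X : Type u} (m : MeasurableSpace X) : m ≤ univCompletion m :=
  fun _ hA _ _ => hA.nullMeasurableSet

theorem measurable_univCompletion {X : Type u} {Y : Type v} {m : MeasurableSpace X}
    {m' : MeasurableSpace Y} {f : Y → X} (hf : @Measurable _ _ (univCompletion m') m f) :
    @Measurable _ _ (univCompletion m') (univCompletion m) f := by
  intro A hA μ hμ
  have hnm : @Measurable (NullMeasurableSpace Y μ) X
      NullMeasurableSpace.instMeasurableSpace m f := fun B hB => hf hB μ hμ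
  let ρ : Measure X := @Measure.map (NullMeasurableSpace Y μ) X _ m f μ.completion
  have hc : IsProbabilityMeasure μ.completion := ⟨hμ.measure_univ⟩
  have hρ : IsProbabilityMeasure ρ :=
    @Measure.isProbabilityMeasure_map (NullMeasurableSpace Y μ) X _ m μ.completion hc f
      hnm.aemeasurable
  have hpre : NullMeasurableSet (α := NullMeasurableSpace Y μ) (f ⁻¹' A) μ.completion :=
    (hA ρ hρ).preimage (hnm.quasiMeasurePreserving _)
  exact hpre.measurable_of_complete

/-- The sample space: the space of sequences of real numbers. -/
def Omega : Type := ℕ → ℝ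

/-- The product of the Borel `σ`-algebras on the sample space. -/
abbrev borelOmega : MeasurableSpace Omega := inferInstanceAs (MeasurableSpace (ℕ → ℝ))

/-- The sample space carries the `σ`-algebra of universally measurable sets. -/
instance Omega.measurableSpace : MeasurableSpace Omega := univCompletion borelOmega

instance : Inhabited Omega := inferInstanceAs (Inhabited (ℕ → ℝ))

theorem measurable_omega_of_borel {f : Omega → Omega}
    (hf : @Measurable _ _ borelOmega borelOmega f) : Measurable f :=
  measurable_univCompletion (hf.mono (le_univCompletion _) le_rfl)

theorem measurable_omega_iff {f : Omega → Omega} :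
    Measurable f ↔ @Measurable _ _ Omega.measurableSpace borelOmega f :=
  ⟨fun h => h.mono le_rfl (le_univCompletion _), fun h => measurable_univCompletion h⟩

/-! ### Quasi-measurable spaces -/

/-- A quasi-measurable space over the sample space: a set with a set of "random variables" that
contains the constants and is stable under precomposition with measurable endomorphisms. -/
structure QUS : Type (u + 1) where
  carrier : Type u
  rv : Set (Omega → carrier)
  comp_mem : ∀ α ∈ rv, ∀ φ : Omega → Omega, Measurable φ → α ∘ φ ∈ rv
  const_mem : ∀ x : carrier, (fun _ => x) ∈ rv

namespace QUS

instance : CoeSort QUS.{u} (Type u) := ⟨QUS.carrier⟩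

/-- The `σ`-algebra of the sets all of whose preimages under random variables are measurable. -/
instance measurableSpace (X : QUS.{u}) : MeasurableSpace X.carrier where
  MeasurableSet' A := ∀ α ∈ X.rv, MeasurableSet (α ⁻¹' A)
  measurableSet_empty _ _ := MeasurableSet.empty
  measurableSet_compl _ hA α hα := (hA α hα).compl
  measurableSet_iUnion f hA α hα := by
    rw [Set.preimage_iUnion]; exact MeasurableSet.iUnion fun i => hA i α hα

theorem measurableSet_iff {X : QUS.{u}} {A : Set X} :
    MeasurableSet A ↔ ∀ α ∈ X.rv, MeasurableSet (α ⁻¹' A) := Iff.rfl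

theorem measurable_of_mem {X : QUS.{u}} {α : Omega → X} (hα : α ∈ X.rv) : Measurable α :=
  fun _ hA => hA α hα

/-- Quasi-measurable maps: the maps that preserve random variables. -/
@[ext]
structure Hom (X Y : QUS.{u}) where
  toFun : X → Y
  map_mem : ∀ α ∈ X.rv, toFun ∘ α ∈ Y.rv

instance : Category QUS.{u} where
  Hom := Hom
  id X := ⟨id, fun _ hα => hα⟩
  comp f g := ⟨g.toFun ∘ f.toFun, fun α hα => g.map_mem _ (f.map_mem α hα)⟩

@[ext] theorem hom_ext {X Y : QUS.{u}} {f g : X ⟶ Y} (h : ∀ x, f.toFun x = g.toFun x) : f = g :=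
  Hom.ext (funext h)

@[simp] theorem id_toFun (X : QUS.{u}) (x : X) : Hom.toFun (𝟙 X) x = x := rfl

@[simp] theorem comp_toFun {X Y Z : QUS.{u}} (f : X ⟶ Y) (g : Y ⟶ Z) (x : X) :
    (f ≫ g).toFun x = g.toFun (f.toFun x) := rfl

theorem Hom.measurable {X Y : QUS.{u}} (f : X ⟶ Y) : Measurable f.toFun :=
  fun _ hA α hα => hA _ (f.map_mem α hα)

/-- The sample space as a quasi-measurable space. -/
def omega : QUS.{0} where
  carrier := Omega
  rv := {φ | Measurable φ}
  comp_mem _ hα _ hφ := Measurable.comp hα hφ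
  const_mem _ := measurable_const

/-- The one-point space. -/
def unit : QUS.{u} where
  carrier := PUnit
  rv := Set.univ
  comp_mem _ _ _ _ := trivial
  const_mem _ := trivial

/-- The product space: random variables are pairs of random variables. -/
def prod (X : QUS.{u}) (Y : QUS.{v}) : QUS.{max u v} where
  carrier := X.carrier × Y.carrier
  rv := {α | (fun ω => (α ω).1) ∈ X.rv ∧ (fun ω => (α ω).2) ∈ Y.rv}
  comp_mem _ hα φ hφ := ⟨X.comp_mem _ hα.1 φ hφ, Y.comp_mem _ hα.2 φ hφ⟩
  const_mem x := ⟨X.const_mem x.1, Y.const_mem x.2⟩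

/-! ### Universal quasi-universal spaces -/

/-- A universal measurable space: its universal completion is isomorphic to a measurable subset of
the sample space. -/
def IsUniversalMeasurable {X : Type u} (m : MeasurableSpace X) : Prop :=
  ∃ S : Set Omega, MeasurableSet S ∧
    Nonempty (@MeasurableEquiv X S (univCompletion m) Subtype.instMeasurableSpace)

/-- A universal quasi-universal space: its `σ`-algebra is that of a universal measurable space, and
its random variables are exactly the measurable maps. -/
def IsUniversal : ObjectProperty QUS.{u} := fun X =>
  IsUniversalMeasurable X.measurableSpace ∧ X.rv = {α | Measurable α}

theorem univCompletion_measurableSpace (X : QUS.{u}) :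
    univCompletion X.measurableSpace = X.measurableSpace :=
  le_antisymm (fun _ hA _ hα => measurable_univCompletion (measurable_of_mem hα) hA)
    (le_univCompletion _)

theorem IsUniversal.exists_equiv {X : QUS.{u}} (h : IsUniversal X) :
    ∃ S : Set Omega, MeasurableSet S ∧ ∃ e : X.carrier ≃ S,
      X.rv = {α | Measurable fun ω => (e (α ω) : Omega)} := by
  obtain ⟨⟨S, hS, he⟩, hrv⟩ := h
  rw [univCompletion_measurableSpace] at he
  obtain ⟨e⟩ := he
  refine ⟨S, hS, e.toEquiv, ?_⟩
  rw [hrv]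
  ext α
  constructor
  · intro hα
    exact measurable_subtype_coe.comp (e.measurable.comp hα)
  · intro hα
    have h1 : Measurable fun ω => e (α ω) := Measurable.subtype_mk (p := (· ∈ S)) hα
    have h2 := e.symm.measurable.comp h1
    have h3 : e.symm ∘ (fun ω => e (α ω)) = α := by funext ω; simp
    rwa [h3] at h2

theorem isUniversal_of_equiv {X : QUS.{u}} {S : Set Omega} (hS : MeasurableSet S)
    (e : X.carrier ≃ S) (hrv : X.rv = {α | Measurable fun ω => (e (α ω) : Omega)}) :
    IsUniversal X := by
  have key : ∀ A : Set X.carrier, MeasurableSet A ↔ MeasurableSet (e.symm ⁻¹' A) := by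
    intro A
    constructor
    · intro hA
      rcases S.eq_empty_or_nonempty with h0 | ⟨s, hs⟩
      · subst h0
        have : e.symm ⁻¹' A = ∅ := by ext ⟨x, hx⟩; exact hx.elim
        rw [this]; exact MeasurableSet.empty
      · classical
        let r : Omega → S := fun ω => if h : ω ∈ S then ⟨ω, h⟩ else ⟨s, hs⟩
        have hr : Measurable fun ω => (r ω : Omega) := by
          have : (fun ω => (r ω : Omega)) = fun ω => if ω ∈ S then ω else s := by
            funext ω; by_cases h : ω ∈ S <;> simp [r, h]
          rw [this]
          exact Measurable.ite hS measurable_id measurable_const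
        have hα : (fun ω => e.symm (r ω)) ∈ X.rv := by
          rw [hrv]; simpa using hr
        have h1 := hA _ hα
        have h2 : e.symm ⁻¹' A = Subtype.val ⁻¹' ((fun ω => e.symm (r ω)) ⁻¹' A) := by
          ext x; simp [r]
        rw [h2]; exact measurable_subtype_coe h1
    · intro hA α hα
      rw [hrv] at hα
      have h1 : Measurable fun ω => e (α ω) := Measurable.subtype_mk (p := (· ∈ S)) hα
      have h2 := h1 hA
      have h3 : (fun ω => e (α ω)) ⁻¹' (e.symm ⁻¹' A) = α ⁻¹' A := by ext; simp
      rwa [h3] at h2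
  refine ⟨⟨S, hS, ?_⟩, ?_⟩
  · rw [univCompletion_measurableSpace]
    refine ⟨⟨e, fun A hA => (key _).2 ?_, fun A hA => (key A).1 hA⟩⟩
    have : e.symm ⁻¹' (e ⁻¹' A) = A := by ext; simp
    rwa [this]
  · ext α
    refine ⟨fun hα => measurable_of_mem hα, fun hα => ?_⟩
    rw [hrv]
    have he : Measurable e := fun A hA => (key _).2 (by
      have : e.symm ⁻¹' (e ⁻¹' A) = A := by ext; simp
      rwa [this])
    exact measurable_subtype_coe.comp (he.comp hα)

theorem isUniversal_unit : IsUniversal unit.{u} := by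
  have hS : MeasurableSet ({default} : Set Omega) :=
    le_univCompletion borelOmega _ (MeasurableSingletonClass.measurableSet_singleton (α := ℕ → ℝ) _)
  refine isUniversal_of_equiv hS
    ⟨fun _ => ⟨default, rfl⟩, fun _ => PUnit.unit, fun _ => rfl, fun x => Subtype.ext x.2.symm⟩ ?_
  ext α
  exact ⟨fun _ => measurable_const, fun _ => trivial⟩

theorem isUniversal_prod {X : QUS.{u}} {Y : QUS.{v}} (hX : IsUniversal X) (hY : IsUniversal Y) :
    IsUniversal (X.prod Y) := by
  obtain ⟨S, hS, e, he⟩ := hX.exists_equiv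
  obtain ⟨T, hT, f, hf⟩ := hY.exists_equiv
  have hu : ¬ Countable (ℕ → ℝ) := fun h => Cardinal.not_countable_real
    (Set.countable_univ_iff.2 (Function.Surjective.countable (f := fun x : ℕ → ℝ => x 0)
      fun r => ⟨fun _ => r, rfl⟩))
  have φ : (ℕ → ℝ) × (ℕ → ℝ) ≃ᵐ (ℕ → ℝ) := PolishSpace.measurableEquivOfNotCountable
    (fun h => hu (Function.Surjective.countable 
      (f := fun p : (ℕ → ℝ) × (ℕ → ℝ) => p.1) fun a => ⟨(a, a), rfl⟩)) hu
  let φ' : Omega × Omega ≃ Omega := φ.toEquiv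
  have h1 : Measurable fun ω : Omega => (φ'.symm ω).1 :=
    measurable_omega_of_borel (measurable_fst.comp φ.symm.measurable)
  have h2 : Measurable fun ω : Omega => (φ'.symm ω).2 :=
    measurable_omega_of_borel (measurable_snd.comp φ.symm.measurable)
  have hpair : ∀ a b : Omega → Omega, Measurable a → Measurable b →
      Measurable fun ω => φ' (a ω, b ω) := by
    intro a b ha hb
    rw [measurable_omega_iff] at ha hb ⊢
    exact φ.measurable.comp (Measurable.prodMk (α := ℕ → ℝ) (β := ℕ → ℝ) ha hb)
  let U : Set Omega := {ω | (φ'.symm ω).1 ∈ S ∧ (φ'.symm ω).2 ∈ T}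
  have hU : MeasurableSet U := (h1 hS).inter (h2 hT)
  let g : (X.prod Y).carrier ≃ U :=
    { toFun := fun p => ⟨φ' (e p.1, f p.2), by simp [U]⟩
      invFun := fun ω => (e.symm ⟨_, ω.2.1⟩, f.symm ⟨_, ω.2.2⟩)
      left_inv := fun p => Prod.ext (by simp) (by simp)
      right_inv := fun ω => by ext; simp }
  refine isUniversal_of_equiv hU g ?_
  ext α
  change (fun ω => (α ω).1) ∈ X.rv ∧ (fun ω => (α ω).2) ∈ Y.rv ↔
    Measurable fun ω => φ' ((e (α ω).1 : Omega), (f (α ω).2 : Omega))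
  rw [he, hf]
  constructor
  · rintro ⟨ha, hb⟩
    exact hpair _ _ ha hb
  · intro h
    have ha := h1.comp h
    have hb := h2.comp h
    simp only [Function.comp_def, Equiv.symm_apply_apply] at ha hb
    exact ⟨ha, hb⟩

end QUS

/-- The category of universal quasi-universal spaces and quasi-measurable maps. -/
abbrev UQUS : Type (u + 1) := (QUS.IsUniversal.{u}).FullSubcategory

namespace UQUS

/-- The underlying set. -/
abbrev carrier (X : UQUS.{u}) : Type u := X.obj.carrier

/-- The underlying map of a morphism. -/
abbrev fn {X Y : UQUS.{u}} (f : X ⟶ Y) : X.carrier → Y.carrier := f.hom.toFun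

theorem hom_ext' {X Y : UQUS.{u}} {f g : X ⟶ Y} (h : ∀ x, fn f x = fn g x) : f = g :=
  ObjectProperty.hom_ext _ (QUS.hom_ext h)

/-- The one-point space. -/
def unit : UQUS.{u} := ⟨QUS.unit, QUS.isUniversal_unit⟩

/-- The product space. -/
def prod (X Y : UQUS.{u}) : UQUS.{u} := ⟨X.obj.prod Y.obj, QUS.isUniversal_prod X.2 Y.2⟩

/-- The first projection. -/
def fst (X Y : UQUS.{u}) : prod X Y ⟶ X := ObjectProperty.homMk ⟨Prod.fst, fun _ hα => hα.1⟩

/-- The second projection. -/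
def snd (X Y : UQUS.{u}) : prod X Y ⟶ Y := ObjectProperty.homMk ⟨Prod.snd, fun _ hα => hα.2⟩

/-- The map into a product given by its components. -/
def lift {X Y Z : UQUS.{u}} (f : Z ⟶ X) (g : Z ⟶ Y) : Z ⟶ prod X Y :=
  ObjectProperty.homMk ⟨fun z => (fn f z, fn g z),
    fun α hα => ⟨f.hom.map_mem α hα, g.hom.map_mem α hα⟩⟩

/-- The one-point space is terminal. -/
def isTerminalUnit : IsTerminal unit.{u} :=
  IsTerminal.ofUniqueHom (fun _ => ObjectProperty.homMk ⟨fun _ => PUnit.unit, fun _ _ => trivial⟩)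
    fun _ _ => hom_ext' fun _ => rfl

/-- The product space is a categorical product. -/
def isLimitProd (X Y : UQUS.{u}) : IsLimit (BinaryFan.mk (fst X Y) (snd X Y)) :=
  BinaryFan.IsLimit.mk _ (fun f g => lift f g) (fun _ _ => rfl) (fun _ _ => rfl)
    fun f g m h1 h2 => hom_ext' fun z => by
      subst h1 h2; rfl

/-- The cartesian monoidal structure given by the product spaces. -/
instance : CartesianMonoidalCategory UQUS.{u} :=
  .ofChosenFiniteProducts ⟨_, isTerminalUnit⟩ fun X Y => ⟨_, isLimitProd X Y⟩

instance : BraidedCategory UQUS.{u} := .ofCartesianMonoidalCategory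


end UQUS

/-! ### The probability monad -/

namespace QUS

/-- The probability measures on the sample space used to define push-forward measures:
`ω ↦ ν (D_ω)` is measurable for every measurable set `D` of the product of the sample space with
itself, where `D_ω` is the section of `D` at `ω`. -/
def IsQ (ν : Measure Omega) : Prop :=
  IsProbabilityMeasure ν ∧ ∀ D : Set (omega.prod omega), MeasurableSet D →
    Measurable fun ω : Omega => ν {y | (ω, y) ∈ D}

/-- The random variables of the space of such probability measures. -/
def IsQRV (κ : Omega → Measure Omega) : Prop :=
  (∀ ω, IsQ (κ ω)) ∧ ∀ φ : Omega → Omega, Measurable φ →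
    ∀ D : Set (omega.prod omega), MeasurableSet D →
      Measurable fun ω : Omega => κ (φ ω) {y | (ω, y) ∈ D}

/-- The space of push-forward probability measures along random variables. -/
def Prob (X : QUS.{u}) : QUS.{u} where
  carrier := {μ : Measure X // ∃ α ∈ X.rv, ∃ ν, IsQ ν ∧ μ = ν.map α}
  rv := {β | ∃ α ∈ X.rv, ∃ κ, IsQRV κ ∧ ∀ ω, (β ω).1 = (κ ω).map α}
  comp_mem := by
    rintro β ⟨α, hα, κ, hκ, h⟩ φ hφ
    exact ⟨α, hα, κ ∘ φ, ⟨fun ω => hκ.1 _, fun ψ hψ => hκ.2 (φ ∘ ψ) (hφ.comp hψ)⟩,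
      fun ω => h (φ ω)⟩
  const_mem := by
    rintro ⟨μ, α, hα, ν, hν, h⟩
    exact ⟨α, hα, fun _ => ν, ⟨fun _ => hν, fun _ _ => hν.2⟩, fun _ => h⟩

theorem measurable_section {D : Set (omega.prod omega)} (hD : MeasurableSet D) (ω : Omega) :
    MeasurableSet {y : Omega | (ω, y) ∈ D} :=
  hD (fun y => (ω, y)) ⟨measurable_const, measurable_id⟩

theorem IsQRV.measurable {κ : Omega → Measure Omega} (hκ : IsQRV κ) : Measurable κ := by
  refine Measure.measurable_of_measurable_coe _ fun A hA => ?_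
  exact hκ.2 id measurable_id {p : Omega × Omega | p.2 ∈ A} fun α hα => hα.2 hA

theorem IsQRV.measurable_lintegral {κ : Omega → Measure Omega} (hκ : IsQRV κ) {φ : Omega → Omega}
    (hφ : Measurable φ) {F : omega.prod omega → ENNReal} (hF : Measurable F) :
    Measurable fun ω : Omega => ∫⁻ y, F (ω, y) ∂κ (φ ω) := by
  have hsec : ∀ {F : omega.prod omega → ENNReal}, Measurable F → ∀ ω : Omega,
      Measurable fun y : Omega => F (ω, y) := fun hF ω A hA => measurable_section (hF hA) ω
  refine Measurable.ennreal_induction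
    (motive := fun F => Measurable fun ω : Omega => ∫⁻ y, F (ω, y) ∂κ (φ ω)) ?_ ?_ ?_ hF
  · intro c D hD
    have : (fun ω : Omega => ∫⁻ y, D.indicator (fun _ => c) (ω, y) ∂κ (φ ω)) =
        fun ω : Omega => c * κ (φ ω) {y | (ω, y) ∈ D} := by
      funext ω
      have h := lintegral_indicator_const (μ := κ (φ ω)) (measurable_section hD ω) c
      exact h
    rw [this]
    exact (hκ.2 φ hφ D hD).const_mul c
  · intro f g _ hf hg ihf ihg
    have : (fun ω : Omega => ∫⁻ y, (f + g) (ω, y) ∂κ (φ ω)) =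
        fun ω : Omega => (∫⁻ y, f (ω, y) ∂κ (φ ω)) + ∫⁻ y, g (ω, y) ∂κ (φ ω) := by
      funext ω
      exact lintegral_add_left (hsec hf ω) _
    rw [this]
    exact ihf.add ihg
  · intro f hf hmono ih
    have : (fun ω : Omega => ∫⁻ y, (⨆ n, f n (ω, y)) ∂κ (φ ω)) =
        fun ω : Omega => ⨆ n, ∫⁻ y, f n (ω, y) ∂κ (φ ω) := by
      funext ω
      exact lintegral_iSup (fun n => hsec (hf n) ω) fun m n hmn y => hmono hmn _
    rw [this]
    exact Measurable.iSup ih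

theorem IsQRV.const {ν : Measure Omega} (hν : IsQ ν) : IsQRV fun _ => ν :=
  ⟨fun _ => hν, fun _ _ => hν.2⟩

/-- Sections of a kernel evaluated on sections of a set are jointly measurable. -/
theorem IsQRV.measurable_uncurry {κ : Omega → Measure Omega} (hκ : IsQRV κ)
    {D : Set (omega.prod omega)} (hD : MeasurableSet D) :
    Measurable fun p : omega.prod omega => κ p.2 {y | (p.1, y) ∈ D} := by
  intro B hB α hα
  have h := hκ.2 (fun t => (α t).2) hα.2 {q : Omega × Omega | ((α q.1).1, q.2) ∈ D}
    fun β hβ => hD (fun t => ((α (β t).1).1, (β t).2)) ⟨hα.1.comp hβ.1, hβ.2⟩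
  exact h hB

theorem isQRV_dirac : IsQRV fun ω => Measure.dirac ω := by
  have key : ∀ φ : Omega → Omega, Measurable φ → ∀ D : Set (omega.prod omega),
      MeasurableSet D → Measurable fun ω : Omega => Measure.dirac (φ ω) {y | (ω, y) ∈ D} := by
    intro φ hφ D hD
    have : (fun ω : Omega => Measure.dirac (φ ω) {y | (ω, y) ∈ D}) =
        fun ω => ((fun ω => ((ω, φ ω) : Omega × Omega)) ⁻¹' D).indicator (fun _ => 1) ω := by
      funext ω
      rw [Measure.dirac_apply' _ (measurable_section hD ω)]
      rfl
    rw [this]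
    exact measurable_const.indicator (hD (fun ω => (ω, φ ω)) ⟨measurable_id, hφ⟩)
  exact ⟨fun ω => ⟨Measure.dirac.isProbabilityMeasure, key _ measurable_const⟩, key⟩

theorem IsQRV.bind {κ ρ : Omega → Measure Omega} (hκ : IsQRV κ) (hρ : IsQRV ρ) :
    IsQRV fun ω => (ρ ω).bind κ := by
  have key : ∀ φ : Omega → Omega, Measurable φ → ∀ D : Set (omega.prod omega),
      MeasurableSet D → Measurable fun ω : Omega => (ρ (φ ω)).bind κ {y | (ω, y) ∈ D} := by
    intro φ hφ D hD
    have : (fun ω : Omega => (ρ (φ ω)).bind κ {y | (ω, y) ∈ D}) =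
        fun ω : Omega => ∫⁻ z, κ z {y | (ω, y) ∈ D} ∂ρ (φ ω) := by
      funext ω
      exact Measure.bind_apply (measurable_section hD ω) hκ.measurable.aemeasurable
    rw [this]
    exact hρ.measurable_lintegral hφ (hκ.measurable_uncurry hD)
  refine ⟨fun ω => ⟨⟨?_⟩, key _ measurable_const⟩, key⟩
  rw [Measure.bind_apply MeasurableSet.univ hκ.measurable.aemeasurable]
  have : IsProbabilityMeasure (ρ ω) := (hρ.1 ω).1
  have h1 : ∀ z, κ z Set.univ = 1 := fun z => (hκ.1 z).1.measure_univ
  simp [h1]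

/-- The underlying measure. -/
def Prob.val {X : QUS.{u}} (μ : Prob X) : Measure X := Subtype.val μ

theorem Prob.measurable_val (X : QUS.{u}) : Measurable (Prob.val (X := X)) := by
  refine Measure.measurable_of_measurable_coe _ fun A hA B hB => ?_
  rintro β ⟨α, hα, κ, hκ, h⟩
  have h1 : Measurable fun ω => κ ω (α ⁻¹' A) :=
    (Measure.measurable_coe (hA α hα)).comp hκ.measurable
  have h2 : (fun ω => (Prob.val (β ω)) A) = fun ω => κ ω (α ⁻¹' A) := by
    funext ω
    have h3 : (Prob.val (β ω)) = (κ ω).map α := h ω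
    rw [h3, Measure.map_apply (measurable_of_mem hα) hA]
  have h3 := h1 hB
  rw [← h2] at h3
  exact h3

theorem Prob.measurable_val_apply {X : QUS.{u}} {A : Set X} (hA : MeasurableSet A) :
    Measurable fun μ : Prob X => (Prob.val μ) A :=
  (Measure.measurable_coe hA).comp (measurable_val X)

theorem Prob.bind_val_apply {X : QUS.{u}} (π : Measure (Prob X)) {A : Set X}
    (hA : MeasurableSet A) : π.bind Prob.val A = ∫⁻ μ, (Prob.val μ) A ∂π :=
  Measure.bind_apply hA (measurable_val X).aemeasurable

/-- Push-forward of measures along a quasi-measurable map. -/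
def Prob.map {X Y : QUS.{u}} (f : X ⟶ Y) : Prob X ⟶ Prob Y where
  toFun μ := ⟨(Prob.val μ).map f.toFun, by
    obtain ⟨μ, α, hα, ν, hν, rfl⟩ := μ
    exact ⟨_, f.map_mem α hα, ν, hν, Measure.map_map f.measurable (measurable_of_mem hα)⟩⟩
  map_mem := by
    rintro β ⟨α, hα, κ, hκ, h⟩
    refine ⟨_, f.map_mem α hα, κ, hκ, fun ω => ?_⟩
    change (Prob.val (β ω)).map _ = _
    have h' : (Prob.val (β ω)) = (κ ω).map α := h ω
    rw [h', Measure.map_map f.measurable (measurable_of_mem hα)]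

/-- The Dirac measures. -/
def Prob.dirac (X : QUS.{u}) : X ⟶ Prob X where
  toFun x := ⟨Measure.dirac x, fun _ => x, X.const_mem x, Measure.dirac default,
    isQRV_dirac.1 _, (Measure.map_dirac' measurable_const _).symm⟩
  map_mem α hα := ⟨α, hα, _, isQRV_dirac,
    fun ω => (Measure.map_dirac' (measurable_of_mem hα) ω).symm⟩

theorem bind_map_aux {X : QUS.{u}} {α : Omega → X} (hα : α ∈ X.rv) {κ : Omega → Measure Omega}
    (hκ : IsQRV κ) {β : Omega → Prob X} (hβ : β ∈ (Prob X).rv)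
    (h : ∀ ω, (Prob.val (β ω)) = (κ ω).map α) (ρ : Measure Omega) :
    (ρ.map β).bind Prob.val = (ρ.bind κ).map α := by
  ext A hA
  have hα' := measurable_of_mem hα
  rw [Prob.bind_val_apply _ hA, Measure.map_apply hα' hA,
    Measure.bind_apply (hα' hA) hκ.measurable.aemeasurable,
    lintegral_map (Prob.measurable_val_apply hA) (measurable_of_mem hβ)]
  refine lintegral_congr fun ω => ?_
  rw [h, Measure.map_apply hα' hA]

/-- The mixture `A ↦ ∫ μ(A) π(dμ)` of a probability measure `π` on probability measures. -/
def Prob.join (X : QUS.{u}) : Prob (Prob X) ⟶ Prob X where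
  toFun π := ⟨(Prob.val π).bind Prob.val, by
    obtain ⟨π, β, ⟨α, hα, κ, hκ, h⟩, ν, hν, rfl⟩ := π
    exact ⟨α, hα, ν.bind κ, (hκ.bind (IsQRV.const hν)).1 default,
      bind_map_aux hα hκ ⟨α, hα, κ, hκ, h⟩ h ν⟩⟩
  map_mem := by
    rintro γ ⟨β, ⟨α, hα, κ, hκ, h⟩, ρ, hρ, hγ⟩
    refine ⟨α, hα, _, hκ.bind hρ, fun ω => ?_⟩
    change (Prob.val (γ ω)).bind _ = _
    have h' : (Prob.val (γ ω)) = (ρ ω).map β := hγ ω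
    rw [h']
    exact bind_map_aux hα hκ ⟨α, hα, κ, hκ, h⟩ h (ρ ω)

theorem prob_ext {X Y : QUS.{u}} {f g : X ⟶ Prob Y} (h : ∀ x, Prob.val (f.toFun x) = Prob.val (g.toFun x)) :
    f = g :=
  QUS.hom_ext fun x => Subtype.ext (h x)

/-- The functor of push-forward probability measures. -/
def probFunctor : QUS.{u} ⥤ QUS.{u} where
  obj := Prob
  map := Prob.map
  map_id _ := prob_ext fun _ => Measure.map_id
  map_comp f g := prob_ext fun _ => (Measure.map_map g.measurable f.measurable).symm

theorem Prob.bind_map_map {X Y : QUS.{u}} (f : X ⟶ Y) (π : Measure (Prob X)) :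
    (π.map (Prob.map f).toFun).bind Prob.val = (π.bind Prob.val).map f.toFun := by
  ext A hA
  rw [Prob.bind_val_apply _ hA, Measure.map_apply f.measurable hA,
    Prob.bind_val_apply _ (f.measurable hA),
    lintegral_map (Prob.measurable_val_apply hA) (Prob.map f).measurable]
  exact lintegral_congr fun μ => Measure.map_apply f.measurable hA

theorem Prob.bind_map_join (X : QUS.{u}) (π : Measure (Prob (Prob X))) :
    (π.map (Prob.join X).toFun).bind Prob.val = (π.bind Prob.val).bind Prob.val := by
  rw [Measure.bind_bind (Prob.measurable_val _).aemeasurable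
    (Prob.measurable_val X).aemeasurable]
  ext A hA
  rw [Prob.bind_val_apply _ hA,
    lintegral_map (Prob.measurable_val_apply hA) (Prob.join X).measurable]
  exact (Measure.bind_apply hA
    ((Prob.measurable_val X).comp (Prob.join X).measurable).aemeasurable).symm

theorem Prob.bind_map_dirac (X : QUS.{u}) (μ : Measure X) :
    (μ.map (Prob.dirac X).toFun).bind Prob.val = μ := by
  ext A hA
  rw [Prob.bind_val_apply _ hA,
    lintegral_map (Prob.measurable_val_apply hA) (Prob.dirac X).measurable]
  exact (Measure.bind_apply hA Measure.measurable_dirac.aemeasurable).symm.trans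
    (by rw [Measure.bind_dirac])

/-- The probability monad on quasi-measurable spaces. -/
def probMonad : Monad QUS.{u} where
  toFunctor := probFunctor
  η := { app := Prob.dirac
         naturality := fun _ _ f => prob_ext fun x => (Measure.map_dirac' f.measurable x).symm }
  μ := { app := Prob.join
         naturality := fun _ _ f => prob_ext fun π => Prob.bind_map_map f (Prob.val π) }
  assoc X := prob_ext fun π => Prob.bind_map_join X (Prob.val π)
  left_unit X := prob_ext fun μ => Measure.dirac_bind (Prob.measurable_val X) μ
  right_unit X := prob_ext fun μ => Prob.bind_map_dirac X (Prob.val μ)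

end QUS

namespace UQUS

/-- Universal quasi-universal spaces are stable under the formation of the space of push-forward
probability measures. -/
def ProbClosed : Prop := ∀ X : QUS.{u}, QUS.IsUniversal X → QUS.IsUniversal X.Prob

/-- The probability monad restricted to universal quasi-universal spaces. -/
def probMonad (hP : ProbClosed.{u}) : Monad UQUS.{u} where
  obj X := ⟨X.obj.Prob, hP X.obj X.property⟩
  map f := ObjectProperty.homMk (QUS.Prob.map f.hom)
  map_id X := ObjectProperty.hom_ext _ (QUS.probMonad.map_id X.obj)
  map_comp f g := ObjectProperty.hom_ext _ (QUS.probMonad.map_comp f.hom g.hom)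
  η := { app := fun X => ObjectProperty.homMk (QUS.Prob.dirac X.obj)
         naturality := fun _ _ f => ObjectProperty.hom_ext _ (QUS.probMonad.η.naturality f.hom) }
  μ := { app := fun X => ObjectProperty.homMk (QUS.Prob.join X.obj)
         naturality := fun _ _ f => ObjectProperty.hom_ext _ (QUS.probMonad.μ.naturality f.hom) }
  assoc X := ObjectProperty.hom_ext _ (QUS.probMonad.assoc X.obj)
  left_unit X := ObjectProperty.hom_ext _ (QUS.probMonad.left_unit X.obj)
  right_unit X := ObjectProperty.hom_ext _ (QUS.probMonad.right_unit X.obj)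

end UQUS

/-! ### Strong, commutative, affine and symmetric monoidal monads -/

namespace CategoryTheory.Monad

variable {C : Type u} [Category.{v} C] [MonoidalCategory C]

/-- A family of maps `X ⊗ T Y ⟶ T (X ⊗ Y)`. -/
abbrev StrengthMap (T : Monad C) := ∀ X Y : C, X ⊗ T.obj Y ⟶ T.obj (X ⊗ Y)

/-- The axioms of a (left) strength. -/
structure IsStrength (T : Monad C) (τ : StrengthMap T) : Prop where
  naturality : ∀ {X X' Y Y' : C} (f : X ⟶ X') (g : Y ⟶ Y'),
    (f ⊗ₘ T.map g) ≫ τ X' Y' = τ X Y ≫ T.map (f ⊗ₘ g)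
  left_unitor : ∀ X : C, τ (𝟙_ C) X ≫ T.map (λ_ X).hom = (λ_ (T.obj X)).hom
  associator : ∀ X Y Z : C, τ (X ⊗ Y) Z ≫ T.map (α_ X Y Z).hom =
    (α_ X Y (T.obj Z)).hom ≫ (X ◁ τ Y Z) ≫ τ X (Y ⊗ Z)
  unit : ∀ X Y : C, (X ◁ T.η.app Y) ≫ τ X Y = T.η.app (X ⊗ Y)
  mult : ∀ X Y : C, (X ◁ T.μ.app Y) ≫ τ X Y =
    τ X (T.obj Y) ≫ T.map (τ X Y) ≫ T.μ.app (X ⊗ Y)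

variable [BraidedCategory C] {T : Monad C} (τ : StrengthMap T)

/-- The right strength obtained by exchanging the factors. -/
def costrength (X Y : C) : T.obj X ⊗ Y ⟶ T.obj (X ⊗ Y) :=
  (β_ (T.obj X) Y).hom ≫ τ Y X ≫ T.map (β_ Y X).hom

/-- The double strength. -/
def doubleStrength (X Y : C) : T.obj X ⊗ T.obj Y ⟶ T.obj (X ⊗ Y) :=
  τ (T.obj X) Y ≫ T.map (costrength τ X Y) ≫ T.μ.app (X ⊗ Y)

/-- A strength is commutative if the two double strengths agree. -/
def IsCommutative : Prop :=
  ∀ X Y : C, doubleStrength τ X Y = costrength τ X (T.obj Y) ≫ T.map (τ X Y) ≫ T.μ.app (X ⊗ Y)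

/-- The monad is a symmetric monoidal monad with the unit `η` and the double strength as structure
maps: its functor is lax symmetric monoidal, and its unit and multiplication are monoidal natural
transformations. -/
def IsSymmetricMonoidal : Prop :=
  ∃ _ : T.toFunctor.LaxBraided,
    Functor.LaxMonoidal.ε T.toFunctor = T.η.app (𝟙_ C) ∧
    (∀ X Y : C, Functor.LaxMonoidal.μ T.toFunctor X Y = doubleStrength τ X Y) ∧
    NatTrans.IsMonoidal T.η ∧ NatTrans.IsMonoidal T.μ

/-- A monad is affine if it preserves the terminal object. -/
def IsAffine {C : Type u} [Category.{v} C] [CartesianMonoidalCategory C] (T : Monad C) : Prop :=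
  IsIso (toUnit (T.obj (𝟙_ C)))

end CategoryTheory.Monad

/-! ### The Kleisli category -/

namespace CategoryTheory.Kleisli

variable {C : Type u} [Category.{v} C] [MonoidalCategory C] [BraidedCategory C] (T : Monad C)
  (τ : Monad.StrengthMap T)

/-- The tensor product of the Kleisli category of a monad with a strength. -/
@[reducible]
def monoidalStruct : MonoidalCategoryStruct (Kleisli T) where
  tensorObj X Y := .mk T (X.of ⊗ Y.of)
  tensorUnit := .mk T (𝟙_ C)
  tensorHom f g := .mk ((f.of ⊗ₘ g.of) ≫ Monad.doubleStrength τ _ _)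
  whiskerLeft X _ _ f := .mk ((X.of ◁ f.of) ≫ τ _ _)
  whiskerRight f Y := .mk ((f.of ▷ Y.of) ≫ Monad.costrength τ _ _)
  associator X Y Z := (Adjunction.toKleisli T).mapIso (α_ X.of Y.of Z.of)
  leftUnitor X := (Adjunction.toKleisli T).mapIso (λ_ X.of)
  rightUnitor X := (Adjunction.toKleisli T).mapIso (ρ_ X.of)

end CategoryTheory.Kleisli

/-- The given tensor product satisfies the laws of a monoidal category. -/
def IsMonoidalStruct {C : Type u} [Category.{v} C] (S : MonoidalCategoryStruct C) : Prop :=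
  ∃ M : MonoidalCategory C, M.toMonoidalCategoryStruct = S

/-- The monoidal category with the given tensor product. -/
@[reducible]
def monoidalOfStruct {C : Type u} [Category.{v} C] (S : MonoidalCategoryStruct C)
    (h : IsMonoidalStruct S) : MonoidalCategory C where
  toMonoidalCategoryStruct := S
  tensorHom_def := by obtain ⟨M, rfl⟩ := h; exact M.tensorHom_def
  id_tensorHom_id := by obtain ⟨M, rfl⟩ := h; exact M.id_tensorHom_id
  tensorHom_comp_tensorHom := by obtain ⟨M, rfl⟩ := h; exact M.tensorHom_comp_tensorHom
  whiskerLeft_id := by obtain ⟨M, rfl⟩ := h; exact M.whiskerLeft_id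
  id_whiskerRight := by obtain ⟨M, rfl⟩ := h; exact M.id_whiskerRight
  associator_naturality := by obtain ⟨M, rfl⟩ := h; exact M.associator_naturality
  leftUnitor_naturality := by obtain ⟨M, rfl⟩ := h; exact M.leftUnitor_naturality
  rightUnitor_naturality := by obtain ⟨M, rfl⟩ := h; exact M.rightUnitor_naturality
  pentagon := by obtain ⟨M, rfl⟩ := h; exact M.pentagon
  triangle := by obtain ⟨M, rfl⟩ := h; exact M.triangle

namespace CategoryTheory.Kleisli

open ComonObj

variable {C : Type u} [Category.{v} C] [CartesianMonoidalCategory C] [BraidedCategory C]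
  (T : Monad C) (τ : Monad.StrengthMap T)

/-- The symmetry, the copy maps and the discard maps of a Markov category structure on the Kleisli
category are the images of the symmetry, the diagonals and the maps to the unit object. -/
def IsCanonicalMarkov (h : IsMonoidalStruct (monoidalStruct T τ))
    (K : letI := monoidalOfStruct _ h; MarkovCategory (Kleisli T)) : Prop :=
  letI := monoidalOfStruct _ h
  letI := K
  (∀ X Y : C, (β_ (Kleisli.mk T X) (Kleisli.mk T Y)).hom =
    (Adjunction.toKleisli T).map (β_ X Y).hom) ∧
  (∀ X : C, Δ[Kleisli.mk T X] = (Adjunction.toKleisli T).map (lift (𝟙 X) (𝟙 X))) ∧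
  (∀ X : C, ε[Kleisli.mk T X] = (Adjunction.toKleisli T).map (toUnit X))

end CategoryTheory.Kleisli

/-! ### Notions for Markov categories -/

namespace CategoryTheory.MarkovCategory

open CopyDiscardCategory ComonObj

variable {C : Type u} [Category.{v} C] [MonoidalCategory C] [MarkovCategory C]

/-- Almost sure equality of `f` and `g` with respect to `p`. -/
def ASEq {S A X : C} (p : S ⟶ A) (f g : A ⟶ X) : Prop :=
  p ≫ Δ[A] ≫ (A ◁ f) = p ≫ Δ[A] ≫ (A ◁ g)

/-- A distribution object `D` for `X` with sampling map `samp`: the morphisms to `X` correspond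
bijectively to the deterministic morphisms to `D` by composition with `samp`. -/
def IsDistributionObject {X D : C} (samp : D ⟶ X) : Prop :=
  ∀ (A : C) (f : A ⟶ X), ∃! g : A ⟶ D, Deterministic g ∧ g ≫ samp = f

variable (C)

/-- A Markov category is representable if every object has a distribution object. -/
def IsRepresentable : Prop :=
  ∀ X : C, ∃ (D : C) (samp : D ⟶ X), IsDistributionObject samp

/-- A representable Markov category is almost surely compatibly representable if the correspondence
between morphisms and deterministic morphisms respects almost sure equality. -/
def IsASCompatiblyRepresentable : Prop :=
  IsRepresentable C ∧ ∀ (X D : C) (samp : D ⟶ X), IsDistributionObject samp →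
    ∀ (S A : C) (p : S ⟶ A) (g h : A ⟶ D), Deterministic g → Deterministic h →
      (ASEq p (g ≫ samp) (h ≫ samp) ↔ ASEq p g h)

/-- Every morphism `f : A ⟶ X ⊗ Y` has a conditional `c : X ⊗ A ⟶ Y`: one recovers `f` by copying
the input, sampling from the marginal of `f` on `X`, copying the result and applying `c`. -/
def HasConditionals : Prop :=
  ∀ (A X Y : C) (f : A ⟶ X ⊗ Y), ∃ c : X ⊗ A ⟶ Y,
    f = Δ[A] ≫ ((f ≫ (X ◁ ε[Y]) ≫ (ρ_ X).hom) ▷ A) ≫ (Δ[X] ▷ A) ≫ (α_ X X A).hom ≫ (X ◁ c)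

variable {C}

/-- The finite tensor products `X 0 ⊗ ⋯ ⊗ X (n - 1)`. -/
def finTensor (X : ℕ → C) : ℕ → C
  | 0 => 𝟙_ C
  | n + 1 => finTensor X n ⊗ X n

/-- The map that discards the last factor. -/
def dropLast (X : ℕ → C) (n : ℕ) : finTensor X (n + 1) ⟶ finTensor X n :=
  (finTensor X n ◁ ε[X n]) ≫ (ρ_ (finTensor X n)).hom

/-- A Kolmogorov product of a sequence of objects: a limit of the finite tensor products with
deterministic projections, which remains a limit after tensoring with any object `Y`. -/
structure IsKolmogorovProduct (X : ℕ → C) (L : C) (π : ∀ n, L ⟶ finTensor X n) : Prop where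
  deterministic : ∀ n, Deterministic (π n)
  comp_dropLast : ∀ n, π (n + 1) ≫ dropLast X n = π n
  existsUnique_lift : ∀ (A : C) (f : ∀ n, A ⟶ finTensor X n),
    (∀ n, f (n + 1) ≫ dropLast X n = f n) → ∃! g : A ⟶ L, ∀ n, g ≫ π n = f n
  existsUnique_lift_tensor : ∀ (Y A : C) (f : ∀ n, A ⟶ finTensor X n ⊗ Y),
    (∀ n, f (n + 1) ≫ (dropLast X n ▷ Y) = f n) →
      ∃! g : A ⟶ L ⊗ Y, ∀ n, g ≫ (π n ▷ Y) = f n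

variable (C)

/-- Every sequence of objects has a Kolmogorov product. -/
def HasKolmogorovProducts : Prop :=
  ∀ X : ℕ → C, ∃ (L : C) (π : ∀ n, L ⟶ finTensor X n), IsKolmogorovProduct X L π

end CategoryTheory.MarkovCategory

namespace UQUS

variable {hP : ProbClosed.{u}}

/-- The probability measure underlying a point of the space of probability measures. -/
def toMeasure {X : UQUS.{u}} (μ : ((probMonad hP).obj X).carrier) : Measure X.carrier :=
  QUS.Prob.val μ

/-- The pair of two points, as a point of the product space. -/
def pair {X Y : UQUS.{u}} (x : X.carrier) (y : Y.carrier) : (X ⊗ Y).carrier := (x, y)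

/-- The maps `τ` send a point `x` and a probability measure `μ` to the product `δ_x ⊗ μ`, that is,
to the push-forward of `μ` along `y ↦ (x, y)`. -/
def IsProductStrength (τ : Monad.StrengthMap (probMonad hP)) : Prop :=
  ∀ (X Y : UQUS.{u}) (x : X.carrier) (μ : ((probMonad hP).obj Y).carrier),
    toMeasure (fn (τ X Y) (pair x μ)) = (toMeasure μ).map (pair x)

end UQUS

end

/-!
The empty space and the retracts of the sample space `Omega` exhaust the universal quasi-universal
spaces (`QUS.IsUniversal.isEmpty_or_retract`, `QUS.Retract.isUniversal`). For a retract, the random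
variables are all measurable maps, and a probability measure is determined by the law of the code of
a point in the Borel space `ℕ → ℝ` (`QUS.Retract.measure_eq`). Conversely every Borel probability
measure extends to the universally measurable sets, and a family of probability measures is
measurable as soon as it is so on Borel sets (`Omega.univExt`, `Omega.measurable_measure_of_borel`).
Hence the measures in `Q(Omega)` are all probability measures, the elements of `Q(Omega)^Omega` are
all Markov kernels, and `P(X)` is the space of all probability measures on a universal space `X`.
All questions about `P` thus become questions about Markov kernels between standard Borel spaces.

* A probability measure on the real line is coded by the values of its distribution function at the
  rationals, so `P(X)` is again a retract (`UQUS.probClosed`). Sequences of sequences are sequences,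
  which gives countable products and coproducts. The category is not closed: a function space of
  `Omega` with itself would be the image of `Omega`, and a diagonal argument applies
  (`UQUS.isEmpty_monoidalClosed`).
* The laws of the strength and of the monoidal structures are identities between iterated integrals.
  Commutativity is Fubini's theorem, which holds because the measures on a product are determined by
  their Borel restrictions (`UQUS.isCommutative`).
* Morphisms of the Kleisli category `UQUS.Kern` are Markov kernels. The measures of a deterministic
  kernel only take the values `0` and `1`, so they are Dirac measures and the kernel is a morphism
  of spaces (`UQUS.Kern.exists_eq_pure`); this makes `P(X)` the distribution object of `X`. Two
  kernels are almost surely equal if and only if they agree at almost every point, since a countable family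
  of sets determines a measure (`UQUS.Kern.asEq_iff`).
* Conditionals come from the disintegration of kernels between standard Borel spaces, carried over
  to `Omega` and then to its retracts (`UQUS.Kern.hasConditionals`).
* The Kolmogorov product of a sequence is its product in the category of spaces. Existence of the
  measures is the theorem of Ionescu-Tulcea for the chain whose transitions are the conditional
  distributions of consecutive terms of a tower (`UQUS.exists_measure_pi`). Uniqueness and
  measurability follow because the cylinder sets form a `π`-system (`UQUS.Kern.existsUnique_tower`).
-/

/-! ### Measures on the sample space -/

namespace Omega

open scoped ENNReal

/-- The identity map from the sample space to the space of sequences with its Borel `σ`-algebra. -/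
def toSeq : Omega → (ℕ → ℝ) := id

/-- The identity map to the sample space. It is not measurable, but it is measurable up to null
sets for every Borel probability measure. -/
def ofSeq : (ℕ → ℝ) → Omega := id

@[simp] theorem toSeq_ofSeq (x : ℕ → ℝ) : toSeq (ofSeq x) = x := rfl

theorem measurable_toSeq : Measurable toSeq := fun _ hA => le_univCompletion borelOmega _ hA

theorem measurable_apply (n : ℕ) : Measurable fun ω : Omega => toSeq ω n :=
  (measurable_pi_apply n).comp measurable_toSeq

theorem nullMeasurableSet_ofSeq_preimage {A : Set Omega} (hA : MeasurableSet A)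
    (μ : Measure (ℕ → ℝ)) [hμ : IsProbabilityMeasure μ] : NullMeasurableSet (ofSeq ⁻¹' A) μ :=
  hA μ hμ

theorem measurable_of_toSeq {f : Omega → Omega} (hf : Measurable fun ω => toSeq (f ω)) :
    Measurable f :=
  measurable_omega_iff.2 hf

theorem measurable_of_apply {f : Omega → Omega} (hf : ∀ n, Measurable fun ω => toSeq (f ω) n) :
    Measurable f :=
  measurable_of_toSeq (measurable_pi_iff.2 hf)

theorem measurable_completion_ofSeq (μ : Measure (ℕ → ℝ)) [IsProbabilityMeasure μ] :
    @Measurable (NullMeasurableSpace (ℕ → ℝ) μ) Omega _ _ ofSeq :=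
  fun _ hA => nullMeasurableSet_ofSeq_preimage hA μ

/-- The extension of a Borel probability measure to the universally measurable sets. -/
noncomputable def univExt (μ : Measure (ℕ → ℝ)) : Measure Omega :=
  @Measure.map (NullMeasurableSpace (ℕ → ℝ) μ) Omega _ _ ofSeq μ.completion

theorem univExt_apply (μ : Measure (ℕ → ℝ)) [IsProbabilityMeasure μ] {A : Set Omega}
    (hA : MeasurableSet A) : univExt μ A = μ (ofSeq ⁻¹' A) := by
  rw [univExt, Measure.map_apply (measurable_completion_ofSeq μ) hA]
  exact Measure.completion_apply _ _

instance (μ : Measure (ℕ → ℝ)) [IsProbabilityMeasure μ] : IsProbabilityMeasure (univExt μ) :=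
  ⟨by rw [univExt_apply _ MeasurableSet.univ]; simp⟩

theorem map_toSeq_univExt (μ : Measure (ℕ → ℝ)) [IsProbabilityMeasure μ] :
    (univExt μ).map toSeq = μ := by
  ext A hA
  rw [Measure.map_apply measurable_toSeq hA, univExt_apply _ (measurable_toSeq hA)]
  rfl

instance (ν : Measure Omega) [IsProbabilityMeasure ν] : IsProbabilityMeasure (ν.map toSeq) :=
  Measure.isProbabilityMeasure_map measurable_toSeq.aemeasurable

/-- A universally measurable set agrees with a Borel set up to a null set. -/
theorem exists_borel_ae_eq {A : Set Omega} (hA : MeasurableSet A) (μ : Measure (ℕ → ℝ))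
    [IsProbabilityMeasure μ] :
    ∃ B : Set (ℕ → ℝ), MeasurableSet B ∧ ∀ᵐ x ∂μ, (ofSeq x ∈ A ↔ x ∈ B) := by
  obtain ⟨B, hB, h⟩ := nullMeasurableSet_ofSeq_preimage hA μ
  refine ⟨B, hB, ?_⟩
  filter_upwards [h] with x hx
  exact iff_of_eq hx

theorem ae_toSeq {ν : Measure Omega} {p : (ℕ → ℝ) → Prop} (h : ∀ᵐ x ∂ν.map toSeq, p x) :
    ∀ᵐ ω ∂ν, p (toSeq ω) :=
  ae_of_ae_map measurable_toSeq.aemeasurable h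

/-- A probability measure on the universally measurable sets is determined by its values on the
Borel sets. -/
theorem measure_eq_of_map_toSeq {ν₁ ν₂ : Measure Omega} [IsProbabilityMeasure ν₁]
    (h : ν₁.map toSeq = ν₂.map toSeq) : ν₁ = ν₂ := by
  ext A hA
  obtain ⟨B, hB, hAB⟩ := exists_borel_ae_eq hA (ν₁.map toSeq)
  have h1 : A =ᵐ[ν₁] toSeq ⁻¹' B := by
    filter_upwards [ae_toSeq hAB] with ω hω using propext hω
  have h2 : A =ᵐ[ν₂] toSeq ⁻¹' B := by
    rw [h] at hAB
    filter_upwards [ae_toSeq hAB] with ω hω using propext hω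
  rw [measure_congr h1, measure_congr h2, ← Measure.map_apply measurable_toSeq hB, h,
    Measure.map_apply measurable_toSeq hB]

theorem univExt_map_toSeq (ν : Measure Omega) [IsProbabilityMeasure ν] :
    univExt (ν.map toSeq) = ν :=
  measure_eq_of_map_toSeq (map_toSeq_univExt _)

/-- The universally measurable sets form a complete `σ`-algebra: a map that agrees almost surely
with a measurable map, for every probability measure, is measurable. -/
theorem measurable_of_forall_ae_eq {Y : Type*} [MeasurableSpace Y] {g : Omega → Y}
    (h : ∀ ν : Measure Omega, IsProbabilityMeasure ν → ∃ g', Measurable g' ∧ g =ᵐ[ν] g') :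
    Measurable g := by
  refine fun B hB => fun (μ : Measure (ℕ → ℝ)) (hμ : IsProbabilityMeasure μ) => ?_
  obtain ⟨g', hg', hgg'⟩ := h (univExt μ) inferInstance
  have h1 : NullMeasurableSet (ofSeq ⁻¹' (g' ⁻¹' B)) μ :=
    nullMeasurableSet_ofSeq_preimage (hg' hB) μ
  refine h1.congr ?_
  have h2 : ∀ᵐ x ∂μ, g (ofSeq x) = g' (ofSeq x) := by
    have h3 := ae_of_ae_map (measurable_completion_ofSeq μ).aemeasurable hgg'
    exact h3
  filter_upwards [h2] with x hx
  change (g' (ofSeq x) ∈ B) = (g (ofSeq x) ∈ B)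
  rw [hx]

/-- A family of probability measures is measurable as soon as it is measurable on Borel sets. -/
theorem measurable_measure_of_borel {κ : Omega → Measure Omega}
    (hκ : ∀ ω, IsProbabilityMeasure (κ ω)) (h : Measurable fun ω => (κ ω).map toSeq) :
    Measurable κ := by
  refine Measure.measurable_of_measurable_coe _ fun A hA => ?_
  refine measurable_of_forall_ae_eq fun ν hν => ?_
  have hρ : IsProbabilityMeasure (ν.bind fun ω => (κ ω).map toSeq) :=
    isProbabilityMeasure_bind h.aemeasurable (ae_of_all _ fun _ => inferInstance)
  obtain ⟨B, hB, hAB⟩ := exists_borel_ae_eq hA (ν.bind fun ω => (κ ω).map toSeq)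
  refine ⟨fun ω => (κ ω).map toSeq B, (Measure.measurable_coe hB).comp h, ?_⟩
  filter_upwards [Measure.ae_ae_of_ae_bind h.aemeasurable hAB] with ω hω
  rw [Measure.map_apply measurable_toSeq hB]
  refine measure_congr ?_
  filter_upwards [ae_toSeq hω] with x hx using propext hx

/-! ### Pairing on the sample space -/

/-- The pairing of two sequences, listing them alternately. -/
def pair (a b : Omega) : Omega :=
  ofSeq fun n => Sum.elim (toSeq a) (toSeq b) (Equiv.natSumNatEquivNat.symm n)

/-- The first component of a sequence with respect to the pairing. -/
def fst (ω : Omega) : Omega := ofSeq fun n => toSeq ω (Equiv.natSumNatEquivNat (Sum.inl n))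

/-- The second component of a sequence with respect to the pairing. -/
def snd (ω : Omega) : Omega := ofSeq fun n => toSeq ω (Equiv.natSumNatEquivNat (Sum.inr n))

@[simp] theorem fst_pair (a b : Omega) : fst (pair a b) = a := by
  funext n
  exact congrArg (Sum.elim a b) (Equiv.symm_apply_apply _ _)

@[simp] theorem snd_pair (a b : Omega) : snd (pair a b) = b := by
  funext n
  exact congrArg (Sum.elim a b) (Equiv.symm_apply_apply _ _)

theorem measurable_fst : Measurable fst := measurable_of_apply fun _ => measurable_apply _

theorem measurable_snd : Measurable snd := measurable_of_apply fun _ => measurable_apply _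

theorem measurable_toSeq_pair {T : Type*} [MeasurableSpace T] {a b : T → Omega}
    (ha : Measurable a) (hb : Measurable b) : Measurable fun t => toSeq (pair (a t) (b t)) := by
  refine measurable_pi_iff.2 fun n => ?_
  obtain ⟨m, rfl⟩ := Equiv.natSumNatEquivNat.surjective n
  have h : ∀ t, toSeq (pair (a t) (b t)) (Equiv.natSumNatEquivNat m) =
      Sum.elim (toSeq (a t)) (toSeq (b t)) m := fun t =>
    congrArg (Sum.elim (toSeq (a t)) (toSeq (b t))) (Equiv.symm_apply_apply _ _)
  simp only [h]
  rcases m with m | m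
  · exact (measurable_apply m).comp ha
  · exact (measurable_apply m).comp hb

theorem measurable_toSeq_pair_ofSeq :
    Measurable fun q : (ℕ → ℝ) × (ℕ → ℝ) => toSeq (pair (ofSeq q.1) (ofSeq q.2)) := by
  refine measurable_pi_iff.2 fun n => ?_
  simp only [pair, toSeq_ofSeq]
  rcases Equiv.natSumNatEquivNat.symm n with k | k
  · exact (measurable_pi_apply k).comp _root_.measurable_fst
  · exact (measurable_pi_apply k).comp _root_.measurable_snd

theorem measurable_pair {a b : Omega → Omega} (ha : Measurable a) (hb : Measurable b) :
    Measurable fun ω => pair (a ω) (b ω) :=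
  measurable_of_toSeq (measurable_toSeq_pair ha hb)

end Omega

namespace QUS

/-- All probability measures on the sample space have measurable evaluations on sections; hence
the admissible random variables of measures are exactly the Markov kernels. -/
theorem isQRV_of_measurable {κ : Omega → Measure Omega} (hκ : ∀ ω, IsProbabilityMeasure (κ ω))
    (h : Measurable κ) : IsQRV κ := by
  have key : ∀ ρ : Omega → Measure Omega, (∀ ω, IsProbabilityMeasure (ρ ω)) → Measurable ρ →
      ∀ D : Set (omega.prod omega), MeasurableSet D →
        Measurable fun ω : Omega => ρ ω {y | (ω, y) ∈ D} := by
    intro ρ hρ h D hD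
    have hp : ∀ ω, Measurable (Omega.pair ω) := fun ω =>
      Omega.measurable_pair measurable_const measurable_id
    have hD' : MeasurableSet {ω : Omega | (Omega.fst ω, Omega.snd ω) ∈ D} :=
      hD (fun ω => (Omega.fst ω, Omega.snd ω)) ⟨Omega.measurable_fst, Omega.measurable_snd⟩
    have h1 : Measurable fun ω => (ρ ω).map (Omega.pair ω) := by
      refine Omega.measurable_measure_of_borel
        (fun ω => Measure.isProbabilityMeasure_map (hp ω).aemeasurable) ?_
      refine Measure.measurable_of_measurable_coe _ fun B hB => ?_
      have hE : MeasurableSet {q : Omega × Omega | Omega.toSeq (Omega.pair q.1 q.2) ∈ B} :=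
        Omega.measurable_toSeq_pair measurable_fst measurable_snd hB
      let ρ' : ProbabilityTheory.Kernel Omega Omega := ⟨ρ, h⟩
      have : ProbabilityTheory.IsMarkovKernel ρ' := ⟨hρ⟩
      convert! ProbabilityTheory.Kernel.measurable_kernel_prodMk_left (κ := ρ') hE using 2 with ω
      rw [Measure.map_map Omega.measurable_toSeq (hp ω), Measure.map_apply
        (Omega.measurable_toSeq.comp (hp ω)) hB]
      rfl
    convert! (Measure.measurable_coe hD').comp h1 using 2 with ω
    simp only [Function.comp]
    rw [Measure.map_apply (hp ω) hD']
    simp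
  exact ⟨fun ω => ⟨hκ ω, key _ (fun _ => hκ ω) measurable_const⟩,
    fun φ hφ D hD => key _ (fun _ => hκ _) (h.comp hφ) D hD⟩

theorem isQ_of_isProbabilityMeasure (ν : Measure Omega) [hν : IsProbabilityMeasure ν] : IsQ ν :=
  (isQRV_of_measurable (κ := fun _ => ν) (fun _ => hν) measurable_const).1 default

end QUS

/-! ### Universal spaces as retracts of the sample space -/

namespace QUS

/-- A presentation of a quasi-measurable space as a retract of the sample space, with section `enc`
and retraction `dec`. -/
structure Retract (X : QUS.{u}) where
  enc : X → Omega
  dec : Omega → X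
  measurable_enc : Measurable enc
  dec_mem : dec ∈ X.rv
  dec_enc : ∀ x, dec (enc x) = x

theorem measurable_iff_forall_mem {X : QUS.{u}} {Y : Type*} [MeasurableSpace Y] {f : X → Y} :
    Measurable f ↔ ∀ α ∈ X.rv, Measurable fun ω => f (α ω) :=
  ⟨fun h _ hα => h.comp (measurable_of_mem hα), fun h _ hA α hα => h α hα hA⟩

theorem measurable_of_toSeq {X : QUS.{u}} {f : X → Omega}
    (h : Measurable fun x => Omega.toSeq (f x)) : Measurable f :=
  measurable_iff_forall_mem.2 fun _ hα =>
    Omega.measurable_of_toSeq (h.comp (measurable_of_mem hα))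

theorem measurable_of_toSeq_apply {X : QUS.{u}} {f : X → Omega}
    (h : ∀ n, Measurable fun x => Omega.toSeq (f x) n) : Measurable f :=
  measurable_of_toSeq (measurable_pi_iff.2 h)

namespace Retract

variable {X : QUS.{u}}

theorem measurable_dec (R : Retract X) : Measurable R.dec := measurable_of_mem R.dec_mem

theorem mem_rv_iff (R : Retract X) {α : Omega → X} : α ∈ X.rv ↔ Measurable α := by
  refine ⟨measurable_of_mem, fun h => ?_⟩
  have := X.comp_mem _ R.dec_mem _ (R.measurable_enc.comp h)
  convert this using 1
  funext ω
  exact (R.dec_enc _).symm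

/-- A retract of the sample space is universal: the image of the section is the equalizer of an
idempotent and the identity. -/
theorem isUniversal (R : Retract X) : IsUniversal X := by
  have hm : Measurable fun ω => R.enc (R.dec ω) := R.measurable_enc.comp R.measurable_dec
  have hS : MeasurableSet {ω | R.enc (R.dec ω) = ω} := by
    have : {ω | R.enc (R.dec ω) = ω} =
        {ω | Omega.toSeq (R.enc (R.dec ω)) = Omega.toSeq ω} := rfl
    rw [this]
    exact measurableSet_eq_fun (Omega.measurable_toSeq.comp hm) Omega.measurable_toSeq
  refine isUniversal_of_equiv hS
    ⟨fun x => ⟨R.enc x, congrArg R.enc (R.dec_enc x)⟩, fun ω => R.dec ω, R.dec_enc,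
      fun ω => Subtype.ext ω.2⟩ ?_
  ext α
  refine R.mem_rv_iff.trans ⟨fun h => R.measurable_enc.comp h, fun h => ?_⟩
  have h' : Measurable fun ω => R.dec (R.enc (α ω)) := R.measurable_dec.comp h
  simpa only [R.dec_enc] using h'

/-- A probability measure on a retract of the sample space is determined by the law of the code of a
point, as a Borel measure on the space of sequences. -/
theorem measure_eq (R : Retract X) {μ ν : Measure X} [IsProbabilityMeasure μ]
    (h : μ.map (fun x => Omega.toSeq (R.enc x)) = ν.map (fun x => Omega.toSeq (R.enc x))) :
    μ = ν := by
  have hp : IsProbabilityMeasure (μ.map R.enc) :=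
    Measure.isProbabilityMeasure_map R.measurable_enc.aemeasurable
  have h1 : μ.map R.enc = ν.map R.enc := by
    refine Omega.measure_eq_of_map_toSeq ?_
    rw [Measure.map_map Omega.measurable_toSeq R.measurable_enc,
      Measure.map_map Omega.measurable_toSeq R.measurable_enc]
    exact h
  have h2 := congrArg (Measure.map R.dec) h1
  rw [Measure.map_map R.measurable_dec R.measurable_enc,
    Measure.map_map R.measurable_dec R.measurable_enc] at h2
  have h3 : R.dec ∘ R.enc = id := funext R.dec_enc
  simpa [h3] using h2

theorem map_dec_map_enc (R : Retract X) (μ : Measure X) : (μ.map R.enc).map R.dec = μ := by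
  rw [Measure.map_map R.measurable_dec R.measurable_enc]
  have h3 : R.dec ∘ R.enc = id := funext R.dec_enc
  simp [h3]

/-- A family of probability measures on a retract of the sample space is measurable as soon as the
Borel laws of the codes are. -/
theorem measurable_measure (R : Retract X) {T : QUS.{v}} {κ : T → Measure X}
    (hκ : ∀ t, IsProbabilityMeasure (κ t))
    (h : Measurable fun t => (κ t).map fun x => Omega.toSeq (R.enc x)) : Measurable κ := by
  refine measurable_iff_forall_mem.2 fun α hα => ?_
  have h1 : Measurable fun ω => (κ (α ω)).map R.enc := by
    refine Omega.measurable_measure_of_borel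
      (fun ω => Measure.isProbabilityMeasure_map R.measurable_enc.aemeasurable) ?_
    convert! h.comp (measurable_of_mem hα) using 2 with ω
    exact Measure.map_map Omega.measurable_toSeq R.measurable_enc
  have h2 := (Measure.measurable_map _ R.measurable_dec).comp h1
  convert! h2 using 2 with ω
  exact (R.map_dec_map_enc _).symm

end Retract

theorem isUniversal_of_isEmpty (X : QUS.{u}) [IsEmpty X] : IsUniversal X := by
  refine isUniversal_of_equiv (S := ∅) MeasurableSet.empty (Equiv.equivOfIsEmpty _ _) ?_
  ext α
  exact isEmptyElim (α default)

/-- The universal spaces are the empty space and the retracts of the sample space. -/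
theorem IsUniversal.isEmpty_or_retract {X : QUS.{u}} (h : IsUniversal X) :
    IsEmpty X ∨ Nonempty (Retract X) := by
  obtain ⟨S, hS, e, he⟩ := h.exists_equiv
  rcases isEmpty_or_nonempty X with h0 | ⟨⟨x⟩⟩
  · exact Or.inl h0
  · refine Or.inr ?_
    classical
    let r : Omega → S := fun ω => if h : ω ∈ S then ⟨ω, h⟩ else e x
    refine ⟨⟨fun x => e x, fun ω => e.symm (r ω), ?_, ?_, fun x => by simp [r]⟩⟩
    · refine measurable_iff_forall_mem.2 fun α hα => ?_
      rw [he] at hα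
      exact hα
    · rw [he]
      have : (fun ω => (r ω : Omega)) = fun ω => if ω ∈ S then ω else e x := by
        funext ω; by_cases h : ω ∈ S <;> simp [r, h]
      simp only [Set.mem_ofPred_eq, Equiv.apply_symm_apply]
      rw [this]
      exact Measurable.ite hS measurable_id measurable_const

theorem IsUniversal.retract {X : QUS.{u}} (h : IsUniversal X) (x : X) : Nonempty (Retract X) :=
  h.isEmpty_or_retract.resolve_left fun h0 => h0.false x

theorem IsUniversal.mem_rv {X : QUS.{u}} (h : IsUniversal X) {α : Omega → X} (hα : Measurable α) :
    α ∈ X.rv := by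
  rw [h.2]; exact hα

/-! ### Probability measures on universal spaces -/

theorem IsUniversal.exists_pushforward {X : QUS.{u}} (h : IsUniversal X) (μ : Measure X)
    [IsProbabilityMeasure μ] : ∃ α ∈ X.rv, ∃ ν, IsQ ν ∧ μ = ν.map α := by
  obtain ⟨x⟩ : Nonempty X := nonempty_of_isProbabilityMeasure μ
  obtain ⟨R⟩ := h.retract x
  have hp : IsProbabilityMeasure (μ.map R.enc) :=
    Measure.isProbabilityMeasure_map R.measurable_enc.aemeasurable
  exact ⟨R.dec, R.dec_mem, μ.map R.enc, isQ_of_isProbabilityMeasure _, (R.map_dec_map_enc μ).symm⟩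

instance Prob.isProbabilityMeasure_val {X : QUS.{u}} (μ : Prob X) :
    IsProbabilityMeasure (Prob.val μ) := by
  obtain ⟨μ, α, hα, ν, hν, rfl⟩ := μ
  have := hν.1
  exact Measure.isProbabilityMeasure_map (measurable_of_mem hα).aemeasurable

/-- The random variables of the space of probability measures of a universal space include all
Markov kernels. -/
theorem IsUniversal.mem_prob_rv {X : QUS.{u}} (h : IsUniversal X) {β : Omega → Prob X}
    (hβ : Measurable fun ω => Prob.val (β ω)) : β ∈ (Prob X).rv := by
  obtain ⟨x⟩ : Nonempty X := nonempty_of_isProbabilityMeasure (Prob.val (β default))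
  obtain ⟨R⟩ := h.retract x
  refine ⟨R.dec, R.dec_mem, fun ω => (Prob.val (β ω)).map R.enc, ?_, fun ω => ?_⟩
  · exact isQRV_of_measurable
      (fun ω => Measure.isProbabilityMeasure_map R.measurable_enc.aemeasurable)
      ((Measure.measurable_map _ R.measurable_enc).comp hβ)
  · exact (R.map_dec_map_enc _).symm

/-- The quasi-measurable map to a space of probability measures given by a Markov kernel. -/
noncomputable def Prob.ofKernel {X Y : QUS.{u}} (hY : IsUniversal Y) (κ : X → Measure Y)
    (hp : ∀ x, IsProbabilityMeasure (κ x)) (hκ : Measurable κ) : X ⟶ Prob Y where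
  toFun x := ⟨κ x, haveI := hp x; hY.exists_pushforward (κ x)⟩
  map_mem _ hα := hY.mem_prob_rv (hκ.comp (measurable_of_mem hα))

end QUS

/-! ### The space of probability measures is universal -/

namespace Omega

open ProbabilityTheory Filter Topology

/-- A measurable isomorphism of the space of sequences with the real line. -/
noncomputable def seqEquivReal : (ℕ → ℝ) ≃ᵐ ℝ :=
  PolishSpace.measurableEquivOfNotCountable
    (fun _ => Cardinal.not_countable_real (Set.countable_univ_iff.2
      (Function.Surjective.countable (f := fun x : ℕ → ℝ => x 0) fun r => ⟨fun _ => r, rfl⟩)))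
    (fun h => Cardinal.not_countable_real (Set.countable_univ_iff.2 h))

/-- The sequence of the values of the distribution function at the rational numbers. -/
noncomputable def cdfSeq (m : Measure ℝ) : ℕ → ℝ :=
  fun n => cdf m ((Denumerable.eqv ℚ).symm n : ℚ)

/-- A sequence read as a function on the rational numbers. -/
def ratFun (x : ℕ → ℝ) (q : ℚ) : ℝ := x (Denumerable.eqv ℚ q)

theorem measurable_ratFun : Measurable ratFun :=
  measurable_pi_iff.2 fun _ => measurable_pi_apply _

theorem ratFun_cdfSeq (m : Measure ℝ) (q : ℚ) : ratFun (cdfSeq m) q = cdf m q := by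
  simp [ratFun, cdfSeq]

theorem isRatStieltjesPoint_cdfSeq (m : Measure ℝ) : IsRatStieltjesPoint ratFun (cdfSeq m) where
  mono p q hpq := by
    simp only [ratFun_cdfSeq]
    exact monotone_cdf m (by exact_mod_cast hpq)
  tendsto_atTop_one := by
    have : ratFun (cdfSeq m) = fun q : ℚ => cdf m q := funext (ratFun_cdfSeq m)
    rw [this]
    exact (tendsto_cdf_atTop m).comp (tendsto_ratCast_atTop_iff.2 tendsto_id)
  tendsto_atBot_zero := by
    have : ratFun (cdfSeq m) = fun q : ℚ => cdf m q := funext (ratFun_cdfSeq m)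
    rw [this]
    exact (tendsto_cdf_atBot m).comp (tendsto_ratCast_atBot_iff.2 tendsto_id)
  iInf_rat_gt_eq t := by
    simp only [ratFun_cdfSeq]
    rw [← StieltjesFunction.iInf_rat_gt_eq (cdf m) t]
    refine Equiv.iInf_congr (Equiv.subtypeEquivRight fun r => ?_) fun r => rfl
    simp

/-- The probability measure on the real line with the given values of the distribution function,
with a default value if there is none. -/
noncomputable def measureOfSeq (x : ℕ → ℝ) : Measure ℝ :=
  (stieltjesOfMeasurableRat ratFun measurable_ratFun x).measure

instance (x : ℕ → ℝ) : IsProbabilityMeasure (measureOfSeq x) :=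
  instIsProbabilityMeasure_stieltjesOfMeasurableRat measurable_ratFun x

theorem measurable_measureOfSeq : Measurable measureOfSeq :=
  measurable_measure_stieltjesOfMeasurableRat measurable_ratFun

theorem measureOfSeq_cdfSeq (m : Measure ℝ) [IsProbabilityMeasure m] :
    measureOfSeq (cdfSeq m) = m := by
  refine ext_of_generate_finite _ Real.borel_eq_generateFrom_Iic_rat Real.isPiSystem_Iic_rat ?_ ?_
  · intro s hs
    obtain ⟨q, rfl⟩ := Set.mem_iUnion.1 hs
    rw [measureOfSeq, measure_stieltjesOfMeasurableRat_Iic, stieltjesOfMeasurableRat_eq,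
      toRatCDF_of_isRatStieltjesPoint (isRatStieltjesPoint_cdfSeq m), ratFun_cdfSeq,
      ofReal_cdf]
  · simp

end Omega

namespace QUS

open Omega

/-- The space of probability measures on a retract of the sample space is a retract of the sample
space: a probability measure on the real line is encoded by its distribution function. -/
noncomputable def Retract.prob {X : QUS.{u}} (R : Retract X) : Retract (Prob X) where
  enc μ := ofSeq (cdfSeq ((Prob.val μ).map fun x => seqEquivReal (toSeq (R.enc x))))
  dec ω := ⟨(univExt ((measureOfSeq (toSeq ω)).map seqEquivReal.symm)).map R.dec, R.dec, R.dec_mem,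
    _, by
      have := Measure.isProbabilityMeasure_map (μ := measureOfSeq (toSeq ω))
        seqEquivReal.symm.measurable.aemeasurable
      exact isQ_of_isProbabilityMeasure _, rfl⟩
  measurable_enc := by
    have hm : Measurable fun x => seqEquivReal (toSeq (R.enc x)) :=
      seqEquivReal.measurable.comp (measurable_toSeq.comp R.measurable_enc)
    refine measurable_of_toSeq_apply fun n => ?_
    have h1 : Measurable fun μ : Prob X =>
        ((Prob.val μ).map (fun x => seqEquivReal (toSeq (R.enc x)))
          (Set.Iic ((Denumerable.eqv ℚ).symm n : ℝ))).toReal :=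
      ((Measure.measurable_coe measurableSet_Iic).comp ((Measure.measurable_map _ hm).comp
        (Prob.measurable_val X))).ennreal_toReal
    convert! h1 using 2 with μ
    have := Measure.isProbabilityMeasure_map (μ := Prob.val μ) hm.aemeasurable
    exact ProbabilityTheory.cdf_eq_real _ _
  dec_mem := by
    have hp : ∀ ω, IsProbabilityMeasure ((measureOfSeq (toSeq ω)).map seqEquivReal.symm) :=
      fun ω => Measure.isProbabilityMeasure_map seqEquivReal.symm.measurable.aemeasurable
    refine ⟨R.dec, R.dec_mem, _, ?_, fun ω => rfl⟩
    refine isQRV_of_measurable (fun ω => inferInstance) ?_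
    refine measurable_measure_of_borel (fun ω => inferInstance) ?_
    simp only [map_toSeq_univExt]
    exact (Measure.measurable_map _ seqEquivReal.symm.measurable).comp
      (measurable_measureOfSeq.comp measurable_toSeq)
  dec_enc μ := by
    have hm : Measurable fun x => toSeq (R.enc x) := measurable_toSeq.comp R.measurable_enc
    have : IsProbabilityMeasure ((Prob.val μ).map fun x => seqEquivReal (toSeq (R.enc x))) :=
      Measure.isProbabilityMeasure_map (seqEquivReal.measurable.comp hm).aemeasurable
    have h1 : (measureOfSeq (cdfSeq ((Prob.val μ).map fun x => seqEquivReal (toSeq (R.enc x))))).map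
        seqEquivReal.symm = ((Prob.val μ).map R.enc).map toSeq := by
      rw [measureOfSeq_cdfSeq, Measure.map_map measurable_toSeq R.measurable_enc]
      refine (Measure.map_map seqEquivReal.symm.measurable
        (seqEquivReal.measurable.comp hm)).trans ?_
      congr 1
      funext x
      simp
    have := Measure.isProbabilityMeasure_map (μ := Prob.val μ) R.measurable_enc.aemeasurable
    refine Subtype.ext ?_
    change (univExt ((measureOfSeq (toSeq (ofSeq (cdfSeq _)))).map seqEquivReal.symm)).map R.dec
      = Prob.val μ
    rw [toSeq_ofSeq, h1, univExt_map_toSeq, R.map_dec_map_enc]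

end QUS

theorem UQUS.probClosed : UQUS.ProbClosed.{u} := fun X hX => by
  rcases hX.isEmpty_or_retract with h | ⟨⟨R⟩⟩
  · have : IsEmpty X.Prob := ⟨fun μ =>
      (nonempty_of_isProbabilityMeasure (QUS.Prob.val μ)).elim h.false⟩
    exact QUS.isUniversal_of_isEmpty _
  · exact R.prob.isUniversal

/-! ### Countable products and coproducts -/

namespace QUS

/-- The product of a family of quasi-measurable spaces: random variables are families of random
variables. -/
def pi {J : Type} (X : J → QUS.{u}) : QUS.{u} where
  carrier := ∀ j, X j
  rv := {α | ∀ j, (fun ω => α ω j) ∈ (X j).rv}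
  comp_mem _ hα φ hφ j := (X j).comp_mem _ (hα j) φ hφ
  const_mem x j := (X j).const_mem (x j)

/-- A countable product of retracts of the sample space, encoded along an injection of the index
set of the double sequence into the natural numbers. -/
def Retract.pi {J : Type} [Encodable J] {X : J → QUS.{u}} (R : ∀ j, Retract (X j)) :
    Retract (QUS.pi X) where
  enc x := Omega.ofSeq fun n => ((Encodable.decode n : Option (J × ℕ)).map fun p =>
    Omega.toSeq ((R p.1).enc (x p.1)) p.2).getD 0
  dec ω j := (R j).dec (Omega.ofSeq fun k => Omega.toSeq ω (Encodable.encode (j, k)))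
  measurable_enc := by
    refine measurable_of_toSeq_apply fun n => ?_
    simp only [Omega.toSeq_ofSeq]
    rcases (Encodable.decode n : Option (J × ℕ)) with _ | ⟨j, k⟩
    · exact measurable_const
    · have h : Measurable fun x : QUS.pi X => (R j).enc (x j) :=
        measurable_iff_forall_mem.2 fun α hα =>
          (R j).measurable_enc.comp (measurable_of_mem (hα j))
      exact (Omega.measurable_apply k).comp h
  dec_mem j := (X j).comp_mem _ (R j).dec_mem _
    (Omega.measurable_of_apply fun _ => Omega.measurable_apply _)
  dec_enc x := by
    funext j
    refine Eq.trans (congrArg (R j).dec ?_) ((R j).dec_enc (x j))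
    funext k
    refine (congrArg (fun o : Option (J × ℕ) =>
      (o.map fun p => Omega.toSeq ((R p.1).enc (x p.1)) p.2).getD 0)
      (Encodable.encodek (j, k))).trans ?_
    rfl

theorem isUniversal_pi {J : Type} [Countable J] {X : J → QUS.{u}} (h : ∀ j, IsUniversal (X j)) :
    IsUniversal (pi X) := by
  have := Encodable.ofCountable J
  by_cases h0 : ∃ j, IsEmpty (X j)
  · obtain ⟨j, hj⟩ := h0
    have : IsEmpty (pi X) := ⟨fun x => hj.false (x j)⟩
    exact isUniversal_of_isEmpty _
  · have hR : ∀ j, Nonempty (Retract (X j)) := fun j =>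
      (h j).isEmpty_or_retract.resolve_left fun hj => h0 ⟨j, hj⟩
    exact (Retract.pi fun j => (hR j).some).isUniversal

/-- The disjoint union of a family of quasi-measurable spaces. The random variables are all maps
that are measurable for the `σ`-algebra of the disjoint union. -/
def sigma {J : Type} (X : J → QUS.{u}) : QUS.{u} where
  carrier := Σ j, X j
  rv := {α | Measurable α}
  comp_mem _ hα _ hφ := Measurable.comp hα hφ
  const_mem _ := measurable_const

theorem measurable_sigma_iff {J : Type} {X : J → QUS.{u}} {Y : Type*} [MeasurableSpace Y]
    {f : (Σ j, X j) → Y} : Measurable f ↔ ∀ j, Measurable fun x => f ⟨j, x⟩ := by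
  refine ⟨fun h j => fun A hA => MeasurableSpace.measurableSet_iInf.1 (h hA) j, fun h A hA => ?_⟩
  exact MeasurableSpace.measurableSet_iInf.2 fun j => h j hA

theorem measurable_of_measurable_sigma {J : Type} {X : J → QUS.{u}} {Y : Type*}
    [MeasurableSpace Y] {f : (Σ j, X j) → Y} (h : ∀ j, Measurable fun x => f ⟨j, x⟩) :
    @Measurable _ _ (measurableSpace (sigma X)) _ f :=
  measurable_iff_forall_mem.2 fun _ hα => (measurable_sigma_iff.2 h).comp hα

open Classical in
/-- A countable disjoint union of retracts of the sample space: the first component of the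
encoding is the index of the summand. Some summands may be empty. -/
noncomputable def Retract.sigma {J : Type} [Encodable J] {X : J → QUS.{u}}
    (R : ∀ j, Nonempty (X j) → Retract (X j)) (d : Σ j, X j) : Retract (QUS.sigma X) where
  enc x := Omega.pair (Omega.ofSeq fun _ => (Encodable.encode x.1 : ℝ)) ((R x.1 ⟨x.2⟩).enc x.2)
  dec ω := (Encodable.decode ⌊Omega.toSeq (Omega.fst ω) 0⌋₊ : Option J).elim d fun j =>
    if h : Nonempty (X j) then ⟨j, (R j h).dec (Omega.snd ω)⟩ else d
  measurable_enc := by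
    refine measurable_of_measurable_sigma fun j => ?_
    rcases isEmpty_or_nonempty (X j) with h | h
    · exact Measurable.of_discrete (α := X j)
    · exact measurable_of_toSeq
        (Omega.measurable_toSeq_pair (a := fun _ => Omega.ofSeq fun _ => (Encodable.encode j : ℝ))
          measurable_const (R j h).measurable_enc)
  dec_mem := by
    let F : ℕ × Omega → Σ j, X j := fun p => (Encodable.decode p.1 : Option J).elim d fun j =>
      if h : Nonempty (X j) then ⟨j, (R j h).dec p.2⟩ else d
    have hF : Measurable F := by
      refine measurable_from_prod_countable_right fun n => ?_
      simp only [F]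
      rcases (Encodable.decode n : Option J) with _ | j
      · exact measurable_const
      · by_cases h : Nonempty (X j)
        · simp only [Option.elim_some, h, dif_pos]
          have h1 : Measurable (Sigma.mk (β := fun j => X j) j) :=
            measurable_sigma_iff.1 measurable_id j
          exact h1.comp (R j h).measurable_dec
        · simp only [Option.elim_some, h, dif_neg, not_false_eq_true]
          exact measurable_const
    exact hF.comp ((Nat.measurable_floor.comp
      ((Omega.measurable_apply 0).comp Omega.measurable_fst)).prodMk Omega.measurable_snd)
  dec_enc := by
    rintro ⟨j, x⟩
    have h : Nonempty (X j) := ⟨x⟩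
    simp only [Omega.fst_pair, Omega.snd_pair, Omega.toSeq_ofSeq, Nat.floor_natCast,
      Encodable.encodek]
    refine (dif_pos h).trans ?_
    rw [Retract.dec_enc]

theorem isUniversal_sigma {J : Type} [Countable J] {X : J → QUS.{u}}
    (h : ∀ j, IsUniversal (X j)) : IsUniversal (sigma X) := by
  have := Encodable.ofCountable J
  rcases isEmpty_or_nonempty (sigma X) with h0 | ⟨⟨d⟩⟩
  · exact isUniversal_of_isEmpty _
  · exact (Retract.sigma (fun j hj => ((h j).retract hj.some).some) d).isUniversal

end QUS

namespace UQUS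

/-- The product of a sequence or of another countable family of spaces. -/
def pi {J : Type} [Countable J] (X : J → UQUS.{u}) : UQUS.{u} :=
  ⟨QUS.pi fun j => (X j).obj, QUS.isUniversal_pi fun j => (X j).property⟩

/-- The projections of a product. -/
def proj {J : Type} [Countable J] (X : J → UQUS.{u}) (j : J) : pi X ⟶ X j :=
  ObjectProperty.homMk ⟨fun x => x j, fun _ hα => hα j⟩

/-- The map into a product given by its components. -/
def piLift {J : Type} [Countable J] {X : J → UQUS.{u}} {Z : UQUS.{u}} (f : ∀ j, Z ⟶ X j) :
    Z ⟶ pi X :=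
  ObjectProperty.homMk ⟨fun z j => fn (f j) z, fun α hα j => (f j).hom.map_mem α hα⟩

theorem hasCountableProducts : HasCountableProducts UQUS.{u} where
  out J _ := by
    have h : ∀ X : J → UQUS.{u}, HasLimit (Discrete.functor X) := fun X =>
      ⟨⟨Fan.mk (pi X) (proj X), Fan.IsLimit.mk _ (fun s => piLift s.proj) (fun _ _ => rfl)
        fun s m hm => hom_ext' fun z => funext fun j => by
          have := congrArg (fun k => fn k z) (hm j)
          exact this⟩⟩
    exact ⟨fun F => hasLimit_of_iso (Discrete.natIsoFunctor (F := F)).symm⟩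

/-- The disjoint union of a countable family of spaces. -/
def sigma {J : Type} [Countable J] (X : J → UQUS.{u}) : UQUS.{u} :=
  ⟨QUS.sigma fun j => (X j).obj, QUS.isUniversal_sigma fun j => (X j).property⟩

/-- The inclusions into a disjoint union. -/
def incl {J : Type} [Countable J] (X : J → UQUS.{u}) (j : J) : X j ⟶ sigma X :=
  ObjectProperty.homMk ⟨fun x => ⟨j, x⟩, fun _ hα =>
    (QUS.measurable_sigma_iff (X := fun j => (X j).obj).1 measurable_id j).comp
      (QUS.measurable_of_mem hα)⟩

/-- The map out of a disjoint union given by its restrictions. -/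
def sigmaDesc {J : Type} [Countable J] {X : J → UQUS.{u}} {Z : UQUS.{u}} (f : ∀ j, X j ⟶ Z) :
    sigma X ⟶ Z :=
  ObjectProperty.homMk ⟨fun p => fn (f p.1) p.2, fun _ hα => Z.property.mem_rv
    ((QUS.measurable_sigma_iff (X := fun j => (X j).obj).2 fun j => (f j).hom.measurable).comp hα)⟩

theorem hasCountableCoproducts : HasCountableCoproducts UQUS.{u} where
  out J _ := by
    have h : ∀ X : J → UQUS.{u}, HasColimit (Discrete.functor X) := fun X =>
      ⟨⟨Cofan.mk (sigma X) (incl X), Cofan.IsColimit.mk _ (fun s => sigmaDesc s.inj)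
        (fun _ _ => rfl) fun s m hm => hom_ext' fun p => by
          have := congrArg (fun k => fn k p.2) (hm p.1)
          exact this⟩⟩
    exact ⟨fun F => hasColimit_of_iso (Discrete.natIsoFunctor (F := F))⟩

/-! ### The category is not closed -/

/-- The sample space, lifted to a given universe. -/
def omega : UQUS.{u} where
  obj :=
    { carrier := ULift Omega
      rv := {α | Measurable fun ω => (α ω).down}
      comp_mem := fun α hα _ hφ => Measurable.comp (g := fun ω => (α ω).down) hα hφ
      const_mem := fun _ => measurable_const }
  property := by
    refine QUS.Retract.isUniversal ⟨ULift.down, ULift.up, ?_, measurable_id, fun _ => rfl⟩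
    exact QUS.measurable_iff_forall_mem.2 fun _ hα => hα

/-- The point of the sample space given by a point of its lift. -/
def omegaDown (x : omega.{u}.carrier) : Omega := ULift.down x

/-- The point of the lift given by a point of the sample space. -/
def omegaUp (ω : Omega) : omega.{u}.carrier := ULift.up ω

/-- Cantor's diagonal argument: an internal hom `H` of the sample space with itself would be a
retract of the sample space, so that the evaluation map would parametrize all endomorphisms of the
sample space by points of the sample space; but the diagonal followed by a translation is not in
the parametrized family. -/
theorem isEmpty_monoidalClosed : IsEmpty (MonoidalClosed UQUS.{u}) := by
  refine ⟨fun hC => ?_⟩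
  let H : UQUS.{u} := (ihom omega).obj omega
  let ev : omega ⊗ H ⟶ omega := (ihom.ev omega).app omega
  have hev : ∀ f : omega.{u} ⟶ omega, ∃ h : H.carrier, ∀ x, fn ev (pair x h) = fn f x := by
    intro f
    let g : omega ⊗ 𝟙_ UQUS.{u} ⟶ omega := CartesianMonoidalCategory.fst _ _ ≫ f
    refine ⟨fn (MonoidalClosed.curry g) PUnit.unit, fun x => ?_⟩
    have h1 : (omega ◁ MonoidalClosed.curry g) ≫ ev = g := by
      rw [← MonoidalClosed.uncurry_eq, MonoidalClosed.uncurry_curry]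
    have h2 := congrArg (fun k => fn k (pair x PUnit.unit)) h1
    exact h2
  obtain ⟨h0, -⟩ := hev (𝟙 _)
  obtain ⟨R⟩ := H.property.retract h0
  let shift : Omega → Omega := fun ω => Omega.ofSeq fun n => Omega.toSeq ω n + 1
  have hshift : Measurable shift :=
    Omega.measurable_of_apply fun n => (Omega.measurable_apply n).add_const 1
  let diag : omega.{u} ⟶ omega := ObjectProperty.homMk
    ⟨fun x => omegaUp (shift (omegaDown (fn ev (pair x (R.dec (omegaDown x)))))), fun α hα =>
      hshift.comp (ev.hom.map_mem (fun ω => (α ω, R.dec (omegaDown (α ω))))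
        ⟨hα, H.obj.comp_mem _ R.dec_mem _ hα⟩)⟩
  obtain ⟨h, hh⟩ := hev diag
  have h1 := hh (omegaUp (R.enc h))
  have h2 : fn diag (omegaUp (R.enc h)) =
      omegaUp (shift (omegaDown (fn ev (pair (omegaUp (R.enc h)) (R.dec (R.enc h)))))) := rfl
  rw [h2, R.dec_enc] at h1
  have h3 := congrFun (congrArg (fun x => Omega.toSeq (omegaDown x)) h1) 0
  simp [shift, omegaUp, omegaDown] at h3

end UQUS

/-! ### Integration against points of the space of probability measures -/

namespace UQUS

variable {X Y Z W T : UQUS.{u}}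

/-- The probability monad on universal quasi-universal spaces. -/
noncomputable abbrev prob : Monad UQUS.{u} := probMonad probClosed

section Pointwise

@[simp] theorem fn_id (x : X.carrier) : fn (𝟙 X) x = x := rfl

@[simp] theorem fn_comp (f : X ⟶ Y) (g : Y ⟶ Z) (x : X.carrier) :
    fn (f ≫ g) x = fn g (fn f x) := rfl

@[simp] theorem fn_tensorHom (f : X ⟶ Y) (g : Z ⟶ W) (x : X.carrier) (z : Z.carrier) :
    fn (f ⊗ₘ g) (pair x z) = pair (fn f x) (fn g z) := rfl

@[simp] theorem fn_whiskerLeft (f : X ⟶ Y) (z : Z.carrier) (x : X.carrier) :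
    fn (Z ◁ f) (pair z x) = pair z (fn f x) := rfl

@[simp] theorem fn_whiskerRight (f : X ⟶ Y) (x : X.carrier) (z : Z.carrier) :
    fn (f ▷ Z) (pair x z) = pair (fn f x) z := rfl

@[simp] theorem fn_associator_hom (x : X.carrier) (y : Y.carrier) (z : Z.carrier) :
    fn (α_ X Y Z).hom (pair (pair x y) z) = pair x (pair y z) := rfl

@[simp] theorem fn_leftUnitor_hom (p : (𝟙_ UQUS.{u}).carrier) (x : X.carrier) :
    fn (λ_ X).hom (pair p x) = x := rfl

@[simp] theorem fn_rightUnitor_hom (p : (𝟙_ UQUS.{u}).carrier) (x : X.carrier) :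
    fn (ρ_ X).hom (pair x p) = x := rfl

@[simp] theorem fn_braiding_hom (x : X.carrier) (y : Y.carrier) :
    fn (β_ X Y).hom (pair x y) = pair y x := rfl

@[simp] theorem fn_lift (f : Z ⟶ X) (g : Z ⟶ Y) (z : Z.carrier) :
    fn (CartesianMonoidalCategory.lift f g) z = pair (fn f z) (fn g z) := rfl

@[simp] theorem fn_fst (x : X.carrier) (y : Y.carrier) :
    fn (CartesianMonoidalCategory.fst X Y) (pair x y) = x := rfl

@[simp] theorem fn_snd (x : X.carrier) (y : Y.carrier) :
    fn (CartesianMonoidalCategory.snd X Y) (pair x y) = y := rfl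

theorem forall_pair {p : (X ⊗ Y).carrier → Prop} : (∀ z, p z) ↔ ∀ x y, p (pair x y) :=
  ⟨fun h _ _ => h _, fun h z => h z.1 z.2⟩

@[fun_prop]
theorem measurable_fn (f : X ⟶ Y) : Measurable (fn f) := f.hom.measurable

@[fun_prop]
theorem measurable_pair {a : T.carrier → X.carrier} {b : T.carrier → Y.carrier}
    (ha : Measurable a) (hb : Measurable b) : Measurable fun t => pair (a t) (b t) :=
  QUS.measurable_iff_forall_mem.2 fun α hα => QUS.measurable_of_mem (X := (X ⊗ Y).obj)
    (α := fun ω => pair (a (α ω)) (b (α ω)))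
    ⟨X.property.mem_rv (ha.comp (QUS.measurable_of_mem hα)),
      Y.property.mem_rv (hb.comp (QUS.measurable_of_mem hα))⟩

/-- The morphism given by a measurable map. -/
def ofMeasurable (f : X.carrier → Y.carrier) (hf : Measurable f) : X ⟶ Y :=
  ObjectProperty.homMk ⟨f, fun _ hα => Y.property.mem_rv (hf.comp (QUS.measurable_of_mem hα))⟩

instance (μ : (prob.obj X).carrier) : IsProbabilityMeasure (toMeasure μ) :=
  QUS.Prob.isProbabilityMeasure_val (X := X.obj) μ

@[fun_prop]
theorem measurable_toMeasure : Measurable (toMeasure (hP := probClosed) (X := X)) :=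
  QUS.Prob.measurable_val X.obj

theorem toMeasure_injective : Function.Injective (toMeasure (hP := probClosed) (X := X)) :=
  fun _ _ h => Subtype.ext h

theorem measure_ext {S : Type*} [MeasurableSpace S] {μ ν : Measure S}
    (h : ∀ F : S → ENNReal, Measurable F → ∫⁻ x, F x ∂μ = ∫⁻ x, F x ∂ν) : μ = ν := by
  ext A hA
  have := h (A.indicator 1) (measurable_one.indicator hA)
  simpa [lintegral_indicator_one hA] using this

theorem prob_ext {μ ν : (prob.obj X).carrier}
    (h : ∀ F : X.carrier → ENNReal, Measurable F →
      ∫⁻ x, F x ∂toMeasure μ = ∫⁻ x, F x ∂toMeasure ν) : μ = ν :=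
  toMeasure_injective (measure_ext h)

theorem lintegral_map' (f : X ⟶ Y) (μ : (prob.obj X).carrier) {F : Y.carrier → ENNReal}
    (hF : Measurable F) :
    ∫⁻ y, F y ∂toMeasure (fn (prob.map f) μ) = ∫⁻ x, F (fn f x) ∂toMeasure μ :=
  lintegral_map hF f.hom.measurable

theorem lintegral_unit (x : X.carrier) {F : X.carrier → ENNReal} (hF : Measurable F) :
    ∫⁻ y, F y ∂toMeasure (fn (prob.η.app X) x) = F x :=
  lintegral_dirac' x hF

theorem lintegral_mult (π : (prob.obj (prob.obj X)).carrier) {F : X.carrier → ENNReal}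
    (hF : Measurable F) :
    ∫⁻ x, F x ∂toMeasure (fn (prob.μ.app X) π) = ∫⁻ μ, ∫⁻ x, F x ∂toMeasure μ ∂toMeasure π :=
  Measure.lintegral_bind (QUS.Prob.measurable_val X.obj).aemeasurable hF.aemeasurable

/-- The quasi-measurable map to a space of probability measures given by a Markov kernel. -/
noncomputable def ofKernel (κ : X.carrier → Measure Y.carrier)
    (hp : ∀ x, IsProbabilityMeasure (κ x)) (hκ : Measurable κ) : X ⟶ prob.obj Y :=
  ObjectProperty.homMk (QUS.Prob.ofKernel Y.property κ hp hκ)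

@[simp] theorem toMeasure_ofKernel (κ : X.carrier → Measure Y.carrier)
    (hp : ∀ x, IsProbabilityMeasure (κ x)) (hκ : Measurable κ) (x : X.carrier) :
    toMeasure (fn (ofKernel κ hp hκ) x) = κ x := rfl

end Pointwise

/-! ### The strength -/

theorem measurable_pair_left (x : X.carrier) : Measurable (pair (Y := Y) x) :=
  measurable_pair measurable_const measurable_id

instance (x : X.carrier) (μ : (prob.obj Y).carrier) :
    IsProbabilityMeasure ((toMeasure μ).map (pair x)) :=
  Measure.isProbabilityMeasure_map (measurable_pair_left x).aemeasurable

/-- Random variables of measures are push-forwards of kernels on the sample space along random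
variables; so the evaluation of such a kernel on sections is measurable. -/
theorem measurable_map_pair : Measurable fun p : (X ⊗ prob.obj Y).carrier =>
    (toMeasure (fn (CartesianMonoidalCategory.snd X (prob.obj Y)) p)).map
      (pair (fn (CartesianMonoidalCategory.fst X (prob.obj Y)) p)) := by
  refine Measure.measurable_of_measurable_coe _ fun A hA => ?_
  refine QUS.measurable_iff_forall_mem.2 ?_
  rintro α ⟨ha, b, hb, κ, hκ, h⟩
  have hD : MeasurableSet {q : (QUS.omega.prod QUS.omega).carrier |
      pair (X := X) (Y := Y) (α q.1).1 (b q.2) ∈ A} := fun γ hγ =>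
    hA (fun ω => pair (X := X) (Y := Y) (α (γ ω).1).1 (b (γ ω).2))
      ⟨X.obj.comp_mem _ ha _ hγ.1, Y.obj.comp_mem _ hb _ hγ.2⟩
  convert! hκ.2 id measurable_id _ hD using 2 with ω
  have hω : toMeasure (fn (CartesianMonoidalCategory.snd X (prob.obj Y)) (α ω)) = (κ ω).map b :=
    h ω
  rw [Measure.map_apply (measurable_pair_left _) hA, hω,
    Measure.map_apply (QUS.measurable_of_mem hb) (measurable_pair_left _ hA)]
  rfl

/-- The strength `(x, μ) ↦ δ_x ⊗ μ`. -/
noncomputable def strength : Monad.StrengthMap prob.{u} := fun _ _ =>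
  ofKernel _ (fun _ => inferInstance) measurable_map_pair

theorem toMeasure_strength (x : X.carrier) (μ : (prob.obj Y).carrier) :
    toMeasure (fn (strength X Y) (pair x μ)) = (toMeasure μ).map (pair x) := rfl

theorem isProductStrength : IsProductStrength strength.{u} := fun _ _ => toMeasure_strength

theorem lintegral_strength (x : X.carrier) (μ : (prob.obj Y).carrier)
    {F : (X ⊗ Y).carrier → ENNReal} (hF : Measurable F) :
    ∫⁻ z, F z ∂toMeasure (fn (strength X Y) (pair x μ)) = ∫⁻ y, F (pair x y) ∂toMeasure μ :=
  lintegral_map hF (measurable_pair_left x)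

/-- Integrals with respect to a kernel of a function with parameters are measurable. -/
theorem measurable_lintegral {κ : T.carrier → (prob.obj Y).carrier} (hκ : Measurable κ)
    {F : T.carrier → Y.carrier → ENNReal}
    (hF : Measurable fun p : (T ⊗ Y).carrier => F (fn (CartesianMonoidalCategory.fst T Y) p)
      (fn (CartesianMonoidalCategory.snd T Y) p)) :
    Measurable fun t => ∫⁻ y, F t y ∂toMeasure (κ t) := by
  have h1 := (Measure.measurable_lintegral hF).comp (measurable_toMeasure.comp
    ((measurable_fn (strength T Y)).comp (measurable_pair measurable_id hκ)))
  convert! h1 using 2 with t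
  exact (lintegral_strength t (κ t) hF).symm

theorem lintegral_costrength (μ : (prob.obj X).carrier) (y : Y.carrier)
    {F : (X ⊗ Y).carrier → ENNReal} (hF : Measurable F) :
    ∫⁻ z, F z ∂toMeasure (fn (Monad.costrength strength X Y) (pair μ y)) =
      ∫⁻ x, F (pair x y) ∂toMeasure μ := by
  simp only [Monad.costrength, fn_comp, fn_braiding_hom]
  rw [lintegral_map' _ _ hF, lintegral_strength _ _ (by fun_prop)]
  rfl

theorem measurable_lintegral_toMeasure {F : X.carrier → ENNReal} (hF : Measurable F) :
    Measurable fun μ : (prob.obj X).carrier => ∫⁻ x, F x ∂toMeasure μ :=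
  (Measure.measurable_lintegral hF).comp measurable_toMeasure

theorem measurable_lintegral_fn (f : X ⟶ prob.obj Y) {F : Y.carrier → ENNReal}
    (hF : Measurable F) : Measurable fun x => ∫⁻ y, F y ∂toMeasure (fn f x) :=
  (measurable_lintegral_toMeasure hF).comp (measurable_fn f)

theorem lintegral_doubleStrength' (μ : (prob.obj X).carrier) (ν : (prob.obj Y).carrier)
    {F : (X ⊗ Y).carrier → ENNReal} (hF : Measurable F) :
    ∫⁻ z, F z ∂toMeasure (fn (Monad.doubleStrength strength X Y) (pair μ ν)) =
      ∫⁻ y, ∫⁻ x, F (pair x y) ∂toMeasure μ ∂toMeasure ν := by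
  simp only [Monad.doubleStrength, fn_comp]
  rw [lintegral_mult _ hF, lintegral_map' _ _ (measurable_lintegral_toMeasure hF),
    lintegral_strength _ _ (measurable_lintegral_fn _ hF)]
  simp only [lintegral_costrength _ _ hF]

theorem lintegral_codoubleStrength (μ : (prob.obj X).carrier) (ν : (prob.obj Y).carrier)
    {F : (X ⊗ Y).carrier → ENNReal} (hF : Measurable F) :
    ∫⁻ z, F z ∂toMeasure (fn (Monad.costrength strength X (prob.obj Y) ≫
      prob.map (strength X Y) ≫ prob.μ.app (X ⊗ Y)) (pair μ ν)) =
      ∫⁻ x, ∫⁻ y, F (pair x y) ∂toMeasure ν ∂toMeasure μ := by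
  simp only [fn_comp]
  rw [lintegral_mult _ hF, lintegral_map' _ _ (measurable_lintegral_toMeasure hF),
    lintegral_costrength _ _ (measurable_lintegral_fn _ hF)]
  simp only [lintegral_strength _ _ hF]

/-- The product of retracts of the sample space. -/
def prodRetract (R : QUS.Retract X.obj) (S : QUS.Retract Y.obj) : QUS.Retract (X ⊗ Y).obj where
  enc p := Omega.pair (R.enc (fn (CartesianMonoidalCategory.fst X Y) p))
    (S.enc (fn (CartesianMonoidalCategory.snd X Y) p))
  dec ω := pair (R.dec (Omega.fst ω)) (S.dec (Omega.snd ω))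
  measurable_enc := QUS.measurable_of_toSeq (Omega.measurable_toSeq_pair
    (R.measurable_enc.comp (measurable_fn _)) (S.measurable_enc.comp (measurable_fn _)))
  dec_mem := ⟨X.obj.comp_mem _ R.dec_mem _ Omega.measurable_fst,
    Y.obj.comp_mem _ S.dec_mem _ Omega.measurable_snd⟩
  dec_enc p := by
    rw [Omega.fst_pair, Omega.snd_pair, R.dec_enc, S.dec_enc]
    rfl

/-- Probability measures on a product are determined by their restrictions to the product
`σ`-algebra. -/
theorem measure_eq_of_lintegral_eq {M₁ M₂ : Measure (X ⊗ Y).carrier} [IsProbabilityMeasure M₁]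
    (h : ∀ F : X.carrier × Y.carrier → ENNReal, Measurable F →
      ∫⁻ p, F (fn (CartesianMonoidalCategory.fst X Y) p, fn (CartesianMonoidalCategory.snd X Y) p)
        ∂M₁ =
      ∫⁻ p, F (fn (CartesianMonoidalCategory.fst X Y) p, fn (CartesianMonoidalCategory.snd X Y) p)
        ∂M₂) : M₁ = M₂ := by
  obtain ⟨p⟩ : Nonempty (X ⊗ Y).carrier := nonempty_of_isProbabilityMeasure M₁
  obtain ⟨R⟩ := X.property.retract p.1
  obtain ⟨S⟩ := Y.property.retract p.2
  refine (prodRetract R S).measure_eq ?_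
  have hm : Measurable fun q : X.carrier × Y.carrier =>
      Omega.toSeq (Omega.pair (R.enc q.1) (S.enc q.2)) :=
    Omega.measurable_toSeq_pair (R.measurable_enc.comp measurable_fst)
      (S.measurable_enc.comp measurable_snd)
  ext B hB
  have hB' := h _ ((measurable_one.indicator hB).comp hm)
  have hm' : Measurable fun p => Omega.toSeq ((prodRetract R S).enc p) :=
    Omega.measurable_toSeq.comp (prodRetract R S).measurable_enc
  rw [← lintegral_indicator_one hB, ← lintegral_indicator_one hB,
    lintegral_map (measurable_one.indicator hB) hm',
    lintegral_map (measurable_one.indicator hB) hm']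
  exact hB'

/-- Fubini's theorem on the product space. Its `σ`-algebra is larger than the product `σ`-algebra,
on which both sides agree by the usual theorem. -/
theorem isCommutative : Monad.IsCommutative strength.{u} := fun X Y => by
  refine hom_ext' (forall_pair.2 fun μ ν => toMeasure_injective (measure_eq_of_lintegral_eq ?_))
  intro F hF
  have hF' : Measurable fun p : (X ⊗ Y).carrier => F (fn (CartesianMonoidalCategory.fst X Y) p,
      fn (CartesianMonoidalCategory.snd X Y) p) :=
    hF.comp ((measurable_fn _).prodMk (measurable_fn _))
  rw [lintegral_doubleStrength' μ ν hF', lintegral_codoubleStrength μ ν hF']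
  simp only [fn_fst, fn_snd]
  exact lintegral_lintegral_swap (f := fun y x => F (x, y)) (hF.comp measurable_swap).aemeasurable

theorem lintegral_doubleStrength (μ : (prob.obj X).carrier) (ν : (prob.obj Y).carrier)
    {F : (X ⊗ Y).carrier → ENNReal} (hF : Measurable F) :
    ∫⁻ z, F z ∂toMeasure (fn (Monad.doubleStrength strength X Y) (pair μ ν)) =
      ∫⁻ x, ∫⁻ y, F (pair x y) ∂toMeasure ν ∂toMeasure μ := by
  rw [isCommutative X Y]
  exact lintegral_codoubleStrength μ ν hF

theorem lintegral_swap (μ : (prob.obj X).carrier) (ν : (prob.obj Y).carrier)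
    {F : (X ⊗ Y).carrier → ENNReal} (hF : Measurable F) :
    ∫⁻ x, ∫⁻ y, F (pair x y) ∂toMeasure ν ∂toMeasure μ =
      ∫⁻ y, ∫⁻ x, F (pair x y) ∂toMeasure μ ∂toMeasure ν :=
  (lintegral_doubleStrength μ ν hF).symm.trans (lintegral_doubleStrength' μ ν hF)

theorem toMeasure_eq_of_subsingleton [Subsingleton X.carrier] (μ ν : (prob.obj X).carrier) :
    toMeasure μ = toMeasure ν := by
  ext A _
  refine Subsingleton.set_cases (p := fun A => toMeasure μ A = toMeasure ν A) ?_ ?_ A <;> simp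

instance : Subsingleton (𝟙_ UQUS.{u}).carrier := inferInstanceAs (Subsingleton PUnit)

theorem isAffine : Monad.IsAffine prob.{u} :=
  ⟨prob.η.app (𝟙_ _), hom_ext' fun _ => toMeasure_injective (toMeasure_eq_of_subsingleton _ _),
    toUnit_unique _ _⟩

theorem isStrength : Monad.IsStrength prob.{u} strength where
  naturality {X X' Y Y'} f g := by
    refine hom_ext' (forall_pair.2 fun x μ => prob_ext fun F hF => ?_)
    simp only [fn_comp, fn_tensorHom]
    rw [lintegral_strength _ _ hF, lintegral_map' _ _ hF, lintegral_strength _ _ (by fun_prop),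
      lintegral_map' _ _ (by fun_prop)]
    rfl
  left_unitor X := by
    refine hom_ext' (forall_pair.2 fun x μ => prob_ext fun F hF => ?_)
    simp only [fn_comp]
    rw [lintegral_map' _ _ hF, lintegral_strength _ _ (by fun_prop)]
    rfl
  associator X Y Z := by
    refine hom_ext' (forall_pair.2 (forall_pair.2 fun x y => fun μ => prob_ext fun F hF => ?_))
    simp only [fn_comp, fn_associator_hom, fn_whiskerLeft]
    rw [lintegral_map' _ _ hF, lintegral_strength _ _ (by fun_prop),
      lintegral_strength _ _ (by fun_prop), lintegral_strength _ _ (by fun_prop)]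
    rfl
  unit X Y := by
    refine hom_ext' (forall_pair.2 fun x y => prob_ext fun F hF => ?_)
    simp only [fn_comp, fn_whiskerLeft]
    rw [lintegral_strength _ _ hF, lintegral_unit _ hF, lintegral_unit _ (by fun_prop)]
  mult X Y := by
    refine hom_ext' (forall_pair.2 fun x π => prob_ext fun F hF => ?_)
    simp only [fn_comp, fn_whiskerLeft]
    rw [lintegral_strength _ _ hF, lintegral_mult _ (by fun_prop), lintegral_mult _ hF,
      lintegral_map' _ _ (measurable_lintegral_toMeasure hF),
      lintegral_strength _ _ (measurable_lintegral_fn _ hF)]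
    simp only [lintegral_strength _ _ hF]

/-- The lax monoidal structure given by the double strength. -/
noncomputable abbrev laxMonoidal : prob.{u}.toFunctor.LaxMonoidal where
  ε := prob.η.app (𝟙_ _)
  μ X Y := Monad.doubleStrength strength X Y
  μ_natural_left {X Y} f X' := by
    refine hom_ext' (forall_pair.2 fun μ ν => prob_ext fun F hF => ?_)
    simp only [fn_comp, fn_whiskerRight]
    rw [lintegral_doubleStrength _ _ hF, lintegral_map' _ _ hF,
      lintegral_doubleStrength _ _ (by fun_prop), lintegral_map' _ _
        (measurable_lintegral measurable_const (by fun_prop))]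
    rfl
  μ_natural_right {X Y} X' f := by
    refine hom_ext' (forall_pair.2 fun μ ν => prob_ext fun F hF => ?_)
    simp only [fn_comp, fn_whiskerLeft]
    rw [lintegral_doubleStrength _ _ hF, lintegral_map' _ _ hF,
      lintegral_doubleStrength _ _ (by fun_prop)]
    refine lintegral_congr fun x => ?_
    rw [lintegral_map' _ _ (by fun_prop)]
    rfl
  associativity X Y Z := by
    refine hom_ext' (forall_pair.2 (forall_pair.2 fun μ ν => fun ρ => prob_ext fun F hF => ?_))
    simp only [fn_comp, fn_whiskerLeft, fn_whiskerRight, fn_associator_hom]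
    rw [lintegral_doubleStrength _ _ hF, lintegral_map' _ _ hF,
      lintegral_doubleStrength _ _ (by fun_prop), lintegral_doubleStrength _ _
        (measurable_lintegral measurable_const (by fun_prop))]
    refine lintegral_congr fun x => ?_
    rw [lintegral_doubleStrength _ _ (by fun_prop)]
    rfl
  left_unitality X := by
    refine hom_ext' (forall_pair.2 fun p μ => prob_ext fun F hF => ?_)
    simp only [fn_comp, fn_whiskerRight, fn_leftUnitor_hom]
    rw [lintegral_map' _ _ hF, lintegral_doubleStrength _ _ (by fun_prop), lintegral_unit _
      (measurable_lintegral measurable_const (by fun_prop))]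
    rfl
  right_unitality X := by
    refine hom_ext' (forall_pair.2 fun μ p => prob_ext fun F hF => ?_)
    simp only [fn_comp, fn_whiskerLeft, fn_rightUnitor_hom]
    rw [lintegral_map' _ _ hF, lintegral_doubleStrength _ _ (by fun_prop)]
    refine lintegral_congr fun x => ?_
    rw [lintegral_unit _ (by fun_prop)]
    rfl

/-- The lax symmetric monoidal structure given by the double strength. -/
noncomputable abbrev laxBraided : prob.{u}.toFunctor.LaxBraided where
  toLaxMonoidal := laxMonoidal
  braided X Y := by
    refine hom_ext' (forall_pair.2 fun μ ν => prob_ext fun F hF => ?_)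
    change ∫⁻ z, F z ∂toMeasure (fn (Monad.doubleStrength strength X Y ≫
      prob.map (β_ X Y).hom) (pair μ ν)) = ∫⁻ z, F z ∂toMeasure (fn ((β_ _ _).hom ≫
        Monad.doubleStrength strength Y X) (pair μ ν))
    simp only [fn_comp, fn_braiding_hom]
    rw [lintegral_doubleStrength _ _ hF, lintegral_map' _ _ hF,
      lintegral_doubleStrength' _ _ (by fun_prop)]
    rfl

theorem isSymmetricMonoidal : Monad.IsSymmetricMonoidal strength.{u} := by
  let : prob.{u}.toFunctor.LaxBraided := laxBraided
  refine ⟨laxBraided, rfl, fun _ _ => rfl, ⟨?_, fun X Y => ?_⟩, ⟨?_, fun X Y => ?_⟩⟩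
  · exact Category.id_comp _
  · refine hom_ext' (forall_pair.2 fun x y => prob_ext fun F hF => ?_)
    change ∫⁻ z, F z ∂toMeasure (fn (prob.η.app (X ⊗ Y)) (pair x y)) =
      ∫⁻ z, F z ∂toMeasure (fn ((prob.η.app X ⊗ₘ prob.η.app Y) ≫
        Monad.doubleStrength strength X Y) (pair x y))
    simp only [fn_comp, fn_tensorHom]
    rw [lintegral_unit _ hF, lintegral_doubleStrength _ _ hF, lintegral_unit _
      (measurable_lintegral measurable_const (by fun_prop)), lintegral_unit _ (by fun_prop)]
  · exact hom_ext' fun x => toMeasure_injective (toMeasure_eq_of_subsingleton _ _)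
  · refine hom_ext' (forall_pair.2 fun μ ν => prob_ext fun F hF => ?_)
    change ∫⁻ z, F z ∂toMeasure (fn (Monad.doubleStrength strength (prob.obj X) (prob.obj Y) ≫
        prob.map (Monad.doubleStrength strength X Y) ≫ prob.μ.app (X ⊗ Y)) (pair μ ν)) =
      ∫⁻ z, F z ∂toMeasure (fn ((prob.μ.app X ⊗ₘ prob.μ.app Y) ≫
        Monad.doubleStrength strength X Y) (pair μ ν))
    simp only [fn_comp, fn_tensorHom]
    rw [lintegral_mult _ hF, lintegral_map' _ _ (measurable_lintegral_toMeasure hF),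
      lintegral_doubleStrength _ _ (measurable_lintegral_fn _ hF),
      lintegral_doubleStrength _ _ hF, lintegral_mult _
        (measurable_lintegral measurable_const (by fun_prop))]
    refine lintegral_congr fun μ' => ?_
    simp only [lintegral_doubleStrength _ _ hF]
    refine Eq.trans (lintegral_swap μ' ν (F := fun p => ∫⁻ y, F (pair
      (fn (CartesianMonoidalCategory.fst X (prob.obj Y)) p) y) ∂toMeasure
      (fn (CartesianMonoidalCategory.snd X (prob.obj Y)) p))
      (measurable_lintegral (by fun_prop) (by fun_prop))).symm ?_
    refine lintegral_congr fun x => ?_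
    rw [lintegral_mult _ (by fun_prop)]
    rfl

end UQUS

/-! ### The Kleisli category as a symmetric monoidal category -/

namespace UQUS

/-- The Kleisli category of the probability monad: its morphisms are Markov kernels. -/
abbrev Kern : Type (u + 1) := Kleisli prob.{u}

/-- The tensor product of Markov kernels. -/
@[reducible]
noncomputable instance kernStruct : MonoidalCategoryStruct Kern.{u} :=
  Kleisli.monoidalStruct prob strength

namespace Kern

variable {A B C D E : Kern.{u}}

/-- The points of an object of the Kleisli category. -/
abbrev pt (A : Kern.{u}) : Type u := A.of.carrier

/-- The measures that form a Markov kernel. -/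
noncomputable def eval (f : A ⟶ B) (a : A.pt) : Measure B.pt := toMeasure (fn f.of a)

instance isProbabilityMeasure_eval (f : A ⟶ B) (a : A.pt) : IsProbabilityMeasure (eval f a) :=
  inferInstanceAs (IsProbabilityMeasure (toMeasure (fn f.of a)))

@[fun_prop]
theorem measurable_eval (f : A ⟶ B) : Measurable (eval f) :=
  measurable_toMeasure.comp (measurable_fn f.of)

theorem ext_eval {f g : A ⟶ B} (h : ∀ a, eval f a = eval g a) : f = g :=
  Kleisli.hom_ext (hom_ext' fun a => toMeasure_injective (h a))

theorem ext_lintegral {f g : A ⟶ B} (h : ∀ a (F : B.pt → ENNReal), Measurable F →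
    ∫⁻ b, F b ∂eval f a = ∫⁻ b, F b ∂eval g a) : f = g :=
  ext_eval fun a => measure_ext (h a)

/-- The deterministic kernel given by a quasi-measurable map. -/
noncomputable abbrev pure {X Y : UQUS.{u}} (φ : X ⟶ Y) : Kleisli.mk prob X ⟶ Kleisli.mk prob Y :=
  (Kleisli.Adjunction.toKleisli prob).map φ

/-- The point of a tensor product with given components. -/
abbrev pair (a : A.pt) (b : B.pt) : (A ⊗ B).pt := UQUS.pair a b

/-- The first component of a point of a tensor product. -/
abbrev fst (p : (A ⊗ B).pt) : A.pt := fn (CartesianMonoidalCategory.fst A.of B.of) p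

/-- The second component of a point of a tensor product. -/
abbrev snd (p : (A ⊗ B).pt) : B.pt := fn (CartesianMonoidalCategory.snd A.of B.of) p

theorem forall_pair {p : (A ⊗ B).pt → Prop} : (∀ z, p z) ↔ ∀ x y, p (pair x y) :=
  UQUS.forall_pair (X := A.of) (Y := B.of)

theorem lintegral_pure {X Y : UQUS.{u}} (φ : X ⟶ Y) (x : X.carrier) {F : Y.carrier → ENNReal}
    (hF : Measurable F) : ∫⁻ y, F y ∂eval (pure φ) x = F (fn φ x) :=
  lintegral_dirac' _ hF

theorem measurable_lintegral_eval (f : A ⟶ B) {F : B.pt → ENNReal} (hF : Measurable F) :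
    Measurable fun a => ∫⁻ b, F b ∂eval f a :=
  measurable_lintegral_fn f.of hF

theorem lintegral_comp (f : A ⟶ B) (g : B ⟶ C) (a : A.pt) {F : C.pt → ENNReal}
    (hF : Measurable F) :
    ∫⁻ c, F c ∂eval (f ≫ g) a = ∫⁻ b, ∫⁻ c, F c ∂eval g b ∂eval f a := by
  change ∫⁻ c, F c ∂toMeasure (fn (prob.μ.app C.of) (fn (prob.map g.of) (fn f.of a))) = _
  rw [lintegral_mult _ hF, lintegral_map' _ _ (measurable_lintegral_toMeasure hF)]
  rfl

theorem lintegral_tensorHom (f : A ⟶ C) (g : B ⟶ D) (a : A.pt) (b : B.pt)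
    {F : (C ⊗ D).pt → ENNReal} (hF : Measurable F) :
    ∫⁻ p, F p ∂eval (f ⊗ₘ g) (pair a b) = ∫⁻ c, ∫⁻ d, F (pair c d) ∂eval g b ∂eval f a :=
  lintegral_doubleStrength _ _ hF

theorem lintegral_whiskerLeft (f : B ⟶ C) (a : A.pt) (b : B.pt)
    {F : (A ⊗ C).pt → ENNReal} (hF : Measurable F) :
    ∫⁻ p, F p ∂eval (A ◁ f) (pair a b) = ∫⁻ c, F (pair a c) ∂eval f b :=
  lintegral_strength _ _ hF

theorem lintegral_whiskerRight (f : A ⟶ C) (a : A.pt) (b : B.pt)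
    {F : (C ⊗ B).pt → ENNReal} (hF : Measurable F) :
    ∫⁻ p, F p ∂eval (f ▷ B) (pair a b) = ∫⁻ c, F (pair c b) ∂eval f a :=
  lintegral_costrength _ _ hF

/-- Integrals with respect to a kernel of a function with parameters are measurable. -/
theorem measurable_lintegral_param {T : UQUS.{u}} (f : A ⟶ B) {φ : T.carrier → A.pt}
    (hφ : Measurable φ) {F : T.carrier → B.pt → ENNReal}
    (hF : Measurable fun p : (T ⊗ B.of).carrier => F (fn (CartesianMonoidalCategory.fst T B.of) p)
      (fn (CartesianMonoidalCategory.snd T B.of) p)) :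
    Measurable fun t => ∫⁻ b, F t b ∂eval f (φ t) :=
  measurable_lintegral ((measurable_fn f.of).comp hφ) hF

/-- Fubini's theorem for kernels. -/
theorem lintegral_swap (f : A ⟶ C) (g : B ⟶ D) (a : A.pt) (b : B.pt)
    {F : C.pt → D.pt → ENNReal} (hF : Measurable fun p : (C ⊗ D).pt => F (fst p) (snd p)) :
    ∫⁻ c, ∫⁻ d, F c d ∂eval g b ∂eval f a = ∫⁻ d, ∫⁻ c, F c d ∂eval f a ∂eval g b :=
  UQUS.lintegral_swap (fn f.of a) (fn g.of b) hF

@[simp] theorem associator_hom (A B C : Kern.{u}) :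
    (α_ A B C).hom = pure (α_ A.of B.of C.of).hom := rfl

@[simp] theorem leftUnitor_hom (A : Kern.{u}) : (λ_ A).hom = pure (λ_ A.of).hom := rfl

@[simp] theorem rightUnitor_hom (A : Kern.{u}) : (ρ_ A).hom = pure (ρ_ A.of).hom := rfl

theorem pure_comp {X Y Z : UQUS.{u}} (f : X ⟶ Y) (g : Y ⟶ Z) :
    pure f ≫ pure g = pure (f ≫ g) :=
  ((Kleisli.Adjunction.toKleisli prob).map_comp f g).symm

theorem pure_id (X : UQUS.{u}) : pure (𝟙 X) = 𝟙 _ :=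
  (Kleisli.Adjunction.toKleisli prob).map_id X

theorem lintegral_comp_pure {Y : UQUS.{u}} (f : A ⟶ B) (φ : B.of ⟶ Y) (a : A.pt)
    {F : Y.carrier → ENNReal} (hF : Measurable F) :
    ∫⁻ y, F y ∂eval (f ≫ pure φ) a = ∫⁻ b, F (fn φ b) ∂eval f a := by
  refine (lintegral_comp _ _ _ hF).trans (lintegral_congr fun b => ?_)
  exact lintegral_pure φ b hF

theorem eval_pure_comp {X : UQUS.{u}} (φ : X ⟶ A.of) (g : A ⟶ B) (x : X.carrier) :
    eval (pure φ ≫ g) x = eval g (fn φ x) :=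
  measure_ext fun _ hF => (lintegral_comp _ _ _ hF).trans
    (lintegral_pure φ x (measurable_lintegral_eval g hF))

theorem whiskerLeft_pure {X Y : UQUS.{u}} (f : X ⟶ Y) (A : Kern.{u}) :
    A ◁ pure f = pure (A.of ◁ f) :=
  Kleisli.hom_ext ((congrArg (· ≫ strength _ _) (whiskerLeft_comp _ _ _)).trans
    ((Category.assoc _ _ _).trans (congrArg _ (isStrength.unit _ _))))

theorem whiskerRight_pure {X Y : UQUS.{u}} (f : X ⟶ Y) (A : Kern.{u}) :
    pure f ▷ A = pure (f ▷ A.of) := by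
  refine ext_lintegral (forall_pair.2 fun x a F hF => ?_)
  rw [lintegral_whiskerRight _ _ _ hF]
  exact (lintegral_pure f x (F := fun c => F (UQUS.pair c a)) (by fun_prop)).trans
    (lintegral_pure (f ▷ A.of) (UQUS.pair x a) hF).symm

theorem tensorHom_pure {X Y Z W : UQUS.{u}} (f : X ⟶ Y) (g : Z ⟶ W) :
    pure f ⊗ₘ pure g = pure (f ⊗ₘ g) := by
  refine ext_lintegral (forall_pair.2 fun x z F hF => ?_)
  refine Eq.trans ?_ (lintegral_pure (f ⊗ₘ g) (UQUS.pair x z) hF).symm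
  rw [lintegral_tensorHom _ _ _ _ hF]
  refine (lintegral_pure f x (F := fun c => ∫⁻ d, F (UQUS.pair c d) ∂eval (pure g) z)
    (measurable_lintegral_param _ measurable_const (by fun_prop))).trans ?_
  exact lintegral_pure g z (F := fun d => F (UQUS.pair (fn f x) d)) (by fun_prop)

/-- The structural isomorphisms are deterministic, so the coherence laws are those of the category
of spaces; functoriality of the tensor product is Fubini's theorem. -/
theorem isMonoidal : IsMonoidalStruct (Kleisli.monoidalStruct prob.{u} strength) := by
  refine ⟨
    { toMonoidalCategoryStruct := kernStruct
      tensorHom_def := ?_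
      id_tensorHom_id := ?_
      tensorHom_comp_tensorHom := ?_
      whiskerLeft_id := ?_
      id_whiskerRight := ?_
      associator_naturality := ?_
      leftUnitor_naturality := ?_
      rightUnitor_naturality := ?_
      pentagon := ?_
      triangle := ?_ }, rfl⟩
  · intro A B C D f g
    refine ext_lintegral (forall_pair.2 fun x y F hF => ?_)
    rw [lintegral_tensorHom _ _ _ _ hF, lintegral_comp _ _ _ hF,
      lintegral_whiskerRight _ _ _ (measurable_lintegral_eval _ hF)]
    refine lintegral_congr fun x' => ?_
    rw [lintegral_whiskerLeft _ _ _ hF]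
  · intro A B
    rw [← pure_id, ← pure_id, tensorHom_pure, id_tensorHom_id, pure_id]
    rfl
  · intro A B C D A' B' f g h k
    refine ext_lintegral (forall_pair.2 fun x y F hF => ?_)
    rw [lintegral_tensorHom _ _ _ _ hF, lintegral_comp _ _ _ hF,
      lintegral_tensorHom _ _ _ _ (measurable_lintegral_eval _ hF),
      lintegral_comp _ _ _ (measurable_lintegral_param _ measurable_const (by fun_prop))]
    refine lintegral_congr fun x' => ?_
    simp only [lintegral_tensorHom _ _ _ _ hF]
    rw [← lintegral_swap]
    · refine lintegral_congr fun x'' => ?_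
      rw [lintegral_comp _ _ _ (by fun_prop)]
    · refine measurable_lintegral_param _ (by fun_prop) (by fun_prop)
  · intro A B
    rw [← pure_id, whiskerLeft_pure, whiskerLeft_id, pure_id]
    rfl
  · intro A B
    rw [← pure_id, whiskerRight_pure, id_whiskerRight, pure_id]
    rfl
  · intro A B C D A' B' f g h
    refine ext_lintegral (forall_pair.2 (forall_pair.2 fun x y => fun z F hF => ?_))
    rw [associator_hom, associator_hom]
    refine (lintegral_comp_pure _ _ _ hF).trans ?_
    rw [lintegral_tensorHom _ _ _ _ (by fun_prop), lintegral_tensorHom _ _ _ _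
      (measurable_lintegral_param _ measurable_const (by fun_prop))]
    refine Eq.trans ?_ (congrArg (fun m => ∫⁻ p, F p ∂m) (eval_pure_comp _ _ _)).symm
    refine Eq.trans ?_ (lintegral_tensorHom f (g ⊗ₘ h) x (pair y z) hF).symm
    refine lintegral_congr fun x' => ?_
    rw [lintegral_tensorHom _ _ _ _ (by fun_prop)]
    rfl
  · intro A B f
    refine ext_lintegral (forall_pair.2 fun p x F hF => ?_)
    rw [leftUnitor_hom, leftUnitor_hom]
    refine (lintegral_comp_pure _ _ _ hF).trans ?_
    refine Eq.trans ?_ (congrArg (fun m => ∫⁻ p, F p ∂m) (eval_pure_comp _ _ _)).symm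
    rw [lintegral_whiskerLeft _ _ _ (by fun_prop)]
    rfl
  · intro A B f
    refine ext_lintegral (forall_pair.2 fun x p F hF => ?_)
    rw [rightUnitor_hom, rightUnitor_hom]
    refine (lintegral_comp_pure _ _ _ hF).trans ?_
    refine Eq.trans ?_ (congrArg (fun m => ∫⁻ p, F p ∂m) (eval_pure_comp _ _ _)).symm
    rw [lintegral_whiskerRight _ _ _ (by fun_prop)]
    rfl
  · intro A B C D
    simp only [associator_hom]
    have h1 := whiskerRight_pure (α_ A.of B.of C.of).hom D
    have h2 := whiskerLeft_pure (α_ B.of C.of D.of).hom A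
    refine (congrArg₂ (fun k l => k ≫ pure (α_ A.of (B.of ⊗ C.of) D.of).hom ≫ l) h1 h2).trans ?_
    rw [pure_comp, pure_comp, pentagon, ← pure_comp]
    rfl
  · intro A B
    simp only [associator_hom, leftUnitor_hom, rightUnitor_hom]
    have h1 := whiskerRight_pure (ρ_ A.of).hom B
    have h2 := whiskerLeft_pure (λ_ B.of).hom A
    refine (congrArg (fun l => pure (α_ A.of (𝟙_ UQUS) B.of).hom ≫ l) h2).trans ?_
    rw [pure_comp, triangle]
    exact h1.symm

/-- The monoidal category of Markov kernels. -/
@[reducible]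
noncomputable instance : MonoidalCategory Kern.{u} := monoidalOfStruct _ isMonoidal

end Kern

end UQUS

/-! ### The Markov category of kernels -/

namespace UQUS

namespace Kern

variable {A B C D E : Kern.{u}}

/-- The symmetry of the category of Markov kernels. -/
@[reducible]
noncomputable instance : SymmetricCategory Kern.{u} where
  braiding A B := (Kleisli.Adjunction.toKleisli prob).mapIso (β_ A.of B.of)
  braiding_naturality_right A B C f := by
    refine ext_lintegral (forall_pair.2 fun x y F hF => ?_)
    refine (lintegral_comp_pure (A ◁ f) (β_ A.of C.of).hom _ hF).trans ?_
    refine Eq.trans ?_ (congrArg (fun m => ∫⁻ p, F p ∂m)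
      (eval_pure_comp (β_ A.of B.of).hom (f ▷ A) (pair x y))).symm
    refine Eq.trans ?_ (lintegral_whiskerRight f y x hF).symm
    exact lintegral_whiskerLeft f x y (F := fun p => F (fn (β_ A.of C.of).hom p)) (by fun_prop)
  braiding_naturality_left {A B} f C := by
    refine ext_lintegral (forall_pair.2 fun x y F hF => ?_)
    refine (lintegral_comp_pure (f ▷ C) (β_ B.of C.of).hom _ hF).trans ?_
    refine Eq.trans ?_ (congrArg (fun m => ∫⁻ p, F p ∂m)
      (eval_pure_comp (β_ A.of C.of).hom (C ◁ f) (pair x y))).symm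
    refine Eq.trans ?_ (lintegral_whiskerLeft f y x hF).symm
    exact lintegral_whiskerRight f x y (F := fun p => F (fn (β_ B.of C.of).hom p)) (by fun_prop)
  hexagon_forward A B C := by
    have h1 := whiskerRight_pure (β_ A.of B.of).hom C
    have h2 := whiskerLeft_pure (β_ A.of C.of).hom B
    refine Eq.trans ?_ (congrArg₂ (fun k l => k ≫ pure (α_ B.of A.of C.of).hom ≫ l) h1 h2).symm
    rw [pure_comp, pure_comp, ← BraidedCategory.hexagon_forward, ← pure_comp, ← pure_comp]
    rfl
  hexagon_reverse A B C := by
    have h1 := whiskerLeft_pure (β_ B.of C.of).hom A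
    have h2 := whiskerRight_pure (β_ A.of C.of).hom B
    refine Eq.trans ?_ (congrArg₂ (fun k l => k ≫ pure (α_ A.of C.of B.of).inv ≫ l) h1 h2).symm
    rw [pure_comp, pure_comp, ← BraidedCategory.hexagon_reverse, ← pure_comp, ← pure_comp]
    rfl
  symmetry A B := by
    refine (pure_comp (β_ A.of B.of).hom (β_ B.of A.of).hom).trans ?_
    rw [SymmetricCategory.symmetry, pure_id]
    rfl

/-- The comonoid structure given by the diagonal. -/
@[reducible]
noncomputable def comonObj (A : Kern.{u}) : ComonObj A where
  counit := pure (toUnit A.of)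
  comul := pure (CartesianMonoidalCategory.lift (𝟙 A.of) (𝟙 A.of))
  counit_comul := by
    refine (congrArg (fun k => pure (CartesianMonoidalCategory.lift (𝟙 A.of) (𝟙 A.of)) ≫ k)
      (whiskerRight_pure (toUnit A.of) A)).trans ?_
    rw [pure_comp]
    rfl
  comul_counit := by
    refine (congrArg (fun k => pure (CartesianMonoidalCategory.lift (𝟙 A.of) (𝟙 A.of)) ≫ k)
      (whiskerLeft_pure (toUnit A.of) A)).trans ?_
    rw [pure_comp]
    rfl
  comul_assoc := by
    refine (congrArg (fun k => pure (CartesianMonoidalCategory.lift (𝟙 A.of) (𝟙 A.of)) ≫ k)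
      (whiskerLeft_pure (CartesianMonoidalCategory.lift (𝟙 A.of) (𝟙 A.of)) A)).trans ?_
    refine Eq.trans ?_ (congrArg (fun k =>
      pure (CartesianMonoidalCategory.lift (𝟙 A.of) (𝟙 A.of)) ≫ k ≫ pure (α_ A.of A.of A.of).hom)
      (whiskerRight_pure (CartesianMonoidalCategory.lift (𝟙 A.of) (𝟙 A.of)) A)).symm
    rw [pure_comp, pure_comp, pure_comp]
    rfl

theorem tensorμ_eq (A B C D : Kern.{u}) :
    tensorμ A B C D = pure (tensorμ A.of B.of C.of D.of) := by
  have h1 := whiskerLeft_pure (α_ B.of C.of D.of).inv A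
  have h2 := (congrArg (A ◁ ·) (whiskerRight_pure (β_ B.of C.of).hom D)).trans
    (whiskerLeft_pure ((β_ B.of C.of).hom ▷ D.of) A)
  have h3 := whiskerLeft_pure (α_ C.of B.of D.of).hom A
  have h : tensorμ A B C D = pure (α_ A.of B.of (C.of ⊗ D.of)).hom ≫
      pure (A.of ◁ (α_ B.of C.of D.of).inv) ≫ pure (A.of ◁ (β_ B.of C.of).hom ▷ D.of) ≫
      pure (A.of ◁ (α_ C.of B.of D.of).hom) ≫ pure (α_ A.of C.of (B.of ⊗ D.of)).inv := by
    rw [← h1, ← h2, ← h3]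
    rfl
  rw [h, pure_comp, pure_comp, pure_comp, pure_comp]
  rfl

instance (A : Kern.{u}) (B : UQUS.{u}) [Subsingleton B.carrier] :
    Subsingleton (A ⟶ Kleisli.mk prob B) :=
  ⟨fun _ _ => ext_eval fun _ => toMeasure_eq_of_subsingleton _ _⟩

/-- The Markov category of kernels between universal quasi-universal spaces. -/
@[reducible]
noncomputable instance : MarkovCategory Kern.{u} where
  comonObj := comonObj
  isCommComonObj A :=
    letI := comonObj A
    ⟨(pure_comp (CartesianMonoidalCategory.lift (𝟙 A.of) (𝟙 A.of)) (β_ A.of A.of).hom).trans rfl⟩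
  copy_tensor A B := by
    have h := tensorHom_pure (CartesianMonoidalCategory.lift (𝟙 A.of) (𝟙 A.of))
      (CartesianMonoidalCategory.lift (𝟙 B.of) (𝟙 B.of))
    refine Eq.trans ?_ (congrArg₂ (· ≫ ·) h (tensorμ_eq A A B B)).symm
    rw [pure_comp]
    rfl
  discard_tensor A B := by
    have h := tensorHom_pure (toUnit A.of) (toUnit B.of)
    refine Eq.trans ?_ (congrArg (· ≫ pure (λ_ (𝟙_ UQUS)).hom) h).symm
    rw [pure_comp]
    rfl
  copy_unit := rfl
  discard_unit := pure_id (𝟙_ UQUS)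
  discard_natural f := Subsingleton.elim (α := _ ⟶ Kleisli.mk prob (𝟙_ UQUS)) _ _

theorem isCanonicalMarkov : Kleisli.IsCanonicalMarkov prob.{u} strength isMonoidal inferInstance :=
  ⟨fun _ _ => rfl, fun _ => rfl, fun _ => rfl⟩

end Kern

end UQUS

/-! ### Deterministic kernels -/

namespace UQUS

theorem dirac_injective {X : UQUS.{u}} {x y : X.carrier}
    (h : Measure.dirac x = Measure.dirac y) : x = y := by
  obtain ⟨R⟩ := X.property.retract x
  have hm : Measurable fun x => Omega.toSeq (R.enc x) :=
    Omega.measurable_toSeq.comp R.measurable_enc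
  have h1 := congrArg (Measure.map fun x => Omega.toSeq (R.enc x)) h
  rw [Measure.map_dirac' hm, Measure.map_dirac' hm, dirac_eq_dirac_iff] at h1
  have h2 : R.enc x = R.enc y := h1
  rw [← R.dec_enc x, h2, R.dec_enc]

/-- A probability measure with values `0` and `1` on a universal space is a Dirac measure. -/
theorem exists_eq_dirac {X : UQUS.{u}} (m : Measure X.carrier) [IsProbabilityMeasure m]
    (h : ∀ B, MeasurableSet B → m B = 0 ∨ m B = 1) : ∃ x, m = Measure.dirac x := by
  obtain ⟨x⟩ : Nonempty X.carrier := nonempty_of_isProbabilityMeasure m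
  obtain ⟨R⟩ := X.property.retract x
  have hm : Measurable fun x => Omega.toSeq (R.enc x) :=
    Omega.measurable_toSeq.comp R.measurable_enc
  have hp : IsProbabilityMeasure (m.map R.enc) :=
    Measure.isProbabilityMeasure_map R.measurable_enc.aemeasurable
  have h01 : IsZeroOneMeasure ((m.map R.enc).map Omega.toSeq) := by
    refine ⟨fun B hB => ?_⟩
    rw [Measure.map_apply Omega.measurable_toSeq hB,
      Measure.map_apply R.measurable_enc (Omega.measurable_toSeq hB)]
    exact h _ (hm hB)
  obtain ⟨z, hz⟩ := IsZeroOneMeasure.exists_eq_dirac (μ := (m.map R.enc).map Omega.toSeq)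
  refine ⟨R.dec (Omega.ofSeq z), ?_⟩
  have h1 : m.map R.enc = Measure.dirac (Omega.ofSeq z) := by
    refine Omega.measure_eq_of_map_toSeq ?_
    rw [hz, Measure.map_dirac' Omega.measurable_toSeq, Omega.toSeq_ofSeq]
  rw [← R.map_dec_map_enc m, h1, Measure.map_dirac' R.measurable_dec]

/-- The real coordinate on a retract of the sample space given by a measurable isomorphism of the
space of sequences with the real line. -/
noncomputable def realCoord {X : UQUS.{u}} (R : QUS.Retract X.obj) (x : X.carrier) : ℝ :=
  Omega.seqEquivReal (Omega.toSeq (R.enc x))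

theorem measurable_realCoord {X : UQUS.{u}} (R : QUS.Retract X.obj) : Measurable (realCoord R) :=
  Omega.seqEquivReal.measurable.comp (Omega.measurable_toSeq.comp R.measurable_enc)

/-- Probability measures on a universal space are determined by countably many values. -/
theorem measure_eq_of_realCoord {X : UQUS.{u}} (R : QUS.Retract X.obj) {m m' : Measure X.carrier}
    [IsProbabilityMeasure m] [IsProbabilityMeasure m']
    (h : ∀ q : ℚ, m (realCoord R ⁻¹' Set.Iic (q : ℝ)) = m' (realCoord R ⁻¹' Set.Iic (q : ℝ))) :
    m = m' := by
  have hm := measurable_realCoord R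
  have hp := Measure.isProbabilityMeasure_map (μ := m) hm.aemeasurable
  have hp' := Measure.isProbabilityMeasure_map (μ := m') hm.aemeasurable
  have h1 : m.map (realCoord R) = m'.map (realCoord R) := by
    refine ext_of_generate_finite _ Real.borel_eq_generateFrom_Iic_rat Real.isPiSystem_Iic_rat
      ?_ ?_
    · intro s hs
      obtain ⟨q, rfl⟩ := Set.mem_iUnion.1 hs
      rw [Measure.map_apply hm measurableSet_Iic, Measure.map_apply hm measurableSet_Iic, h]
    · simp
  refine R.measure_eq ?_
  have h2 := congrArg (Measure.map Omega.seqEquivReal.symm) h1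
  rw [Measure.map_map Omega.seqEquivReal.symm.measurable hm,
    Measure.map_map Omega.seqEquivReal.symm.measurable hm] at h2
  have h3 : Omega.seqEquivReal.symm ∘ realCoord R = fun x => Omega.toSeq (R.enc x) := by
    funext x
    simp [realCoord]
  rwa [h3] at h2

namespace Kern

open ComonObj MarkovCategory

variable {A B C D E : Kern.{u}}

theorem eval_copy_comp (f : A ⊗ A ⟶ B) (a : A.pt) :
    eval (Δ[A] ≫ f) a = eval f (pair a a) :=
  eval_pure_comp (CartesianMonoidalCategory.lift (𝟙 A.of) (𝟙 A.of)) f a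

theorem deterministic_pure {X Y : UQUS.{u}} (φ : X ⟶ Y) : Deterministic (pure φ) where
  hom_counit := MarkovCategory.discard_natural _
  hom_comul := by
    refine (pure_comp φ (CartesianMonoidalCategory.lift (𝟙 Y) (𝟙 Y))).trans ?_
    refine Eq.trans ?_ (congrArg (fun k => Δ[Kleisli.mk prob X] ≫ k) (tensorHom_pure φ φ)).symm
    exact (pure_comp (CartesianMonoidalCategory.lift (𝟙 X) (𝟙 X)) (φ ⊗ₘ φ)).symm

/-- A deterministic kernel is given by a quasi-measurable map: its measures `m` satisfy
`m B = m B * m B`, so they are Dirac measures. -/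
theorem exists_eq_pure (g : A ⟶ B) [hg : Deterministic g] :
    ∃ φ : A.of ⟶ B.of, g = pure φ := by
  have h01 : ∀ a S, MeasurableSet S → eval g a S = 0 ∨ eval g a S = 1 := by
    intro a S hS
    have hF : Measurable fun p : (B ⊗ B).pt =>
        S.indicator (1 : B.pt → ENNReal) (fst p) * S.indicator (1 : B.pt → ENNReal) (snd p) :=
      ((measurable_one.indicator hS).comp (measurable_fn _)).mul
        ((measurable_one.indicator hS).comp (measurable_fn _))
    have h1 := congrArg (fun k => ∫⁻ p, S.indicator (1 : B.pt → ENNReal) (fst p) *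
      S.indicator (1 : B.pt → ENNReal) (snd p) ∂eval k a) (Deterministic.copy_natural g)
    have h2 := lintegral_comp_pure g (CartesianMonoidalCategory.lift (𝟙 B.of) (𝟙 B.of)) a hF
    have h3 := lintegral_tensorHom g g a a hF
    rw [← eval_copy_comp] at h3
    have h4 := h2.symm.trans (h1.trans h3)
    simp only [fn_lift, fn_id, fn_fst, fn_snd] at h4
    have h5 : ∀ b, S.indicator (1 : B.pt → ENNReal) b * S.indicator (1 : B.pt → ENNReal) b =
        S.indicator (1 : B.pt → ENNReal) b := by
      intro b
      by_cases hb : b ∈ S <;> simp [hb]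
    simp only [h5] at h4
    have h6 : Measurable (S.indicator (1 : B.pt → ENNReal)) := measurable_one.indicator hS
    simp only [lintegral_const_mul _ h6, lintegral_mul_const _ h6, lintegral_indicator_one hS] at h4
    refine or_iff_not_imp_left.2 fun h0 => ?_
    exact ((ENNReal.mul_right_inj h0 (measure_ne_top _ _)).1 ((mul_one _).trans h4)).symm
  choose d hd using fun a => exists_eq_dirac (eval g a) (h01 a)
  have hdm : Measurable d := by
    intro S hS
    have : d ⁻¹' S = {a | eval g a S = 1} := by
      ext a
      rw [Set.mem_ofPred_eq, hd a, Measure.dirac_apply' _ hS]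
      by_cases ha : d a ∈ S <;> simp [ha]
    rw [this]
    exact ((Measure.measurable_coe hS).comp (measurable_eval g)) (measurableSet_singleton _)
  exact ⟨ofMeasurable d hdm, ext_eval hd⟩

/-! ### Distribution objects and almost sure equality -/

/-- The distribution object of `X` is `P(X)`; the sampling morphism is the identity map of `P(X)`,
read as a kernel from `P(X)` to `X`. -/
theorem isRepresentable : IsRepresentable Kern.{u} := by
  intro X
  let samp : Kleisli.mk prob (prob.obj X.of) ⟶ X := .mk (𝟙 _)
  have hs : ∀ {A : Kern.{u}} (φ : A.of ⟶ prob.obj X.of) a,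
      eval (pure φ ≫ samp) a = toMeasure (fn φ a) := fun φ a => eval_pure_comp φ samp a
  refine ⟨_, samp, fun A f => ⟨pure f.of, ⟨deterministic_pure _, ext_eval (hs f.of)⟩, ?_⟩⟩
  rintro g ⟨hg, hgf⟩
  obtain ⟨φ, rfl⟩ := exists_eq_pure g
  congr 1
  refine hom_ext' fun a => toMeasure_injective ?_
  rw [← hs φ a, hgf]
  rfl

theorem lintegral_copy_whiskerLeft (p : D ⟶ A) (f : A ⟶ B) (s : D.pt)
    {F : (A ⊗ B).pt → ENNReal} (hF : Measurable F) :
    ∫⁻ z, F z ∂eval (p ≫ Δ[A] ≫ (A ◁ f)) s = ∫⁻ a, ∫⁻ b, F (pair a b) ∂eval f a ∂eval p s := by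
  rw [lintegral_comp _ _ _ hF]
  refine lintegral_congr fun a => ?_
  rw [eval_copy_comp, lintegral_whiskerLeft _ _ _ hF]

/-- Almost sure equality in the categorical sense is almost sure equality of the measures. -/
theorem asEq_iff (p : D ⟶ A) (f g : A ⟶ B) :
    ASEq p f g ↔ ∀ s, ∀ᵐ a ∂eval p s, eval f a = eval g a := by
  constructor
  · intro h s
    obtain ⟨a₀⟩ : Nonempty A.pt := nonempty_of_isProbabilityMeasure (eval p s)
    obtain ⟨b₀⟩ : Nonempty B.pt := nonempty_of_isProbabilityMeasure (eval f a₀)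
    obtain ⟨R⟩ := B.of.property.retract b₀
    -- A probability measure on the real line is determined by countably many half-lines.
    have key : ∀ q : ℚ, ∀ᵐ a ∂eval p s, eval f a (realCoord R ⁻¹' Set.Iic (q : ℝ)) =
        eval g a (realCoord R ⁻¹' Set.Iic (q : ℝ)) := by
      intro q
      have hS : MeasurableSet (realCoord R ⁻¹' Set.Iic (q : ℝ)) :=
        measurable_realCoord R measurableSet_Iic
      have hms : ∀ f : A ⟶ B, Measurable fun a => eval f a (realCoord R ⁻¹' Set.Iic (q : ℝ)) :=
        fun f => (Measure.measurable_coe hS).comp (measurable_eval f)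
      refine ae_eq_of_forall_setLIntegral_eq_of_sigmaFinite (hms f) (hms g) fun C hC _ => ?_
      have hF : Measurable fun z : (A ⊗ B).pt => C.indicator (1 : A.pt → ENNReal) (fst z) *
          (realCoord R ⁻¹' Set.Iic (q : ℝ)).indicator (1 : B.pt → ENNReal) (snd z) :=
        ((measurable_one.indicator hC).comp (measurable_fn _)).mul
          ((measurable_one.indicator hS).comp (measurable_fn _))
      have hint : ∀ f : A ⟶ B, ∫⁻ a in C, eval f a (realCoord R ⁻¹' Set.Iic (q : ℝ)) ∂eval p s =
          ∫⁻ z, C.indicator (1 : A.pt → ENNReal) (fst z) *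
          (realCoord R ⁻¹' Set.Iic (q : ℝ)).indicator (1 : B.pt → ENNReal) (snd z)
            ∂eval (p ≫ Δ[A] ≫ (A ◁ f)) s := by
        intro f
        rw [lintegral_copy_whiskerLeft p f s hF, ← lintegral_indicator hC]
        refine lintegral_congr fun a => ?_
        simp only [fn_fst, fn_snd]
        rw [lintegral_const_mul _ (measurable_one.indicator hS), lintegral_indicator_one hS]
        by_cases ha : a ∈ C <;> simp [ha]
      rw [hint f, hint g]
      exact congrArg (fun k => ∫⁻ z, C.indicator (1 : A.pt → ENNReal) (fst z) *
          (realCoord R ⁻¹' Set.Iic (q : ℝ)).indicator (1 : B.pt → ENNReal) (snd z) ∂eval k s) h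
    filter_upwards [ae_all_iff.2 key] with a ha using measure_eq_of_realCoord R ha
  · intro h
    refine ext_lintegral fun s F hF => ?_
    rw [lintegral_copy_whiskerLeft p f s hF, lintegral_copy_whiskerLeft p g s hF]
    refine lintegral_congr_ae ?_
    filter_upwards [h s] with a ha
    rw [ha]

/-- For any distribution object, the sampling morphism separates points, so two deterministic
morphisms agree at a point if and only if the sampled measures do. -/
theorem isASCompatiblyRepresentable : IsASCompatiblyRepresentable Kern.{u} := by
  refine ⟨isRepresentable, fun X D samp hsamp S A p g h hg hh => ?_⟩
  obtain ⟨φ, rfl⟩ := exists_eq_pure g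
  obtain ⟨ψ, rfl⟩ := exists_eq_pure h
  have hinj : ∀ d d' : D.pt, eval samp d = eval samp d' → d = d' := by
    intro d d' hd
    let c : D.pt → (𝟙_ UQUS.{u} ⟶ D.of) := fun d => ofMeasurable (fun _ => d) measurable_const
    have he : pure (c d) ≫ samp = pure (c d') ≫ samp := ext_eval fun x => by
      refine (eval_pure_comp (c d) samp x).trans (Eq.trans hd (eval_pure_comp (c d') samp x).symm)
    have h1 : pure (c d) = pure (c d') :=
      (hsamp (Kleisli.mk prob (𝟙_ UQUS)) (pure (c d) ≫ samp)).unique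
        ⟨deterministic_pure _, rfl⟩ ⟨deterministic_pure _, he.symm⟩
    exact dirac_injective (congrArg (fun k => eval k PUnit.unit) h1)
  rw [asEq_iff, asEq_iff]
  refine forall_congr' fun s => ⟨fun h => ?_, fun h => ?_⟩
  · filter_upwards [h] with a ha
    have h1 := hinj _ _ ((eval_pure_comp φ samp a).symm.trans (ha.trans (eval_pure_comp ψ samp a)))
    exact congrArg Measure.dirac h1
  · filter_upwards [h] with a ha
    refine measure_ext fun F hF => ?_
    rw [lintegral_comp _ _ _ hF, lintegral_comp _ _ _ hF, ha]

end Kern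

end UQUS

/-! ### Conditionals -/

namespace UQUS

variable {X Y T : UQUS.{u}}

theorem measurable_omegaUp : Measurable omegaUp.{u} :=
  QUS.measurable_of_mem (X := omega.obj) (α := omegaUp) measurable_id

theorem measurable_omegaDown : Measurable omegaDown.{u} :=
  QUS.measurable_iff_forall_mem.2 fun _ hα => hα

/-- The lifted sample space as a retract of the sample space. -/
def omegaRetract : QUS.Retract omega.{u}.obj where
  enc := omegaDown
  dec := omegaUp
  measurable_enc := measurable_omegaDown
  dec_mem := measurable_id
  dec_enc _ := rfl

/-- A point of the lifted sample space as a point of the Borel space of sequences. -/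
def seq (x : omega.{u}.carrier) : ℕ → ℝ := Omega.toSeq (omegaDown x)

@[fun_prop]
theorem measurable_seq : Measurable seq.{u} :=
  Omega.measurable_toSeq.comp measurable_omegaDown

/-- The section of a retract of the sample space, as a morphism. -/
def encHom (R : QUS.Retract X.obj) : X ⟶ omega.{u} :=
  ofMeasurable (fun x => omegaUp (R.enc x)) (measurable_omegaUp.comp R.measurable_enc)

/-- The retraction onto a retract of the sample space, as a morphism. -/
def decHom (R : QUS.Retract X.obj) : omega.{u} ⟶ X :=
  ofMeasurable (fun x => R.dec (omegaDown x)) (R.measurable_dec.comp measurable_omegaDown)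

@[simp] theorem fn_decHom_fn_encHom (R : QUS.Retract X.obj) (x : X.carrier) :
    fn (decHom R) (fn (encHom R) x) = x := R.dec_enc x

/-- A measurable family of Borel measures extends to a kernel on the universally measurable sets. -/
theorem exists_extension (κ : T.carrier → Measure (ℕ → ℝ)) (hp : ∀ t, IsProbabilityMeasure (κ t))
    (hκ : Measurable κ) :
    ∃ k : T ⟶ prob.obj omega.{u}, ∀ t, (toMeasure (fn k t)).map seq = κ t := by
  have h1 : Measurable fun t => (Omega.univExt (κ t)).map omegaUp.{u} := by
    refine QUS.measurable_iff_forall_mem.2 fun α hα => ?_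
    refine (Measure.measurable_map _ measurable_omegaUp).comp ?_
    refine Omega.measurable_measure_of_borel (fun _ => inferInstance) ?_
    simp only [Omega.map_toSeq_univExt]
    exact hκ.comp (QUS.measurable_of_mem hα)
  refine ⟨ofKernel _ (fun t => Measure.isProbabilityMeasure_map measurable_omegaUp.aemeasurable) h1,
    fun t => ?_⟩
  rw [toMeasure_ofKernel, Measure.map_map measurable_seq measurable_omegaUp]
  exact Omega.map_toSeq_univExt _

/-- A point of the square of the sample space as a pair of sequences. -/
def seqPair (p : (omega.{u} ⊗ omega.{u}).carrier) : (ℕ → ℝ) × (ℕ → ℝ) :=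
  (seq (fn (CartesianMonoidalCategory.fst omega omega) p),
    seq (fn (CartesianMonoidalCategory.snd omega omega) p))

@[fun_prop]
theorem measurable_seqPair : Measurable seqPair.{u} :=
  (measurable_seq.comp (measurable_fn _)).prodMk (measurable_seq.comp (measurable_fn _))

theorem measure_eq_of_map_seqPair {m m' : Measure (omega.{u} ⊗ omega.{u}).carrier}
    [IsProbabilityMeasure m] (h : m.map seqPair = m'.map seqPair) : m = m' := by
  have hj := Omega.measurable_toSeq_pair_ofSeq
  refine (prodRetract omegaRetract omegaRetract).measure_eq ?_
  have h1 := congrArg (Measure.map fun q : (ℕ → ℝ) × (ℕ → ℝ) =>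
      Omega.toSeq (Omega.pair (Omega.ofSeq q.1) (Omega.ofSeq q.2))) h
  rw [Measure.map_map hj measurable_seqPair, Measure.map_map hj measurable_seqPair] at h1
  exact h1

namespace Kern

open ComonObj MarkovCategory ProbabilityTheory

variable {A B C D E : Kern.{u}}

theorem whiskerLeft_discard (B C : Kern.{u}) :
    (B ◁ ε[C]) ≫ (ρ_ B).hom = pure (CartesianMonoidalCategory.fst B.of C.of) := by
  refine (congrArg (fun k => k ≫ (ρ_ B).hom) (whiskerLeft_pure (toUnit C.of) B)).trans ?_
  rw [rightUnitor_hom]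
  refine (pure_comp (B.of ◁ toUnit C.of) (ρ_ B.of).hom).trans ?_
  rfl

theorem lintegral_marginal (f : A ⟶ B ⊗ C) (a : A.pt) {F : B.pt → ENNReal} (hF : Measurable F) :
    ∫⁻ b, F b ∂eval (f ≫ (B ◁ ε[C]) ≫ (ρ_ B).hom) a = ∫⁻ p, F (fst p) ∂eval f a := by
  rw [whiskerLeft_discard]
  exact lintegral_comp_pure _ _ _ hF

/-- Copying the input, sampling from the marginal of `f`, copying the result and applying `c`. -/
theorem lintegral_conditional (f : A ⟶ B ⊗ C) (c : B ⊗ A ⟶ C) (a : A.pt)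
    {F : (B ⊗ C).pt → ENNReal} (hF : Measurable F) :
    ∫⁻ p, F p ∂eval (Δ[A] ≫ ((f ≫ (B ◁ ε[C]) ≫ (ρ_ B).hom) ▷ A) ≫ (Δ[B] ▷ A) ≫
      (α_ B B A).hom ≫ (B ◁ c)) a =
      ∫⁻ p, ∫⁻ y, F (pair (fst p) y) ∂eval c (pair (fst p) a) ∂eval f a := by
  have h1 : (Δ[B] ▷ A) ≫ (α_ B B A).hom = pure
      ((CartesianMonoidalCategory.lift (𝟙 B.of) (𝟙 B.of) ▷ A.of) ≫ (α_ B.of B.of A.of).hom) := by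
    refine (congrArg (fun k => k ≫ (α_ B B A).hom) (whiskerRight_pure
      (CartesianMonoidalCategory.lift (𝟙 B.of) (𝟙 B.of)) A)).trans ?_
    exact pure_comp (CartesianMonoidalCategory.lift (𝟙 B.of) (𝟙 B.of) ▷ A.of)
      (α_ B.of B.of A.of).hom
  have h2 : ∀ b, ∫⁻ p, F p ∂eval ((Δ[B] ▷ A) ≫ (α_ B B A).hom ≫ (B ◁ c)) (pair b a) =
      ∫⁻ y, F (pair b y) ∂eval c (pair b a) := by
    intro b
    rw [← Category.assoc, h1]
    refine (congrArg (fun m => ∫⁻ p, F p ∂m) (eval_pure_comp _ (B ◁ c) _)).trans ?_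
    exact lintegral_whiskerLeft c b (pair b a) hF
  rw [eval_copy_comp, lintegral_comp _ _ _ hF, lintegral_whiskerRight _ _ _
    (measurable_lintegral_eval _ hF)]
  simp only [h2]
  exact lintegral_marginal f a (measurable_lintegral_param c (by fun_prop) (by fun_prop))

/-- Conditionals for kernels into the square of the sample space are given by the disintegration of
kernels on the Borel space of sequences. -/
theorem exists_conditional_omega
    (f : A ⟶ Kleisli.mk prob omega.{u} ⊗ Kleisli.mk prob omega.{u}) :
    ∃ c : Kleisli.mk prob omega ⊗ A ⟶ Kleisli.mk prob omega,
      f = Δ[A] ≫ ((f ≫ (Kleisli.mk prob omega ◁ ε[Kleisli.mk prob omega]) ≫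
        (ρ_ (Kleisli.mk prob omega)).hom) ▷ A) ≫ (Δ[Kleisli.mk prob omega] ▷ A) ≫
        (α_ (Kleisli.mk prob omega) (Kleisli.mk prob omega) A).hom ≫
        (Kleisli.mk prob omega ◁ c) := by
  let κ : Kernel A.pt ((ℕ → ℝ) × (ℕ → ℝ)) :=
    ⟨fun a => (eval f a).map seqPair, (Measure.measurable_map _ measurable_seqPair).comp
      (measurable_eval f)⟩
  have hκ : IsMarkovKernel κ := ⟨fun a =>
    haveI := isProbabilityMeasure_eval f a
    Measure.isProbabilityMeasure_map (μ := eval f a) measurable_seqPair.aemeasurable⟩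
  obtain ⟨k, hk⟩ := exists_extension (T := omega ⊗ A.of)
    (fun t => κ.condKernel (fn (CartesianMonoidalCategory.snd omega A.of) t,
      seq (fn (CartesianMonoidalCategory.fst omega A.of) t))) (fun t => inferInstance)
    (κ.condKernel.measurable.comp ((measurable_fn _).prodMk
      (measurable_seq.comp (measurable_fn _))))
  let c : Kleisli.mk prob omega ⊗ A ⟶ Kleisli.mk prob omega := .mk k
  refine ⟨c, ext_eval fun a => ?_⟩
  have := isProbabilityMeasure_eval f a
  refine measure_eq_of_map_seqPair (measure_ext fun H hH => ?_)
  rw [lintegral_map hH measurable_seqPair, lintegral_map hH measurable_seqPair]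
  refine Eq.trans ?_ (lintegral_conditional f c a (hH.comp measurable_seqPair)).symm
  have h1 : ∀ p : (omega.{u} ⊗ omega.{u}).carrier,
      ∫⁻ y, H (seqPair (UQUS.pair (fn (CartesianMonoidalCategory.fst omega omega) p) y)) ∂eval c
        (UQUS.pair (fn (CartesianMonoidalCategory.fst omega omega) p) a) =
      ∫⁻ v, H ((seqPair p).1, v) ∂κ.condKernel (a, (seqPair p).1) := by
    intro p
    have h2 := hk (UQUS.pair (fn (CartesianMonoidalCategory.fst omega omega) p) a)
    refine Eq.trans ?_ (congrArg (fun m => ∫⁻ v, H ((seqPair p).1, v) ∂m) h2)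
    exact (lintegral_map (μ := toMeasure (fn k (UQUS.pair _ a)))
      (f := fun v => H ((seqPair p).1, v)) (g := seq) (hH.comp measurable_prodMk_left)
      measurable_seq).symm
  have h3 : Measurable fun u => ∫⁻ v, H (u, v) ∂κ.condKernel (a, u) := by
    have := Measurable.lintegral_kernel_prod_right' (κ := κ.condKernel.comap (fun u => (a, u))
      measurable_prodMk_left) hH
    exact this
  calc ∫⁻ p, H (seqPair p) ∂eval f a = ∫⁻ q, H q ∂κ a := (lintegral_map hH measurable_seqPair).symm
    _ = ∫⁻ q, H q ∂(κ.fst ⊗ₖ κ.condKernel) a := by rw [κ.disintegrate]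
    _ = ∫⁻ u, ∫⁻ v, H (u, v) ∂κ.condKernel (a, u) ∂κ.fst a :=
      Kernel.lintegral_compProd _ _ _ hH
    _ = ∫⁻ q, ∫⁻ v, H (q.1, v) ∂κ.condKernel (a, q.1) ∂κ a := by
      rw [Kernel.fst_apply, lintegral_map h3 measurable_fst]
    _ = ∫⁻ p, ∫⁻ v, H ((seqPair p).1, v) ∂κ.condKernel (a, (seqPair p).1) ∂eval f a :=
      lintegral_map (h3.comp measurable_fst) measurable_seqPair
    _ = _ := (lintegral_congr h1).symm

/-- The general case follows from the one of the sample space: outputs are encoded, conditioned as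
points of the sample space, and decoded. -/
theorem hasConditionals : HasConditionals Kern.{u} := by
  intro A X Y f
  rcases isEmpty_or_nonempty A.pt with hA | ⟨⟨a₀⟩⟩
  · have : IsEmpty (X ⊗ A).pt := ⟨fun p => hA.false (snd p)⟩
    refine ⟨.mk (ofMeasurable (fun p => isEmptyElim p) (fun S _ => ?_)),
      ext_eval fun a => hA.elim a⟩
    rw [Set.eq_empty_of_isEmpty (_ ⁻¹' S)]
    exact MeasurableSet.empty
  · obtain ⟨p₀⟩ : Nonempty (X ⊗ Y).pt := nonempty_of_isProbabilityMeasure (eval f a₀)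
    obtain ⟨R⟩ := X.of.property.retract (fst p₀)
    obtain ⟨S⟩ := Y.of.property.retract (snd p₀)
    obtain ⟨c, hc⟩ := exists_conditional_omega (f ≫ pure (encHom R ⊗ₘ encHom S))
    refine ⟨pure (encHom R ▷ A.of) ≫ c ≫ pure (decHom S), ext_lintegral fun a F hF => ?_⟩
    rw [lintegral_conditional _ _ _ hF]
    have hF' : Measurable fun p => F (fn (decHom R ⊗ₘ decHom S) p) := by fun_prop
    have h1 := congrArg (fun k => ∫⁻ p, F (fn (decHom R ⊗ₘ decHom S) p) ∂eval k a) hc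
    have h2 := h1.trans (lintegral_conditional _ c a hF')
    have h3 := (lintegral_comp_pure f (encHom R ⊗ₘ encHom S) a hF').symm.trans
      (h2.trans (lintegral_comp_pure f (encHom R ⊗ₘ encHom S) a
        (measurable_lintegral_param c (by fun_prop) (by fun_prop))))
    have h4 : ∀ p : (X ⊗ Y).pt,
        fn (decHom R ⊗ₘ decHom S) (fn (encHom R ⊗ₘ encHom S) p) = p :=
      forall_pair.2 fun x y => by
        simp only [fn_tensorHom, fn_decHom_fn_encHom]
    simp only [h4] at h3
    refine h3.trans (lintegral_congr fun p => ?_)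
    have hF'' : Measurable fun y => F (pair (fst p) y) := by fun_prop
    refine Eq.trans ?_ (congrArg (fun m => ∫⁻ y, F (pair (fst p) y) ∂m)
      (eval_pure_comp (encHom R ▷ A.of) (c ≫ pure (decHom S)) (pair (fst p) a))).symm
    refine Eq.trans ?_ (lintegral_comp_pure c (decHom S) _ hF'').symm
    refine lintegral_congr fun y => congrArg F ?_
    exact congrArg (fun x => UQUS.pair x (fn (decHom S) y)) (fn_decHom_fn_encHom R (fst p))

end Kern

end UQUS

/-! ### Projective limits of probability measures -/

section MarkovChain

open ProbabilityTheory

variable {S : Type*} [MeasurableSpace S] [StandardBorelSpace S] [Nonempty S]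

/-- Given compatible joint laws of consecutive terms, there is a Markov chain that realizes them:
its transition kernels are the conditional kernels of the joint laws, and its law on the space of
trajectories exists by the theorem of Ionescu-Tulcea. -/
theorem exists_measure_consecutive (ρ : ℕ → Measure (S × S)) [∀ n, IsProbabilityMeasure (ρ n)]
    (h : ∀ n, (ρ n).snd = (ρ (n + 1)).fst) :
    ∃ M : Measure (ℕ → S), IsProbabilityMeasure M ∧
      ∀ n, M.map (fun x => (x n, x (n + 1))) = ρ n := by
  let κ : (n : ℕ) → Kernel (∀ _ : Finset.Iic n, S) S := fun n =>
    (ρ n).condKernel.comap (fun x => x ⟨n, Finset.mem_Iic.2 le_rfl⟩) (measurable_pi_apply _)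
  let M : Measure (ℕ → S) := Kernel.trajMeasure (X := fun _ => S) (ρ 0).fst κ
  have hstep : ∀ n, M.map (fun x => x n) = (ρ n).fst →
      M.map (fun x => (x n, x (n + 1))) = ρ n := by
    intro n hn
    have h1 : M.map (Preorder.frestrictLe n) ⊗ₘ κ n =
        M.map fun x => (Preorder.frestrictLe n x, x (n + 1)) :=
      Kernel.map_frestrictLe_trajMeasure_compProd_eq_map_trajMeasure (X := fun _ => S)
    have hm : Measurable fun q : (∀ _ : Finset.Iic n, S) × S =>
        (q.1 ⟨n, Finset.mem_Iic.2 le_rfl⟩, q.2) := by fun_prop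
    have h2 := congrArg (Measure.map fun q : (∀ _ : Finset.Iic n, S) × S =>
        (q.1 ⟨n, Finset.mem_Iic.2 le_rfl⟩, q.2)) h1
    rw [Measure.map_map hm (by fun_prop)] at h2
    refine Eq.trans h2.symm (UQUS.measure_ext fun F hF => ?_)
    refine (lintegral_map hF hm).trans ((Measure.lintegral_compProd (hF.comp hm)).trans ?_)
    have hG : Measurable fun u => ∫⁻ v, F (u, v) ∂(ρ n).condKernel u :=
      Measurable.lintegral_kernel_prod_right' hF
    calc ∫⁻ x, ∫⁻ v, F (x ⟨n, _⟩, v) ∂κ n x ∂M.map (Preorder.frestrictLe n)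
        = ∫⁻ x, ∫⁻ v, F (x n, v) ∂(ρ n).condKernel (x n) ∂M :=
          lintegral_map (f := fun x => ∫⁻ v, F (x ⟨n, _⟩, v) ∂κ n x)
            (hG.comp (measurable_pi_apply _)) (by fun_prop)
      _ = ∫⁻ u, ∫⁻ v, F (u, v) ∂(ρ n).condKernel u ∂M.map fun x => x n :=
          (lintegral_map hG (measurable_pi_apply n)).symm
      _ = ∫⁻ q, F q ∂((ρ n).fst ⊗ₘ (ρ n).condKernel) := by
          rw [hn, Measure.lintegral_compProd hF]
      _ = ∫⁻ q, F q ∂ρ n := by rw [(ρ n).disintegrate]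
  have hmarg : ∀ n, M.map (fun x => x n) = (ρ n).fst := by
    intro n
    induction n with
    | zero =>
      have h0 : Measurable fun x : ∀ _ : Finset.Iic 0, S => x ⟨0, Finset.mem_Iic.2 le_rfl⟩ :=
        measurable_pi_apply _
      have h1 : M.map (Preorder.frestrictLe 0) =
          (ρ 0).fst.map (MeasurableEquiv.piUnique fun _ : Finset.Iic 0 => S).symm := by
        refine (Measure.map_comp _ _ (Preorder.measurable_frestrictLe 0)).trans ?_
        rw [Kernel.traj_map_frestrictLe, Kernel.partialTraj_self, Measure.id_comp]
      have h2 := congrArg (Measure.map fun x : ∀ _ : Finset.Iic 0, S =>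
        x ⟨0, Finset.mem_Iic.2 le_rfl⟩) h1
      rw [Measure.map_map h0 (by fun_prop), Measure.map_map h0 (by fun_prop)] at h2
      exact h2.trans Measure.map_id
    | succ n ih =>
      rw [← h n, ← hstep n ih, Measure.snd, Measure.map_map measurable_snd (by fun_prop)]
      rfl
  exact ⟨M, inferInstance, fun n => hstep n (hmarg n)⟩

end MarkovChain

namespace UQUS

/-- A consistent sequence of probability measures on a sequence of universal spaces comes from a
probability measure on the compatible sequences of points: a Markov chain in the space of sequences
that follows the laws of the codes is decoded. -/
theorem exists_measure_pi (Z : ℕ → UQUS.{u}) (p : ∀ n, Z (n + 1) ⟶ Z n)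
    (μ : ∀ n, Measure (Z n).carrier) [hμ : ∀ n, IsProbabilityMeasure (μ n)]
    (h : ∀ n, (μ (n + 1)).map (fn (p n)) = μ n) :
    ∃ m : Measure (pi Z).carrier, IsProbabilityMeasure m ∧
      (∀ᵐ z ∂m, ∀ n, fn (p n) (fn (proj Z (n + 1)) z) = fn (proj Z n) z) ∧
      ∀ n, m.map (fn (proj Z n)) = μ n := by
  have hR : ∀ n, Nonempty (QUS.Retract (Z n).obj) := fun n =>
    (Z n).property.retract (nonempty_of_isProbabilityMeasure (μ n)).some
  let R : ∀ n, QUS.Retract (Z n).obj := fun n => (hR n).some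
  have hs : ∀ n, Measurable fun z => Omega.toSeq ((R n).enc z) := fun n =>
    Omega.measurable_toSeq.comp (R n).measurable_enc
  let j : ∀ n, (Z (n + 1)).carrier → (ℕ → ℝ) × (ℕ → ℝ) := fun n z =>
    (Omega.toSeq ((R n).enc (fn (p n) z)), Omega.toSeq ((R (n + 1)).enc z))
  have hj : ∀ n, Measurable (j n) := fun n =>
    ((hs n).comp (measurable_fn (p n))).prodMk (hs (n + 1))
  have hρ : ∀ n, IsProbabilityMeasure ((μ (n + 1)).map (j n)) := fun n =>
    Measure.isProbabilityMeasure_map (hj n).aemeasurable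
  obtain ⟨M, hM, hMρ⟩ := exists_measure_consecutive (fun n => (μ (n + 1)).map (j n)) (fun n => by
    rw [Measure.snd, Measure.fst, Measure.map_map measurable_snd (hj n),
      Measure.map_map measurable_fst (hj (n + 1)), ← h (n + 1),
      Measure.map_map (measurable_snd.comp (hj n)) (measurable_fn _)]
    rfl)
  -- The codes of a sequence of points are collected in one sequence, as in the product of retracts.
  let e : (ℕ → ℕ → ℝ) → (ℕ → ℝ) := fun x k =>
    ((Encodable.decode k : Option (ℕ × ℕ)).map fun i => x i.1 i.2).getD 0
  have he : Measurable e := by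
    refine measurable_pi_iff.2 fun k => ?_
    simp only [e]
    rcases (Encodable.decode k : Option (ℕ × ℕ)) with _ | ⟨i, l⟩
    · exact measurable_const
    · exact (measurable_pi_apply l).comp (measurable_pi_apply i)
  have hMe : IsProbabilityMeasure (M.map e) := Measure.isProbabilityMeasure_map he.aemeasurable
  let N : Measure Omega := Omega.univExt (M.map e)
  let c : ℕ → Omega → Omega := fun n ω =>
    Omega.ofSeq fun k => Omega.toSeq ω (Encodable.encode (n, k))
  have hc : ∀ n, Measurable (c n) := fun n =>
    Omega.measurable_of_apply fun k => Omega.measurable_apply _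
  have hce : ∀ n x, Omega.toSeq (c n (Omega.ofSeq (e x))) = x n := by
    intro n x
    funext k
    exact congrArg (fun o : Option (ℕ × ℕ) => (o.map fun i => x i.1 i.2).getD 0)
      (Encodable.encodek (n, k))
  have hP : ∀ n, Measurable fun ω => Omega.pair (c n ω) (c (n + 1) ω) := fun n =>
    Omega.measurable_pair (hc n) (hc (n + 1))
  have hQ : ∀ n, Measurable fun z =>
      Omega.pair ((R n).enc (fn (p n) z)) ((R (n + 1)).enc z) := fun n =>
    QUS.measurable_of_toSeq (X := (Z (n + 1)).obj) (Omega.measurable_toSeq_pair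
      ((R n).measurable_enc.comp (measurable_fn (p n))) (R (n + 1)).measurable_enc)
  have hlaw : ∀ n, N.map (fun ω => Omega.pair (c n ω) (c (n + 1) ω)) =
      (μ (n + 1)).map fun z => Omega.pair ((R n).enc (fn (p n) z)) ((R (n + 1)).enc z) := by
    intro n
    have hG : Measurable fun x : ℕ → ℝ =>
        Omega.toSeq (Omega.pair (c n (Omega.ofSeq x)) (c (n + 1) (Omega.ofSeq x))) :=
      Omega.measurable_toSeq_pair_ofSeq.comp (Measurable.prodMk
        (measurable_pi_iff.2 fun k => measurable_pi_apply (Encodable.encode (n, k)))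
        (measurable_pi_iff.2 fun k => measurable_pi_apply (Encodable.encode (n + 1, k))))
    have hNP : IsProbabilityMeasure
        (N.map fun ω => Omega.pair (c n ω) (c (n + 1) ω)) :=
      Measure.isProbabilityMeasure_map (hP n).aemeasurable
    refine Omega.measure_eq_of_map_toSeq ?_
    rw [Measure.map_map Omega.measurable_toSeq (hP n),
      Measure.map_map Omega.measurable_toSeq (hQ n)]
    have h1 := (Measure.map_map (μ := N) hG Omega.measurable_toSeq).symm
    refine h1.trans ?_
    rw [Omega.map_toSeq_univExt, Measure.map_map hG he]
    have h2 := congrArg (Measure.map fun q : (ℕ → ℝ) × (ℕ → ℝ) =>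
      Omega.toSeq (Omega.pair (Omega.ofSeq q.1) (Omega.ofSeq q.2))) (hMρ n)
    rw [Measure.map_map Omega.measurable_toSeq_pair_ofSeq (by fun_prop),
      Measure.map_map Omega.measurable_toSeq_pair_ofSeq (hj n)] at h2
    refine Eq.trans (congrArg (fun g => M.map g) (funext fun x => ?_)) h2
    exact congrArg₂ (fun a b => Omega.toSeq (Omega.pair (Omega.ofSeq a) (Omega.ofSeq b)))
      (hce n x) (hce (n + 1) x)
  let D : QUS.Retract (pi Z).obj := QUS.Retract.pi R
  have hDm : Measurable fun ω => (D.dec ω : (pi Z).carrier) := D.measurable_dec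
  refine ⟨N.map fun ω => (D.dec ω : (pi Z).carrier),
    Measure.isProbabilityMeasure_map hDm.aemeasurable, ?_, fun n => ?_⟩
  · refine ae_all_iff.2 fun n => ?_
    -- Compatibility is tested on codes, where the diagonal is measurable.
    have hS : MeasurableSet {ω | Omega.toSeq ((R n).enc ((R n).dec (Omega.fst ω))) =
        Omega.toSeq ((R n).enc (fn (p n) ((R (n + 1)).dec (Omega.snd ω))))} :=
      measurableSet_eq_fun
        ((hs n).comp ((R n).measurable_dec.comp Omega.measurable_fst))
        ((hs n).comp ((measurable_fn (p n)).comp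
          ((R (n + 1)).measurable_dec.comp Omega.measurable_snd)))
    have h1 : ∀ᵐ ω ∂N.map fun ω => Omega.pair (c n ω) (c (n + 1) ω),
        Omega.toSeq ((R n).enc ((R n).dec (Omega.fst ω))) =
          Omega.toSeq ((R n).enc (fn (p n) ((R (n + 1)).dec (Omega.snd ω)))) := by
      rw [hlaw n, ae_map_iff (hQ n).aemeasurable hS]
      refine ae_of_all _ fun z => ?_
      rw [Omega.fst_pair, Omega.snd_pair, (R n).dec_enc, (R (n + 1)).dec_enc]
    have h2 : ∀ᵐ z ∂N.map fun ω => (D.dec ω : (pi Z).carrier),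
        Omega.toSeq ((R n).enc (fn (p n) (fn (proj Z (n + 1)) z))) =
          Omega.toSeq ((R n).enc (fn (proj Z n) z)) := by
      refine (ae_map_iff hDm.aemeasurable ?_).2 ?_
      · exact measurableSet_eq_fun
          ((hs n).comp ((measurable_fn (p n)).comp (measurable_fn (proj Z (n + 1)))))
          ((hs n).comp (measurable_fn (proj Z n)))
      filter_upwards [ae_of_ae_map (hP n).aemeasurable h1] with ω hω
      rw [Omega.fst_pair, Omega.snd_pair] at hω
      exact hω.symm
    filter_upwards [h2] with z hz
    have h3 := congrArg (R n).dec hz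
    exact ((R n).dec_enc _).symm.trans (h3.trans ((R n).dec_enc _))
  · rw [Measure.map_map (measurable_fn _) hDm]
    have hdf : Measurable fun ω => ((R n).dec (Omega.fst ω) : (Z n).carrier) :=
      (R n).measurable_dec.comp Omega.measurable_fst
    have h1 := congrArg (Measure.map fun ω => ((R n).dec (Omega.fst ω) : (Z n).carrier)) (hlaw n)
    rw [Measure.map_map hdf (hP n), Measure.map_map hdf (hQ n)] at h1
    have h2 : (fun ω => ((R n).dec (Omega.fst ω) : (Z n).carrier)) ∘
        (fun z => Omega.pair ((R n).enc (fn (p n) z)) ((R (n + 1)).enc z)) = fn (p n) :=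
      funext fun z => (congrArg (R n).dec (Omega.fst_pair _ _)).trans ((R n).dec_enc _)
    rw [h2, h n] at h1
    refine Eq.trans (congrArg (fun g => N.map g) (funext fun ω => ?_)) h1
    exact congrArg (R n).dec (Omega.fst_pair _ _).symm

end UQUS

/-! ### Kolmogorov products -/

namespace UQUS

section Tower

variable {Z : ℕ → UQUS.{u}} {p : ∀ n, Z (n + 1) ⟶ Z n} {M : UQUS.{u}} {q : ∀ n, M ⟶ Z n}
  {r : pi Z ⟶ M}

/-- The preimages of measurable sets under the maps `q n`. -/
def cylinders (q : ∀ n, M ⟶ Z n) : Set (Set M.carrier) :=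
  {S | ∃ n T, MeasurableSet T ∧ fn (q n) ⁻¹' T = S}

theorem generateFrom_cylinders_le (q : ∀ n, M ⟶ Z n) :
    MeasurableSpace.generateFrom (cylinders q) ≤ (inferInstance : MeasurableSpace M.carrier) := by
  refine MeasurableSpace.generateFrom_le ?_
  rintro _ ⟨n, T, hT, rfl⟩
  exact measurable_fn (q n) hT

/-- By `hq`, finitely many cylinders are preimages under a single map `q n`. -/
theorem isPiSystem_cylinders (hq : ∀ n, q (n + 1) ≫ p n = q n) : IsPiSystem (cylinders q) := by
  have h : ∀ n (T : Set (Z n).carrier), MeasurableSet T → ∀ k, n ≤ k →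
      ∃ T' : Set (Z k).carrier, MeasurableSet T' ∧ fn (q k) ⁻¹' T' = fn (q n) ⁻¹' T := by
    intro n T hT k hk
    induction k, hk using Nat.le_induction with
    | base => exact ⟨T, hT, rfl⟩
    | succ k _ ih =>
      obtain ⟨T', hT', h⟩ := ih
      refine ⟨fn (p k) ⁻¹' T', measurable_fn _ hT', ?_⟩
      rw [← h, ← hq k]
      rfl
  rintro _ ⟨n, T, hT, rfl⟩ _ ⟨n', T', hT', rfl⟩ -
  obtain ⟨U, hU, h1⟩ := h n T hT _ (le_max_left n n')
  obtain ⟨U', hU', h2⟩ := h n' T' hT' _ (le_max_right n n')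
  refine ⟨max n n', U ∩ U', hU.inter hU', ?_⟩
  rw [Set.preimage_inter, h1, h2]

/-- A retract `M` of a product of retracts of the sample space, with section given by the maps `q n`
and retraction `r`. -/
def towerRetract (R : ∀ n, QUS.Retract (Z n).obj) (hr : ∀ m, fn r (fn (piLift q) m) = m) :
    QUS.Retract M.obj where
  enc m := (QUS.Retract.pi R).enc (fn (piLift q) m)
  dec ω := fn r ((QUS.Retract.pi R).dec ω)
  measurable_enc := (QUS.Retract.pi R).measurable_enc.comp (measurable_fn (piLift q))
  dec_mem := r.hom.map_mem _ (QUS.Retract.pi R).dec_mem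
  dec_enc m := (congrArg (fn r) ((QUS.Retract.pi R).dec_enc _)).trans (hr m)

/-- The coordinates of the code of a point of `M` are coordinates of codes of its images, so they
are measurable for the cylinder `σ`-algebra, which is smaller than the one of `M`. -/
theorem measurable_towerRetract_enc (R : ∀ n, QUS.Retract (Z n).obj)
    (hr : ∀ m, fn r (fn (piLift q) m) = m) :
    Measurable[MeasurableSpace.generateFrom (cylinders q)]
      fun m : M.carrier => Omega.toSeq ((towerRetract R hr).enc m) := by
  refine @measurable_pi_lambda _ _ _ (_) _ _ fun l => ?_
  change Measurable[MeasurableSpace.generateFrom (cylinders q)] fun m : M.carrier =>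
    ((Encodable.decode l : Option (ℕ × ℕ)).map fun i =>
      Omega.toSeq ((R i.1).enc (fn (q i.1) m)) i.2).getD 0
  rcases (Encodable.decode l : Option (ℕ × ℕ)) with _ | ⟨n, k⟩
  · exact @measurable_const _ _ _ (_) _
  · intro S hS
    exact MeasurableSpace.measurableSet_generateFrom ⟨n, _,
      ((Omega.measurable_apply k).comp (R n).measurable_enc) hS, rfl⟩

/-- A probability measure on `M` is determined by its finite-dimensional marginals. -/
theorem measure_eq_of_map_tower (R : ∀ n, QUS.Retract (Z n).obj)
    (hr : ∀ m, fn r (fn (piLift q) m) = m) (hq : ∀ n, q (n + 1) ≫ p n = q n)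
    {μ ν : Measure M.carrier} [IsProbabilityMeasure μ] [IsProbabilityMeasure ν]
    (h : ∀ n, μ.map (fn (q n)) = ν.map (fn (q n))) : μ = ν := by
  refine (towerRetract R hr).measure_eq (Measure.ext fun S hS => ?_)
  have hm := measurable_towerRetract_enc R hr
  have hm' : Measurable fun m : M.carrier => Omega.toSeq ((towerRetract R hr).enc m) :=
    hm.mono (generateFrom_cylinders_le q) le_rfl
  rw [Measure.map_apply hm' hS, Measure.map_apply hm' hS]
  refine ext_on_measurableSpace_of_generate_finite _ (cylinders q) ?_ (generateFrom_cylinders_le q)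
    rfl (isPiSystem_cylinders hq) (by simp) (hm hS)
  rintro _ ⟨n, T, hT, rfl⟩
  rw [← Measure.map_apply (measurable_fn _) hT, h, Measure.map_apply (measurable_fn _) hT]

/-- A family of probability measures on `M` is measurable as soon as its finite-dimensional
marginals are. -/
theorem measurable_measure_tower (R : ∀ n, QUS.Retract (Z n).obj)
    (hr : ∀ m, fn r (fn (piLift q) m) = m) (hq : ∀ n, q (n + 1) ≫ p n = q n) {T : UQUS.{u}}
    {κ : T.carrier → Measure M.carrier} (hκ : ∀ t, IsProbabilityMeasure (κ t))
    (h : ∀ n, Measurable fun t => (κ t).map (fn (q n))) : Measurable κ := by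
  have hle := generateFrom_cylinders_le q
  have hm := measurable_towerRetract_enc R hr
  have hm' : Measurable fun m : M.carrier => Omega.toSeq ((towerRetract R hr).enc m) :=
    hm.mono hle le_rfl
  have hp : ∀ t, IsProbabilityMeasure ((κ t).trim hle) := fun t =>
    ⟨by rw [trim_measurableSet_eq hle MeasurableSet.univ]; exact measure_univ⟩
  have h1 : Measurable fun t => (κ t).trim hle := by
    refine Measurable.measure_of_isPiSystem_of_isProbabilityMeasure rfl (isPiSystem_cylinders hq) ?_
    rintro _ ⟨n, S, hS, rfl⟩
    have h2 := (Measure.measurable_coe hS).comp (h n)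
    convert! h2 using 2 with t
    refine (trim_measurableSet_eq hle (MeasurableSpace.measurableSet_generateFrom
      ⟨n, S, hS, rfl⟩)).trans ?_
    exact (Measure.map_apply (measurable_fn _) hS).symm
  refine (towerRetract R hr).measurable_measure (T := T.obj) hκ ?_
  refine Measure.measurable_of_measurable_coe _ fun S hS => ?_
  have h2 := (Measure.measurable_coe (hm hS)).comp h1
  convert! h2 using 2 with t
  exact (Measure.map_apply hm' hS).trans (trim_measurableSet_eq hle (hm hS)).symm

end Tower

namespace Kern

open ComonObj MarkovCategory ProbabilityTheory

/-- Universal property of the space of threads of a tower for Markov kernels. The space `M` is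
identified with the threads by the maps `q` and `r`. -/
theorem existsUnique_tower {Z : ℕ → UQUS.{u}} {p : ∀ n, Z (n + 1) ⟶ Z n} {M : UQUS.{u}}
    {q : ∀ n, M ⟶ Z n} {r : pi Z ⟶ M} (hr : ∀ m, fn r (fn (piLift q) m) = m)
    (hq : ∀ n, q (n + 1) ≫ p n = q n)
    (hqr : ∀ z, (∀ n, fn (p n) (fn (proj Z (n + 1)) z) = fn (proj Z n) z) →
      ∀ n, fn (q n) (fn r z) = fn (proj Z n) z)
    {A : Kern.{u}} (f : ∀ n, A ⟶ Kleisli.mk prob (Z n)) (hf : ∀ n, f (n + 1) ≫ pure (p n) = f n) :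
    ∃! g : A ⟶ Kleisli.mk prob M, ∀ n, g ≫ pure (q n) = f n := by
  have heval : ∀ {X Y : UQUS.{u}} (g : A ⟶ Kleisli.mk prob X) (φ : X ⟶ Y) a,
      eval (g ≫ pure φ) a = (eval g a).map (fn φ) := fun g φ a =>
    measure_ext fun F hF => (lintegral_comp_pure g φ a hF).trans
      (lintegral_map hF (measurable_fn φ)).symm
  have hκ : ∀ a, ∃ κ : Measure M.carrier, IsProbabilityMeasure κ ∧
      ∀ n, κ.map (fn (q n)) = eval (f n) a := by
    intro a
    obtain ⟨m, hm, hc, hmf⟩ := exists_measure_pi Z p (fun n => eval (f n) a)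
      (hμ := fun n => isProbabilityMeasure_eval (f n) a)
      (fun n => (heval (f (n + 1)) (p n) a).symm.trans (congrArg (eval · a) (hf n)))
    refine ⟨m.map (fn r), Measure.isProbabilityMeasure_map (measurable_fn r).aemeasurable,
      fun n => ?_⟩
    rw [Measure.map_map (measurable_fn _) (measurable_fn _), ← hmf n]
    refine Measure.map_congr ?_
    filter_upwards [hc] with z hz using hqr z hz n
  choose κ hκp hκ using hκ
  have hR : Nonempty A.pt → Nonempty (∀ n, QUS.Retract (Z n).obj) := by
    rintro ⟨a⟩
    have hp := fun n => isProbabilityMeasure_eval (f n) a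
    exact ⟨fun n => ((Z n).property.retract
      (nonempty_of_isProbabilityMeasure (eval (f n) a)).some).some⟩
  have hκm : Measurable κ := by
    rcases isEmpty_or_nonempty A.pt with hA | hA
    · intro S _
      rw [Set.eq_empty_of_isEmpty (_ ⁻¹' S)]
      exact MeasurableSet.empty
    · obtain ⟨R⟩ := hR hA
      refine measurable_measure_tower R hr hq hκp fun n => ?_
      simp only [hκ]
      exact measurable_eval (f n)
  refine ⟨.mk (UQUS.ofKernel κ hκp hκm), fun n => ext_eval fun a => ?_, fun g hg =>
    ext_eval fun a => ?_⟩
  · refine (heval _ (q n) a).trans (Eq.trans ?_ (hκ a n))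
    exact congrArg (Measure.map _) (toMeasure_ofKernel κ hκp hκm a)
  · obtain ⟨R⟩ := hR ⟨a⟩
    have h1 := isProbabilityMeasure_eval g a
    have h2 : eval g a = κ a := measure_eq_of_map_tower R hr hq fun n => by
      rw [hκ a n, ← hg n]
      exact (heval g (q n) a).symm
    exact h2.trans (toMeasure_ofKernel κ hκp hκm a).symm

/-- The projections of a product of a sequence to the finite products. -/
noncomputable def projFin (X : ℕ → Kern.{u}) : ∀ n, pi (fun n => (X n).of) ⟶ (finTensor X n).of
  | 0 => toUnit _
  | n + 1 => CartesianMonoidalCategory.lift (projFin X n) (proj (fun n => (X n).of) n)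

theorem dropLast_eq (X : ℕ → Kern.{u}) (n : ℕ) :
    dropLast X n = pure (CartesianMonoidalCategory.fst (finTensor X n).of (X n).of) :=
  whiskerLeft_discard _ _

/-- The space of threads of the finite products with a common factor `Y` is the product of the whole
sequence with `Y`. -/
theorem existsUnique_lift_tensor (X : ℕ → Kern.{u}) (Y A : Kern.{u})
    (f : ∀ n, A ⟶ finTensor X n ⊗ Y) (hf : ∀ n, f (n + 1) ≫ (dropLast X n ▷ Y) = f n) :
    ∃! g : A ⟶ Kleisli.mk prob (pi fun n => (X n).of) ⊗ Y,
      ∀ n, g ≫ (pure (projFin X n) ▷ Y) = f n := by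
  let Z : ℕ → UQUS.{u} := fun n => (finTensor X n).of ⊗ Y.of
  let p : ∀ n, Z (n + 1) ⟶ Z n := fun n =>
    CartesianMonoidalCategory.fst (finTensor X n).of (X n).of ▷ Y.of
  -- A thread is determined by the last factors of its terms and by its component in `Y`.
  let r : pi Z ⟶ (pi fun n => (X n).of) ⊗ Y.of :=
    CartesianMonoidalCategory.lift
      (piLift fun n => proj Z (n + 1) ≫
        CartesianMonoidalCategory.fst ((finTensor X n).of ⊗ (X n).of) Y.of ≫
        CartesianMonoidalCategory.snd (finTensor X n).of (X n).of)
      (proj Z 0 ≫ CartesianMonoidalCategory.snd _ _)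
  have hr : ∀ m, fn r (fn (piLift fun n => projFin X n ▷ Y.of) m) = m := fun _ => rfl
  have hqr : ∀ z, (∀ n, fn (p n) (fn (proj Z (n + 1)) z) = fn (proj Z n) z) →
      ∀ n, fn (projFin X n ▷ Y.of) (fn r z) = fn (proj Z n) z := by
    intro z hz n
    induction n with
    | zero => rfl
    | succ n ih =>
      have h1 := ih.trans (hz n).symm
      exact congrArg (fun w : (Z n).carrier => (UQUS.pair (UQUS.pair
        (fn (CartesianMonoidalCategory.fst (finTensor X n).of Y.of) w)
        (fn (CartesianMonoidalCategory.snd (finTensor X n).of (X n).of)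
          (fn (CartesianMonoidalCategory.fst ((finTensor X n).of ⊗ (X n).of) Y.of)
            (fn (proj Z (n + 1)) z))))
        (fn (CartesianMonoidalCategory.snd (finTensor X n).of Y.of) w) : (Z (n + 1)).carrier)) h1
  have h := existsUnique_tower (A := A) (q := fun n => projFin X n ▷ Y.of) hr (fun _ => rfl) hqr f
    fun n => by
      rw [← hf n, dropLast_eq]
      exact congrArg (f (n + 1) ≫ ·) (whiskerRight_pure _ Y).symm
  simp only [whiskerRight_pure]
  exact h

theorem hasKolmogorovProducts : HasKolmogorovProducts Kern.{u} := by
  refine fun X => ⟨Kleisli.mk prob (pi fun n => (X n).of), fun n => pure (projFin X n),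
    fun n => deterministic_pure _, fun n => ?_, fun A f hf => ?_, existsUnique_lift_tensor X⟩
  · rw [dropLast_eq]
    exact pure_comp (projFin X (n + 1)) _
  -- The case without a factor `Y` is the case of the unit object, up to the right unitors.
  · obtain ⟨g, hg, hu⟩ := existsUnique_lift_tensor X (𝟙_ Kern.{u}) A
      (fun n => f n ≫ (ρ_ (finTensor X n)).inv) fun n => by
        rw [Category.assoc, ← rightUnitor_inv_naturality, ← Category.assoc, hf]
    have h : ∀ g', (∀ n, g' ≫ (pure (projFin X n) ▷ 𝟙_ Kern.{u}) =
        f n ≫ (ρ_ (finTensor X n)).inv) ↔ ∀ n, (g' ≫ (ρ_ _).hom) ≫ pure (projFin X n) = f n :=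
      fun g' => forall_congr' fun n => by
        rw [Iso.eq_comp_inv, Category.assoc, Category.assoc, rightUnitor_naturality]
    refine ⟨g ≫ (ρ_ _).hom, (h g).1 hg, fun g' hg' => ?_⟩
    rw [← hu (g' ≫ (ρ_ _).inv) ((h _).2 ?_), Category.assoc, Iso.inv_hom_id, Category.comp_id]
    rw [Category.assoc, Iso.inv_hom_id, Category.comp_id]
    exact hg'

end Kern

end UQUS

theorem mainTheorem10 :
    (Nonempty (IsTerminal (𝟙_ UQUS.{u})) ∧
      (∀ X Y : UQUS.{u}, Nonempty (IsLimit
        (BinaryFan.mk (CartesianMonoidalCategory.fst X Y) (CartesianMonoidalCategory.snd X Y)))) ∧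
      (∀ X Y : UQUS.{u}, (β_ X Y).hom ≫ (β_ Y X).hom = 𝟙 (X ⊗ Y)) ∧
      IsEmpty (MonoidalClosed UQUS.{u}) ∧
      HasCountableProducts UQUS.{u} ∧ HasCountableCoproducts UQUS.{u}) ∧
    ∃ (hP : UQUS.ProbClosed.{u}) (τ : Monad.StrengthMap (UQUS.probMonad hP)),
      UQUS.IsProductStrength τ ∧
      Monad.IsStrength (UQUS.probMonad hP) τ ∧
      Monad.IsCommutative τ ∧
      Monad.IsAffine (UQUS.probMonad hP) ∧
      Monad.IsSymmetricMonoidal τ ∧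
      ∃ hM : IsMonoidalStruct (Kleisli.monoidalStruct (UQUS.probMonad hP) τ),
        letI := monoidalOfStruct _ hM
        ∃ K : MarkovCategory (Kleisli (UQUS.probMonad hP)),
          Kleisli.IsCanonicalMarkov (UQUS.probMonad hP) τ hM K ∧
          MarkovCategory.IsASCompatiblyRepresentable (Kleisli (UQUS.probMonad hP)) ∧
          MarkovCategory.HasConditionals (Kleisli (UQUS.probMonad hP)) ∧
          MarkovCategory.HasKolmogorovProducts (Kleisli (UQUS.probMonad hP)) := by
  refine ⟨⟨⟨UQUS.isTerminalUnit⟩, fun X Y => ⟨tensorProductIsBinaryProduct X Y⟩,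
      fun X Y => SymmetricCategory.symmetry X Y, UQUS.isEmpty_monoidalClosed,
      UQUS.hasCountableProducts, UQUS.hasCountableCoproducts⟩,
    UQUS.probClosed, UQUS.strength, UQUS.isProductStrength, UQUS.isStrength, UQUS.isCommutative,
    UQUS.isAffine, UQUS.isSymmetricMonoidal, UQUS.Kern.isMonoidal, inferInstance,
    UQUS.Kern.isCanonicalMarkov, UQUS.Kern.isASCompatiblyRepresentable,
    UQUS.Kern.hasConditionals, UQUS.Kern.hasKolmogorovProducts⟩
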